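/- Let $d\ge 1$, $s\ge 0$ and $\eta,q\in[2,\infty)$; all functions and distributions on $\mathbb R^d$ are real-valued. Let $\dot H^{-s,q}(\mathbb R^d)$ be the homogeneous Bessel potential space of all $F\in\mathcal S'(\mathbb R^d)/\mathcal P$ (tempered distributions modulo polynomials) with $\|F\|_{\dot H^{-s,q}(\mathbb R^d)}:=\|(-\Delta)^{-s/2}F\|_{L^q(\mathbb R^d)}<\infty$. For a probability space carrying a sequence $(\gamma_n)_{n\ge1}$ of independent standard Gaussian random variables, and an orthonormal basis $(h_n)_{n\ge1}$ of $L^2(\mathbb R^d)$, a bounded linear operator $T:L^2(\mathbb R^d)\to X$ is called $\gamma$-radonifying, $T\in\gamma(L^2(\mathbb R^d),X)$, if $\sum_{n\ge1}\gamma_nTh_n$ converges in $L^2(\Omega;X)$, and then $\|T\|_{\gamma(L^2(\mathbb R^d),X)}:=\big(\mathbb E\|\sum_{n\ge1}\gamma_nTh_n\|_X^2\big)^{1/2}$. For $g\in L^\eta(\mathbb R^d)$ let $M_g:h\mapsto gh$ be the multiplication operator by $g$. Then the following are equivalent: (1) There is a constant $C$ such that for all $g\in L^\eta(\mathbb R^d)$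 one has $M_g\in\gamma(L^2(\mathbb R^d),\dot H^{-s,q}(\mathbb R^d))$ and $$\|M_g\|_{\gamma(L^2(\mathbb R^d),\dot H^{-s,q}(\mathbb R^d))}\le C\,\|g\|_{L^\eta(\mathbb R^d)}.$$ (2) $$\frac sd+\frac1q=\frac1\eta+\frac12,\qquad s\in\Big(\frac d2,d\Big),\qquad \eta\in(2,q).$$ In case (2), the constant $C$ in (1) can be chosen depending only on $d,s,q,\eta$ (and not on the probability space, $(\gamma_n)$ or $(h_n)$). -/

import Mathlib

open MeasureTheory ProbabilityTheory Filter Topology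
open scoped ENNReal NNReal SchwartzMap FourierTransform

noncomputable section

namespace HomSob

/-- The Euclidean space `ℝᵈ`. -/
abbrev Rd (d : ℕ) : Type := EuclideanSpace ℝ (Fin d)

/-- Real tempered distributions `𝓢'(ℝᵈ)`: continuous linear functionals on the space of real-valued
Schwartz functions. -/
abbrev TempDist (d : ℕ) : Type := 𝓢(Rd d, ℝ) →L[ℝ] ℝ

/-! ### Functions as tempered distributions -/

/-- The tempered distribution `φ ↦ ∫ φ f` defined by `f ∈ Lᵖ(ℝᵈ)`, `1 ≤ p ≤ ∞`
(by Hölder's inequality). -/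
def ofLp {d : ℕ} {p : ℝ≥0∞} [hp : Fact (1 ≤ p)] :
    Lp ℝ p (volume : Measure (Rd d)) →ₗ[ℝ] TempDist d :=
  haveI := ENNReal.HolderConjugate.inv_one_sub_inv' hp.out
  haveI : Fact (1 ≤ (1 - p⁻¹)⁻¹) := by simp [fact_iff]
  { toFun := fun f =>
      ((ContinuousLinearMap.lsmul ℝ ℝ).flip.lpPairing volume p (1 - p⁻¹)⁻¹ f) ∘L
        SchwartzMap.toLpCLM ℝ ℝ (1 - p⁻¹)⁻¹ volume
    map_add' := fun f g => by ext φ; simp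
    map_smul' := fun c f => by ext φ; simp }

theorem ofLp_apply {d : ℕ} {p : ℝ≥0∞} [hp : Fact (1 ≤ p)]
    (f : Lp ℝ p (volume : Measure (Rd d))) (φ : 𝓢(Rd d, ℝ)) :
    ofLp f φ = ∫ x, φ x * f x := by
  have := ENNReal.HolderConjugate.inv_one_sub_inv' hp.out
  have : Fact (1 ≤ (1 - p⁻¹)⁻¹) := by simp [fact_iff]
  change ((ContinuousLinearMap.lsmul ℝ ℝ).flip.lpPairing volume p (1 - p⁻¹)⁻¹ f)
    (SchwartzMap.toLpCLM ℝ ℝ (1 - p⁻¹)⁻¹ volume φ) = _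
  rw [ContinuousLinearMap.lpPairing_eq_integral]
  apply integral_congr_ae
  filter_upwards [φ.coeFn_toLp (1 - p⁻¹)⁻¹ volume] with x hx
  simp only [SchwartzMap.toLpCLM_apply, hx]
  simp

theorem hasTemperateGrowth_eval {d : ℕ} (P : MvPolynomial (Fin d) ℝ) :
    Function.HasTemperateGrowth (fun x : Rd d => MvPolynomial.eval (fun i => x i) P) := by
  induction P using MvPolynomial.induction_on with
  | C a => simp
  | add p q hp hq =>
    simp only [map_add]
    exact hp.add hq
  | mul_X p i hp =>
    have hi : Function.HasTemperateGrowth (fun x : Rd d => x i) :=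
      (EuclideanSpace.proj i : Rd d →L[ℝ] ℝ).hasTemperateGrowth
    simp only [map_mul, MvPolynomial.eval_X]
    exact hp.mul hi

/-- The tempered distribution `φ ↦ ∫ φ P` defined by a real polynomial `P` on `ℝᵈ`. -/
def ofPoly {d : ℕ} (P : MvPolynomial (Fin d) ℝ) : TempDist d :=
  (SchwartzMap.integralCLM ℝ volume) ∘L
    (SchwartzMap.bilinLeftCLM (ContinuousLinearMap.lsmul ℝ ℝ) (hasTemperateGrowth_eval P))

theorem ofPoly_apply {d : ℕ} (P : MvPolynomial (Fin d) ℝ) (φ : 𝓢(Rd d, ℝ)) :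
    ofPoly P φ = ∫ x, φ x * MvPolynomial.eval (fun i => x i) P := rfl

/-! ### Tempered distributions modulo polynomials -/

/-- The subspace `𝓟` of `𝓢'(ℝᵈ)` of all real polynomials. -/
def polys (d : ℕ) : Submodule ℝ (TempDist d) where
  carrier := Set.range ofPoly
  zero_mem' := ⟨0, by ext φ; simp [ofPoly_apply]⟩
  add_mem' := by
    rintro _ _ ⟨P, rfl⟩ ⟨Q, rfl⟩
    refine ⟨P + Q, ?_⟩
    ext φ
    have hi : ∀ R : MvPolynomial (Fin d) ℝ,
        Integrable (fun x : Rd d => φ x * MvPolynomial.eval (fun i => x i) R) := fun R =>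
      (SchwartzMap.bilinLeftCLM (ContinuousLinearMap.lsmul ℝ ℝ)
        (hasTemperateGrowth_eval R) φ).integrable
    simp only [ofPoly_apply, add_apply, map_add, mul_add]
    exact integral_add (hi P) (hi Q)
  smul_mem' := by
    rintro c _ ⟨P, rfl⟩
    refine ⟨c • P, ?_⟩
    ext φ
    simp only [ofPoly_apply, smul_apply, MvPolynomial.smul_eval, smul_eq_mul,
      ← integral_const_mul]
    congr 1
    ext x
    ring

/-- The space `𝓢'(ℝᵈ) / 𝓟` of tempered distributions modulo polynomials. -/
abbrev TempDistModPoly (d : ℕ) : Type := TempDist d ⧸ polys d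

/-- `𝓢₀(ℝᵈ)`: the Schwartz functions all of whose moments vanish. -/
def schwartzZero (d : ℕ) : Set 𝓢(Rd d, ℝ) :=
  {φ | ∀ P : MvPolynomial (Fin d) ℝ, ∫ x, φ x * MvPolynomial.eval (fun i => x i) P = 0}

/-- The duality pairing `F ↦ ⟨F, φ⟩` of `𝓢'(ℝᵈ) / 𝓟` with a function `φ ∈ 𝓢₀(ℝᵈ)`. -/
def pairing {d : ℕ} (φ : 𝓢(Rd d, ℝ)) (hφ : φ ∈ schwartzZero d) :
    TempDistModPoly d →ₗ[ℝ] ℝ :=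
  (polys d).liftQ
    { toFun := fun f => f φ, map_add' := fun _ _ => rfl, map_smul' := fun _ _ => rfl } (by
      rintro _ ⟨P, rfl⟩
      exact hφ P)

theorem pairing_mk {d : ℕ} (φ : 𝓢(Rd d, ℝ)) (hφ : φ ∈ schwartzZero d) (f : TempDist d) :
    pairing φ hφ (Submodule.Quotient.mk f) = f φ := rfl

/-! ### The fractional Laplacian and homogeneous Bessel potential spaces -/

/-- `ψ = (-Δ)^{σ/2} φ` for Schwartz functions: `ψ̂(ξ) = (2π|ξ|)^σ φ̂(ξ)`, with the convention
`φ̂(ξ) = ∫ e^{-2πi x·ξ} φ(x) dx`. Every `φ ∈ 𝓢₀(ℝᵈ)` has exactly one such `ψ ∈ 𝓢₀(ℝᵈ)`. -/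
def IsFracLaplace {d : ℕ} (σ : ℝ) (φ ψ : 𝓢(Rd d, ℝ)) : Prop :=
  ∀ ξ : Rd d, 𝓕 (fun x => (ψ x : ℂ)) ξ =
    (((2 * Real.pi * ‖ξ‖) ^ σ : ℝ) : ℂ) * 𝓕 (fun x => (φ x : ℂ)) ξ

/-- `(-Δ)^{σ/2} F = u` in `𝓢'(ℝᵈ) / 𝓟`, for `F ∈ 𝓢'(ℝᵈ) / 𝓟` and `u ∈ L^q(ℝᵈ)`. As usual,
`(-Δ)^{σ/2} F` is defined by duality: `⟨(-Δ)^{σ/2} F, φ⟩ = ⟨F, (-Δ)^{σ/2} φ⟩`, `φ ∈ 𝓢₀(ℝᵈ)`. -/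
def FracLaplaceEq {d : ℕ} (σ : ℝ) {q : ℝ≥0∞} [Fact (1 ≤ q)] (F : TempDistModPoly d)
    (u : Lp ℝ q (volume : Measure (Rd d))) : Prop :=
  ∀ (φ ψ : 𝓢(Rd d, ℝ)) (_ : φ ∈ schwartzZero d) (hψ : ψ ∈ schwartzZero d),
    IsFracLaplace σ φ ψ → pairing ψ hψ F = ofLp u φ

theorem FracLaplaceEq.add {d : ℕ} {σ : ℝ} {q : ℝ≥0∞} [Fact (1 ≤ q)] {F G : TempDistModPoly d}
    {u v : Lp ℝ q (volume : Measure (Rd d))} (hF : FracLaplaceEq σ F u)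
    (hG : FracLaplaceEq σ G v) : FracLaplaceEq σ (F + G) (u + v) := by
  intro φ ψ hφ hψ h
  rw [map_add, map_add, hF φ ψ hφ hψ h, hG φ ψ hφ hψ h, add_apply]

theorem FracLaplaceEq.smul {d : ℕ} {σ : ℝ} {q : ℝ≥0∞} [Fact (1 ≤ q)] {F : TempDistModPoly d}
    {u : Lp ℝ q (volume : Measure (Rd d))} (c : ℝ) (hF : FracLaplaceEq σ F u) :
    FracLaplaceEq σ (c • F) (c • u) := by
  intro φ ψ hφ hψ h
  rw [map_smul, map_smul, hF φ ψ hφ hψ h, smul_apply]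

theorem FracLaplaceEq.zero {d : ℕ} {σ : ℝ} {q : ℝ≥0∞} [Fact (1 ≤ q)] :
    FracLaplaceEq σ (0 : TempDistModPoly d) (0 : Lp ℝ q (volume : Measure (Rd d))) := by
  intro φ ψ hφ hψ _
  rw [map_zero, map_zero, zero_apply]

/-- The set of all `F ∈ 𝓢'(ℝᵈ) / 𝓟` with `(-Δ)^{σ/2} F ∈ L^q(ℝᵈ)`, as a linear subspace. -/
def homSobolevSubmodule (d : ℕ) (σ : ℝ) (q : ℝ≥0∞) [Fact (1 ≤ q)] :
    Submodule ℝ (TempDistModPoly d) where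
  carrier := {F | ∃ u : Lp ℝ q (volume : Measure (Rd d)), FracLaplaceEq σ F u}
  zero_mem' := ⟨0, FracLaplaceEq.zero⟩
  add_mem' := by
    rintro F G ⟨u, hu⟩ ⟨v, hv⟩
    exact ⟨u + v, hu.add hv⟩
  smul_mem' := by
    rintro c F ⟨u, hu⟩
    exact ⟨c • u, hu.smul c⟩

/-- The homogeneous Bessel potential space `Ḣ^{σ,q}(ℝᵈ)`. It is a type of its own, so that it does
not inherit the topology of `𝓢'(ℝᵈ) / 𝓟`. -/
def HomSobolev (d : ℕ) (σ : ℝ) (q : ℝ≥0∞) [Fact (1 ≤ q)] : Type :=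
  homSobolevSubmodule d σ q

namespace HomSobolev

variable {d : ℕ} {σ : ℝ} {q : ℝ≥0∞} [Fact (1 ≤ q)]

instance : AddCommGroup (HomSobolev d σ q) :=
  inferInstanceAs (AddCommGroup (homSobolevSubmodule d σ q))

instance : Module ℝ (HomSobolev d σ q) :=
  inferInstanceAs (Module ℝ (homSobolevSubmodule d σ q))

/-- The inclusion `Ḣ^{σ,q}(ℝᵈ) ⊆ 𝓢'(ℝᵈ) / 𝓟`. -/
def incl : HomSobolev d σ q →ₗ[ℝ] TempDistModPoly d := (homSobolevSubmodule d σ q).subtype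

/-- The functions `u ∈ L^q(ℝᵈ)` with `u = (-Δ)^{σ/2} F`. For `q < ∞` there is exactly one. -/
abbrev Rep (F : HomSobolev d σ q) : Type :=
  {u : Lp ℝ q (volume : Measure (Rd d)) // FracLaplaceEq σ (incl F) u}

instance (F : HomSobolev d σ q) : Nonempty (Rep F) :=
  let ⟨u, hu⟩ := F.2
  ⟨⟨u, hu⟩⟩

/-- `‖F‖ = ‖(-Δ)^{σ/2} F‖_{L^q}`. The infimum runs over the one function `u ∈ L^q(ℝᵈ)` that is equal
to `(-Δ)^{σ/2} F` modulo polynomials (`q < ∞`); for `q = ∞`, it is the quotient norm. -/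
instance : Norm (HomSobolev d σ q) := ⟨fun F => ⨅ u : Rep F, ‖u.1‖⟩

theorem norm_def (F : HomSobolev d σ q) : ‖F‖ = ⨅ u : Rep F, ‖u.1‖ := rfl

theorem norm_le {F : HomSobolev d σ q} {u : Lp ℝ q (volume : Measure (Rd d))}
    (hu : FracLaplaceEq σ (incl F) u) : ‖F‖ ≤ ‖u‖ :=
  ciInf_le (f := fun u : Rep F => ‖u.1‖) ⟨0, by rintro _ ⟨v, rfl⟩; exact norm_nonneg _⟩ ⟨u, hu⟩

theorem norm_nonneg' (F : HomSobolev d σ q) : 0 ≤ ‖F‖ :=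
  le_ciInf fun _ => norm_nonneg _

theorem norm_smul_le' (c : ℝ) (F : HomSobolev d σ q) : ‖c • F‖ ≤ ‖c‖ * ‖F‖ := by
  rw [norm_def F, Real.mul_iInf_of_nonneg (norm_nonneg c)]
  refine le_ciInf fun u => ?_
  rw [← norm_smul]
  exact norm_le (u.2.smul c)

theorem seminormCore : SeminormedSpace.Core ℝ (HomSobolev d σ q) where
  norm_nonneg := norm_nonneg'
  norm_smul c F := by
    refine le_antisymm (norm_smul_le' c F) ?_
    rcases eq_or_ne c 0 with rfl | hc
    · simpa using norm_nonneg' _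
    · have h := norm_smul_le' c⁻¹ (c • F)
      rw [smul_smul, inv_mul_cancel₀ hc, one_smul, norm_inv] at h
      have hc' : 0 < ‖c‖ := norm_pos_iff.mpr hc
      calc ‖c‖ * ‖F‖ ≤ ‖c‖ * (‖c‖⁻¹ * ‖c • F‖) := by gcongr
        _ = ‖c • F‖ := by field_simp
  norm_triangle F G := by
    refine le_of_forall_pos_le_add fun ε hε => ?_
    obtain ⟨u, hu⟩ := exists_lt_of_ciInf_lt (show (⨅ u : Rep F, ‖u.1‖) < ‖F‖ + ε / 2 by
      rw [← norm_def]; linarith)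
    obtain ⟨v, hv⟩ := exists_lt_of_ciInf_lt (show (⨅ v : Rep G, ‖v.1‖) < ‖G‖ + ε / 2 by
      rw [← norm_def]; linarith)
    have h1 : ‖F + G‖ ≤ ‖u.1 + v.1‖ := norm_le (u.2.add v.2)
    have h2 := norm_add_le u.1 v.1
    linarith

instance : SeminormedAddCommGroup (HomSobolev d σ q) :=
  SeminormedAddCommGroup.ofCore seminormCore

instance : NormedSpace ℝ (HomSobolev d σ q) where
  norm_smul_le := norm_smul_le'

end HomSobolev

/-! ### Multiplication operators -/

/-- Multiplication by `g ∈ L^η(ℝᵈ)`, `η ≥ 2`, as a linear map `L²(ℝᵈ) → 𝓢'(ℝᵈ)`. The product `g h`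
belongs to `Lᵖ(ℝᵈ)`, where `1/p = 1/η + 1/2 ≤ 1`. -/
def mulDist {d : ℕ} {η : ℝ≥0∞} (hη : 2 ≤ η) (g : Lp ℝ η (volume : Measure (Rd d))) :
    Lp ℝ 2 (volume : Measure (Rd d)) →ₗ[ℝ] TempDist d :=
  haveI : ENNReal.HolderTriple η 2 (η⁻¹ + 2⁻¹)⁻¹ := ⟨by simp⟩
  haveI : Fact (1 ≤ (η⁻¹ + 2⁻¹)⁻¹) := ⟨by
    rw [ENNReal.one_le_inv]
    calc η⁻¹ + 2⁻¹ ≤ 2⁻¹ + 2⁻¹ := by gcongr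
      _ = 1 := ENNReal.inv_two_add_inv_two⟩
  ofLp (p := (η⁻¹ + 2⁻¹)⁻¹) ∘ₗ
    (ContinuousLinearMap.lsmul ℝ ℝ).holderₗ volume η 2 (η⁻¹ + 2⁻¹)⁻¹ g

theorem mulDist_apply {d : ℕ} {η : ℝ≥0∞} (hη : 2 ≤ η) (g : Lp ℝ η (volume : Measure (Rd d)))
    (h : Lp ℝ 2 (volume : Measure (Rd d))) (φ : 𝓢(Rd d, ℝ)) :
    mulDist hη g h φ = ∫ x, φ x * (g x * h x) := by
  have : ENNReal.HolderTriple η 2 (η⁻¹ + 2⁻¹)⁻¹ := ⟨by simp⟩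
  have : Fact (1 ≤ (η⁻¹ + 2⁻¹)⁻¹) := ⟨by
    rw [ENNReal.one_le_inv]
    calc η⁻¹ + 2⁻¹ ≤ 2⁻¹ + 2⁻¹ := by gcongr
      _ = 1 := ENNReal.inv_two_add_inv_two⟩
  change ofLp ((ContinuousLinearMap.lsmul ℝ ℝ).holder (η⁻¹ + 2⁻¹)⁻¹ g h) φ = _
  rw [ofLp_apply]
  apply integral_congr_ae
  filter_upwards [(ContinuousLinearMap.lsmul ℝ ℝ).coeFn_holder (r := (η⁻¹ + 2⁻¹)⁻¹) g h]
    with x hx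
  rw [hx]
  simp

/-- The operator `T : L²(ℝᵈ) → Ḣ^{σ,q}(ℝᵈ)` is the multiplication operator `M_g : h ↦ g h`. -/
def IsMul {d : ℕ} {σ : ℝ} {η q : ℝ≥0∞} [Fact (1 ≤ q)] (hη : 2 ≤ η)
    (g : Lp ℝ η (volume : Measure (Rd d)))
    (T : Lp ℝ 2 (volume : Measure (Rd d)) →L[ℝ] HomSobolev d σ q) : Prop :=
  ∀ h, HomSobolev.incl (T h) = Submodule.Quotient.mk (mulDist hη g h)

/-! ### `γ`-radonifying operators -/

section Gamma

variable {Ω : Type*} [MeasurableSpace Ω] {H X : Type*} [NormedAddCommGroup H]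
  [InnerProductSpace ℝ H] [SeminormedAddCommGroup X] [NormedSpace ℝ X]

/-- `(γ_n)` is a sequence of independent standard Gaussian random variables. -/
def IsGaussianSeq (Pr : Measure Ω) (γ : ℕ → Ω → ℝ) : Prop :=
  (∀ n, HasLaw (γ n) (gaussianReal 0 1) Pr) ∧ iIndepFun γ Pr

/-- The random variable `Y ∈ L²(Ω; X)` is the sum `∑ γ_n T h_n`, with convergence in `L²(Ω; X)`. -/
def IsGaussianSum (Pr : Measure Ω) (γ : ℕ → Ω → ℝ) (e : HilbertBasis ℕ ℝ H) (T : H →L[ℝ] X)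
    (Y : Ω → X) : Prop :=
  MemLp Y 2 Pr ∧
    Tendsto (fun N => eLpNorm (fun ω => (∑ n ∈ Finset.range N, γ n ω • T (e n)) - Y ω) 2 Pr)
      atTop (𝓝 0)

/-- `T ∈ γ(H, X)`: the series `∑ γ_n T h_n` converges in `L²(Ω; X)`. -/
def IsGammaRadonifying (Pr : Measure Ω) (γ : ℕ → Ω → ℝ) (e : HilbertBasis ℕ ℝ H)
    (T : H →L[ℝ] X) : Prop :=
  ∃ Y : Ω → X, IsGaussianSum Pr γ e T Y

/-- `‖T‖_{γ(H, X)} = (𝔼 ‖∑ γ_n T h_n‖²)^{1/2}`. All sums `Y` of the series have the same norm; the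
value is `∞` if the series does not converge. -/
def gammaNorm (Pr : Measure Ω) (γ : ℕ → Ω → ℝ) (e : HilbertBasis ℕ ℝ H) (T : H →L[ℝ] X) : ℝ≥0∞ :=
  ⨅ (Y : Ω → X) (_ : IsGaussianSum Pr γ e T Y), eLpNorm Y 2 Pr

end Gamma

/-- For every `g ∈ L^η(ℝᵈ)`, the operator `M_g` belongs to `γ(L²(ℝᵈ), Ḣ^{-s,q}(ℝᵈ))`, and
`‖M_g‖ ≤ C ‖g‖_{L^η}`. -/
def MulGammaBound {Ω : Type*} [MeasurableSpace Ω] (Pr : Measure Ω) (γ : ℕ → Ω → ℝ) {d : ℕ}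
    (e : HilbertBasis ℕ ℝ (Lp ℝ 2 (volume : Measure (Rd d)))) (s : ℝ) {η : ℝ≥0∞} (hη : 2 ≤ η)
    (q : ℝ≥0∞) [Fact (1 ≤ q)] (C : ℝ≥0) : Prop :=
  ∀ g : Lp ℝ η (volume : Measure (Rd d)),
    ∃ T : Lp ℝ 2 (volume : Measure (Rd d)) →L[ℝ] HomSobolev d (-s) q,
      IsMul hη g T ∧ IsGammaRadonifying Pr γ e T ∧ gammaNorm Pr γ e T ≤ C * ‖g‖ₑ

/-- The condition `s/d + 1/q = 1/η + 1/2`, `s ∈ (d/2, d)`, `η ∈ (2, q)`. -/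
def SharpExponents (d : ℕ) (s : ℝ) (η q : ℝ≥0) : Prop :=
  s / d + 1 / q = 1 / η + 1 / 2 ∧ s ∈ Set.Ioo ((d : ℝ) / 2) d ∧ η ∈ Set.Ioo 2 q

end HomSob

end

noncomputable section

namespace HomSob

/-! ### Riesz potentials and the Hardy–Littlewood–Sobolev inequality -/

/-! Sufficiency. Put `K(z) = c ‖z‖ ^ (s - d)`, the kernel of `(-Δ)^{-s/2}`. Since `q < ∞`, the
`γ`-norm into `L^q` is controlled by the `L^q` norm of the square function `(∑ |K * (g
e_n)|²)^{1/2}`: a scalar Gaussian sum has `q`-th moment equal to a constant times a power of its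
variance. For fixed `x`, the numbers `K * (g e_n)(x)` are the coefficients of `y ↦ K(x - y) g(y)` in
the basis, so Bessel's inequality bounds the squared square function by the Riesz potential of
`|g|²` with kernel `‖z‖ ^ (2 (s - d))`. The exponent identity together with `2 < η < q` is exactly
what the Hardy–Littlewood–Sobolev inequality from `L^{η/2}` to `L^{q/2}` needs (`rieszPot_bound`).

The series must converge in the homogeneous space itself, whose elements are classes of
distributions and whose completeness is not established. It is therefore summed in a complete space
of pairs `(u, v)` in `L^q × L^q` (`repPairs`), where `u = K * (g h)` carries the norm and `v = (1 -
Δ)^{-m}(g h)` records the distribution `g h = (1 - Δ)^m v`. The Bessel kernel is dominated by the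
Riesz kernel, so `v` obeys the same estimates as `u`. Both kernels are treated at once as
superpositions of heat kernels (`IsWeight`). The sum is then pushed forward by a continuous map
(`IsGaussianSeq.exists_isGaussianSum`).

Necessity. Take `g = 1_E` and pair with `ψ = (-Δ)^{-s/2} φ`, where the Fourier transform of `φ`
vanishes near the origin. Parseval's identity turns the `γ`-bound into a bound of `∫_E |ψ|²`, also
in an averaged form over families of such pairs (`MulGammaBound.testing`). Four choices of test
functions give the exponents. Dilating one pair forces the scaling identity. Averaging over
translates gives `∫_{B_R} |ψ|² ≤ K ‖φ‖_1² |B_R|^{2/η - 2/q}`, which excludes `η > q` as `R → ∞`. If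
`η = q`, then `s = d/2` and this would make `(-Δ)^{-d/4}` bounded from `L¹` to `L²`, which a
superposition of `N` dyadic annuli refutes. If `η = 2`, shrinking balls give `|ψ(0)| ≤ C ‖φ‖_p` with
`p = q'` and `s = d/p`, the false endpoint of the Sobolev embedding; superposing two distant scales
improves the constant of such a bound indefinitely. Finally `2 < η < q` and the scaling identity
place `s` in `(d/2, d)`. -/

theorem lintegral_comp_const_smul {d : ℕ} (f : Rd d → ℝ≥0∞) {c : ℝ} (hc : c ≠ 0) :
    ∫⁻ x, f (c • x) = ENNReal.ofReal ((|c| ^ d)⁻¹) * ∫⁻ x, f x := by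
  have h1 : ∫⁻ x, f (c • x) = ∫⁻ x, f x ∂(Measure.map (c • ·) (volume : Measure (Rd d))) := by
    have := lintegral_map_equiv (μ := (volume : Measure (Rd d))) f
      (Homeomorph.smulOfNeZero c hc).toMeasurableEquiv
    exact this.symm
  rw [h1, Measure.map_addHaar_smul _ hc, lintegral_smul_measure]
  simp [abs_inv, abs_pow]

theorem lintegral_comp_norm_div {d : ℕ} (f : ℝ → ℝ≥0∞) {δ : ℝ} (hδ : 0 < δ) :
    ∫⁻ x : Rd d, f (‖x‖ / δ) = ENNReal.ofReal (δ ^ d) * ∫⁻ x : Rd d, f ‖x‖ := by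
  have := lintegral_comp_const_smul (d := d) (fun x => f ‖x‖) (inv_ne_zero hδ.ne')
  simp only [norm_smul, Real.norm_eq_abs, abs_inv, abs_of_pos hδ] at this
  simp only [div_eq_inv_mul]
  rw [this]
  congr 2
  simp

/-- `‖x‖ ^ a` for `‖x‖ < δ`, and `0` otherwise. -/
def innerKernel (a δ t : ℝ) : ℝ≥0∞ := (Set.Iio δ).indicator (fun t => ENNReal.ofReal (t ^ a)) t

/-- `‖x‖ ^ a` for `‖x‖ ≥ δ`, and `0` otherwise. -/
def outerKernel (a δ t : ℝ) : ℝ≥0∞ := (Set.Ici δ).indicator (fun t => ENNReal.ofReal (t ^ a)) t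

@[fun_prop]
theorem measurable_innerKernel (a δ : ℝ) : Measurable (innerKernel a δ) := by
  unfold innerKernel
  exact (by fun_prop : Measurable fun t : ℝ => ENNReal.ofReal (t ^ a)).indicator measurableSet_Iio

@[fun_prop]
theorem measurable_outerKernel (a δ : ℝ) : Measurable (outerKernel a δ) := by
  unfold outerKernel
  exact (by fun_prop : Measurable fun t : ℝ => ENNReal.ofReal (t ^ a)).indicator measurableSet_Ici

theorem innerKernel_add_outerKernel (a δ t : ℝ) :
    innerKernel a δ t + outerKernel a δ t = ENNReal.ofReal (t ^ a) := by
  unfold innerKernel outerKernel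
  rcases lt_or_ge t δ with h | h
  · simp [h, not_le.2 h]
  · simp [h, not_lt.2 h]

theorem innerKernel_scale (a : ℝ) {δ t : ℝ} (hδ : 0 < δ) (ht : 0 ≤ t) :
    innerKernel a δ t = ENNReal.ofReal (δ ^ a) * innerKernel a 1 (t / δ) := by
  unfold innerKernel
  rcases lt_or_ge t δ with h | h
  · have h' : t / δ < 1 := (div_lt_one hδ).2 h
    rw [Set.indicator_of_mem (by exact h), Set.indicator_of_mem (by exact h'),
      ← ENNReal.ofReal_mul (by positivity), ← Real.mul_rpow hδ.le (by positivity),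
      mul_div_cancel₀ _ hδ.ne']
  · have h' : ¬ t / δ < 1 := not_lt.2 ((one_le_div hδ).2 h)
    rw [Set.indicator_of_notMem (by simpa using h), Set.indicator_of_notMem (by simpa using h'),
      mul_zero]

theorem outerKernel_scale (a : ℝ) {δ t : ℝ} (hδ : 0 < δ) :
    outerKernel a δ t = ENNReal.ofReal (δ ^ a) * outerKernel a 1 (t / δ) := by
  unfold outerKernel
  rcases lt_or_ge t δ with h | h
  · have h' : t / δ < 1 := (div_lt_one hδ).2 h
    rw [Set.indicator_of_notMem (by simpa using h), Set.indicator_of_notMem (by simpa using h'),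
      mul_zero]
  · have h' : 1 ≤ t / δ := (one_le_div hδ).2 h
    rw [Set.indicator_of_mem (by exact h), Set.indicator_of_mem (by exact h'),
      ← ENNReal.ofReal_mul (by positivity), ← Real.mul_rpow hδ.le (by positivity),
      mul_div_cancel₀ _ hδ.ne']

theorem lintegral_innerKernel {d : ℕ} (a : ℝ) {δ : ℝ} (hδ : 0 < δ) :
    ∫⁻ x : Rd d, innerKernel a δ ‖x‖ =
      ENNReal.ofReal (δ ^ (a + d)) * ∫⁻ x : Rd d, innerKernel a 1 ‖x‖ := by
  simp_rw [innerKernel_scale a hδ (norm_nonneg _)]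
  rw [lintegral_const_mul _ (by fun_prop), lintegral_comp_norm_div _ hδ, ← mul_assoc,
    ← ENNReal.ofReal_mul (by positivity), Real.rpow_add hδ, Real.rpow_natCast]

theorem lintegral_outerKernel {d : ℕ} (a : ℝ) {δ : ℝ} (hδ : 0 < δ) :
    ∫⁻ x : Rd d, outerKernel a δ ‖x‖ =
      ENNReal.ofReal (δ ^ (a + d)) * ∫⁻ x : Rd d, outerKernel a 1 ‖x‖ := by
  simp_rw [outerKernel_scale a hδ]
  rw [lintegral_const_mul _ (by fun_prop), lintegral_comp_norm_div _ hδ, ← mul_assoc,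
    ← ENNReal.ofReal_mul (by positivity), Real.rpow_add hδ, Real.rpow_natCast]

theorem lintegral_innerKernel_ne_top {d : ℕ} (hd : 1 ≤ d) {a : ℝ} (ha : -(d : ℝ) < a) :
    ∫⁻ x : Rd d, innerKernel a 1 ‖x‖ ≠ ∞ := by
  have : Nonempty (Fin d) := ⟨⟨0, hd⟩⟩
  have h : IntegrableOn (fun x : Rd d => ‖x‖ ^ a) (Metric.ball 0 1) volume := by
    rw [integrableOn_fun_norm_addHaar volume (f := fun t : ℝ => t ^ a)]
    rw [finrank_euclideanSpace_fin]
    have h2 : IntegrableOn (fun y : ℝ => y ^ (a + (d - 1))) (Set.Ioo 0 1) := by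
      rw [intervalIntegral.integrableOn_Ioo_rpow_iff zero_lt_one]
      linarith
    refine h2.congr_fun (fun y hy => ?_) measurableSet_Ioo
    simp only [smul_eq_mul]
    rw [Real.rpow_add hy.1, mul_comm, ← Real.rpow_natCast]
    push_cast [Nat.cast_sub hd]
    rfl
  have h3 := h.lintegral_lt_top
  rw [← lintegral_indicator Metric.isOpen_ball.measurableSet] at h3
  refine ne_of_lt (lt_of_eq_of_lt (lintegral_congr fun x => ?_) h3)
  by_cases hx : ‖x‖ < 1 <;> simp [innerKernel, hx]

theorem lintegral_outerKernel_ne_top {d : ℕ} (hd : 1 ≤ d) {a : ℝ} (ha : a < -(d : ℝ)) :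
    ∫⁻ x : Rd d, outerKernel a 1 ‖x‖ ≠ ∞ := by
  have : Nonempty (Fin d) := ⟨⟨0, hd⟩⟩
  have h : Integrable (fun x : Rd d => (Set.Ici (1 : ℝ)).indicator (fun t => t ^ a) ‖x‖) volume := by
    rw [integrable_fun_norm_addHaar volume (f := (Set.Ici (1 : ℝ)).indicator (fun t => t ^ a))]
    rw [finrank_euclideanSpace_fin]
    have h2 : IntegrableOn (fun y : ℝ => y ^ (a + (d - 1))) (Set.Ioi (1 / 2)) :=
      integrableOn_Ioi_rpow_of_lt (by linarith) (by norm_num)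
    have h3 : IntegrableOn (fun y : ℝ => y ^ (a + (d - 1))) (Set.Ici 1) :=
      h2.mono_set fun y (hy : 1 ≤ y) => by
        simp only [Set.mem_Ioi]; linarith
    rw [← integrable_indicator_iff measurableSet_Ici] at h3
    refine (h3.integrableOn (s := Set.Ioi 0)).congr_fun (fun y hy => ?_) measurableSet_Ioi
    by_cases h1 : 1 ≤ y
    · simp only [smul_eq_mul, Set.mem_Ici, h1, Set.indicator_of_mem]
      rw [Real.rpow_add hy, mul_comm, ← Real.rpow_natCast]
      push_cast [Nat.cast_sub hd]
      rfl
    · simp [h1]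
  refine ne_of_lt (lt_of_eq_of_lt (lintegral_congr fun x => ?_) h.lintegral_lt_top)
  by_cases hx : 1 ≤ ‖x‖ <;> simp [outerKernel, hx]

/-- The layer-cake integral. The value `x = ∞` is included because it is applied to Riesz potentials
before they are known to be finite. -/
theorem lintegral_Ioi_rpow_indicator {ρ : ℝ} (hρ : 0 < ρ) (x : ℝ≥0∞) :
    ∫⁻ u in Set.Ioi (0 : ℝ), {u | ENNReal.ofReal u < x}.indicator
      (fun u => ENNReal.ofReal (u ^ (ρ - 1))) u = x ^ ρ / ENNReal.ofReal ρ := by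
  have key : ∀ y : ℝ, 0 ≤ y → ∫⁻ u in Set.Ioo (0 : ℝ) y, ENNReal.ofReal (u ^ (ρ - 1)) =
      ENNReal.ofReal (y ^ ρ / ρ) := by
    intro y hy
    have hi : IntervalIntegrable (fun u : ℝ => u ^ (ρ - 1)) volume 0 y :=
      intervalIntegral.intervalIntegrable_rpow' (by linarith)
    rw [← ofReal_integral_eq_lintegral_ofReal
      ((intervalIntegrable_iff_integrableOn_Ioo_of_le hy).1 hi), ← integral_Ioc_eq_integral_Ioo,
      ← intervalIntegral.integral_of_le hy, integral_rpow (Or.inl (by linarith))]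
    · simp [hρ.ne']
    · filter_upwards [ae_restrict_mem measurableSet_Ioo] with u hu
      exact Real.rpow_nonneg hu.1.le _
  rcases eq_or_ne x ∞ with rfl | hx
  · rw [ENNReal.top_rpow_of_pos hρ, ENNReal.top_div_of_ne_top ENNReal.ofReal_ne_top]
    refine eq_top_iff.2 (le_of_tendsto' (f := fun n : ℕ => ENNReal.ofReal ((n : ℝ) ^ ρ / ρ))
      (x := atTop) ?_ fun n => ?_)
    · refine ENNReal.tendsto_ofReal_atTop.comp ?_
      exact ((tendsto_rpow_atTop hρ).comp tendsto_natCast_atTop_atTop).atTop_div_const hρ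
    · rw [← key n (by positivity)]
      refine (lintegral_mono_set (fun u hu => hu.1)).trans_eq (lintegral_congr fun u => ?_)
      simp
  · lift x to ℝ≥0 using hx
    have : ∀ u : ℝ, 0 < u → (ENNReal.ofReal u < x ↔ u < x) := fun u hu => by
      rw [ENNReal.ofReal_lt_iff_lt_toReal hu.le ENNReal.coe_ne_top]; simp
    have e : (x : ℝ≥0∞) ^ ρ / ENNReal.ofReal ρ = ENNReal.ofReal ((x : ℝ) ^ ρ / ρ) := by
      rw [← ENNReal.coe_rpow_of_nonneg _ hρ.le, ENNReal.ofReal_div_of_pos hρ, ← NNReal.coe_rpow, ENNReal.ofReal_coe_nnreal]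
    rw [e, ← key x x.2, ← lintegral_indicator measurableSet_Ioi,
      ← lintegral_indicator measurableSet_Ioo]
    refine lintegral_congr fun u => ?_
    by_cases hu : 0 < u
    · by_cases hux : u < x
      · simp [hu, hux, this u hu]
      · simp [hu, hux, this u hu]
    · simp [hu]

/-- The Riesz potential `∫ ‖x - y‖ ^ a f(y) dy`. -/
def rieszPot {d : ℕ} (a : ℝ) (f : Rd d → ℝ≥0∞) (x : Rd d) : ℝ≥0∞ :=
  ∫⁻ y, ENNReal.ofReal (‖x - y‖ ^ a) * f y

theorem lintegral_sub_left {d : ℕ} (f : Rd d → ℝ≥0∞) (x : Rd d) :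
    ∫⁻ y, f (x - y) = ∫⁻ y, f y := lintegral_sub_left_eq_self f x

theorem measurable_rieszPot {d : ℕ} (a : ℝ) {f : Rd d → ℝ≥0∞} (hf : Measurable f) :
    Measurable (rieszPot a f) := by
  unfold rieszPot
  exact Measurable.lintegral_prod_right' (f := fun z : Rd d × Rd d =>
    ENNReal.ofReal (‖z.1 - z.2‖ ^ a) * f z.2) (by fun_prop)

/-- The kernel is cut at a radius `δ` and `f` at the height `t ^ (r / p)`. Only the part with near
kernel and large `f` can exceed a multiple of `t`, and Chebyshev's inequality measures it. Keeping
the integral of `f` over its superlevel set on the right, instead of bounding it, lets the strong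
inequality follow by integration in `t` without interpolation. -/
theorem rieszPot_weak_bound {d : ℕ} (hd : 1 ≤ d) {a p r : ℝ} (hp : 1 < p) (hr : p < r)
    (ha : a = d * (1 / p - 1 / r) - d) :
    ∃ A c : ℝ≥0, 0 < A ∧ ∀ f : Rd d → ℝ≥0∞, Measurable f → ∫⁻ y, f y ^ p ≤ 1 → ∀ t : ℝ, 0 < t →
      volume {x | A * ENNReal.ofReal t < rieszPot a f x} ≤
        c * ENNReal.ofReal (t ^ (-(r / p))) *
          ∫⁻ y, {y | ENNReal.ofReal (t ^ (r / p)) < f y}.indicator f y := by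
  have hd' : (0 : ℝ) < d := by exact_mod_cast hd
  have hp0 : 0 < p := by linarith
  have hr0 : 0 < r := by linarith
  have hrp : 1 / r < 1 / p := one_div_lt_one_div_of_lt hp0 hr
  have hpq := Real.HolderConjugate.conjExponent hp
  set p' := p.conjExponent with hp'
  have hp'0 : 0 < p' := hpq.symm.pos
  have hinv : 1 / p' = 1 - 1 / p := by
    have := hpq.inv_add_inv_eq_one
    rw [one_div, one_div]; linarith
  have had : -(d : ℝ) < a := by
    rw [ha]; have := mul_pos hd' (sub_pos.2 hrp); linarith
  have hap : a * p' < -(d : ℝ) := by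
    have h1 : a < -(d : ℝ) * (1 / p') := by
      rw [ha, hinv]
      have : 0 < (d : ℝ) * (1 / r) := by positivity
      nlinarith
    calc a * p' < -(d : ℝ) * (1 / p') * p' := by gcongr
      _ = -d := by field_simp
  set c1 : ℝ≥0∞ := ∫⁻ x : Rd d, innerKernel a 1 ‖x‖ with hc1
  set c2 : ℝ≥0∞ := (∫⁻ x : Rd d, outerKernel (a * p') 1 ‖x‖) ^ (1 / p') with hc2
  have hc1t : c1 ≠ ∞ := lintegral_innerKernel_ne_top hd had
  have hc2t : c2 ≠ ∞ :=
    ENNReal.rpow_ne_top_of_nonneg (by positivity) (lintegral_outerKernel_ne_top hd hap)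
  -- The three summands are the shares of the near kernel against small `f`, of the far kernel
  -- (Hölder), and of the threshold `t` left for Chebyshev.
  refine ⟨c1.toNNReal + c2.toNNReal + 1, c1.toNNReal, by positivity, fun f hf hf1 t ht => ?_⟩
  push_cast
  rw [ENNReal.coe_toNNReal hc1t, ENNReal.coe_toNNReal hc2t]
  -- This radius balances the two harmless parts: both `δ ^ (a + d) * t ^ (r / p)` and the `L^{p'}`
  -- norm of the far kernel become multiples of `t`.
  set δ : ℝ := t ^ (-(r / d)) with hδ
  have hδ0 : 0 < δ := by positivity
  set S : Set (Rd d) := {y | ENNReal.ofReal (t ^ (r / p)) < f y} with hS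
  have hSm : MeasurableSet S := measurableSet_lt measurable_const hf
  have hδa : δ ^ (a + d) = t ^ (1 - r / p) := by
    rw [hδ, ← Real.rpow_mul ht.le, ha]
    congr 1
    field_simp
    ring
  have hin : ∀ x : Rd d, ∫⁻ y, innerKernel a δ ‖x - y‖ = ENNReal.ofReal (t ^ (1 - r / p)) * c1 := by
    intro x
    rw [lintegral_sub_left (fun z : Rd d => innerKernel a δ ‖z‖), lintegral_innerKernel a hδ0, hδa]
  have hin' : ∀ y : Rd d, ∫⁻ x, innerKernel a δ ‖x - y‖ = ENNReal.ofReal (t ^ (1 - r / p)) * c1 := by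
    intro y
    simp_rw [norm_sub_rev _ y]
    exact hin y
  have hout : ∀ x : Rd d, ∫⁻ y, outerKernel a δ ‖x - y‖ * f y ≤ c2 * ENNReal.ofReal t := by
    intro x
    have h1 := ENNReal.lintegral_mul_le_Lp_mul_Lq volume hpq.symm
      (f := fun y : Rd d => outerKernel a δ ‖x - y‖) (g := f)
      (by fun_prop) hf.aemeasurable
    refine h1.trans ?_
    have h2 : ∀ y : Rd d, outerKernel a δ ‖x - y‖ ^ p' = outerKernel (a * p') δ ‖x - y‖ := by
      intro y
      unfold outerKernel
      by_cases h : δ ≤ ‖x - y‖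
      · simp only [Set.mem_Ici, h, Set.indicator_of_mem]
        rw [ENNReal.ofReal_rpow_of_nonneg (by positivity) hp'0.le, Real.rpow_mul (norm_nonneg _)]
      · simp [h, hp'0]
    simp_rw [h2]
    rw [lintegral_sub_left (fun z : Rd d => outerKernel (a * p') δ ‖z‖),
      lintegral_outerKernel _ hδ0, ENNReal.mul_rpow_of_nonneg _ _ (by positivity), ← hc2,
      ENNReal.ofReal_rpow_of_nonneg (by positivity) (by positivity)]
    have h3 : (δ ^ (a * p' + d)) ^ (1 / p') = t := by
      rw [hδ, ← Real.rpow_mul ht.le, ← Real.rpow_mul ht.le]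
      have : -(r / d) * (a * p' + d) * (1 / p') = 1 := by
        have : (a * p' + d) * (1 / p') = a + d * (1 / p') := by field_simp
        rw [mul_assoc, this, hinv, ha]
        field_simp
        ring
      rw [this, Real.rpow_one]
    rw [h3]
    calc ENNReal.ofReal t * c2 * (∫⁻ y, f y ^ p) ^ (1 / p)
        ≤ ENNReal.ofReal t * c2 * 1 ^ (1 / p) := by gcongr
      _ = c2 * ENNReal.ofReal t := by rw [ENNReal.one_rpow, mul_one, mul_comm]
  have hsmall : ∀ x : Rd d, ∫⁻ y, innerKernel a δ ‖x - y‖ * Sᶜ.indicator f y ≤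
      c1 * ENNReal.ofReal t := by
    intro x
    calc ∫⁻ y, innerKernel a δ ‖x - y‖ * Sᶜ.indicator f y
        ≤ ∫⁻ y, innerKernel a δ ‖x - y‖ * ENNReal.ofReal (t ^ (r / p)) := by
          gcongr with y
          by_cases hy : y ∈ S
          · simp [hy]
          · simpa [hy] using not_lt.1 hy
      _ = ENNReal.ofReal (t ^ (1 - r / p)) * c1 * ENNReal.ofReal (t ^ (r / p)) := by
          rw [lintegral_mul_const _ (by fun_prop), hin]
      _ = c1 * (ENNReal.ofReal (t ^ (1 - r / p)) * ENNReal.ofReal (t ^ (r / p))) := by ring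
      _ = c1 * ENNReal.ofReal t := by
          rw [← ENNReal.ofReal_mul (by positivity), ← Real.rpow_add ht]
          simp
  set G : Rd d → ℝ≥0∞ := fun x => ∫⁻ y, innerKernel a δ ‖x - y‖ * S.indicator f y with hG
  have hdecomp : ∀ x, rieszPot a f x ≤ G x + c1 * ENNReal.ofReal t + c2 * ENNReal.ofReal t := by
    intro x
    have : rieszPot a f x = G x + (∫⁻ y, innerKernel a δ ‖x - y‖ * Sᶜ.indicator f y) +
        ∫⁻ y, outerKernel a δ ‖x - y‖ * f y := by
      rw [hG, ← lintegral_add_left, ← lintegral_add_left]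
      · refine lintegral_congr fun y => ?_
        rw [← mul_add, ← Pi.add_apply, Set.indicator_self_add_compl, ← add_mul,
          innerKernel_add_outerKernel]
      · exact ((by fun_prop : Measurable fun y : Rd d => innerKernel a δ ‖x - y‖).mul
          (hf.indicator hSm)).add ((by fun_prop : Measurable fun y : Rd d =>
            innerKernel a δ ‖x - y‖).mul (hf.indicator hSm.compl))
      · exact (by fun_prop : Measurable fun y : Rd d => innerKernel a δ ‖x - y‖).mul
          (hf.indicator hSm)
    rw [this]
    gcongr
    · exact hsmall x
    · exact hout x
  have hsub : {x | (c1 + c2 + 1) * ENNReal.ofReal t < rieszPot a f x} ⊆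
      {x | ENNReal.ofReal t ≤ G x} := by
    intro x hx
    by_contra hcon
    have h1 : G x ≤ ENNReal.ofReal t := (not_le.1 hcon).le
    refine not_lt.2 ((hdecomp x).trans ?_) hx
    calc G x + c1 * ENNReal.ofReal t + c2 * ENNReal.ofReal t
        ≤ ENNReal.ofReal t + c1 * ENNReal.ofReal t + c2 * ENNReal.ofReal t := by gcongr
      _ = (c1 + c2 + 1) * ENNReal.ofReal t := by ring
  have hmeas : Measurable (fun z : Rd d × Rd d => innerKernel a δ ‖z.1 - z.2‖ * S.indicator f z.2) :=
    (by fun_prop : Measurable fun z : Rd d × Rd d => innerKernel a δ ‖z.1 - z.2‖).mul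
      ((hf.indicator hSm).comp measurable_snd)
  have hGm : Measurable G := Measurable.lintegral_prod_right' hmeas
  have hGint : ∫⁻ x, G x = ENNReal.ofReal (t ^ (1 - r / p)) * c1 * ∫⁻ y, S.indicator f y := by
    rw [hG, lintegral_lintegral_swap hmeas.aemeasurable]
    rw [← lintegral_const_mul _ (hf.indicator hSm)]
    refine lintegral_congr fun y => ?_
    rw [lintegral_mul_const _ (by fun_prop), hin']
  have hM := mul_meas_ge_le_lintegral (μ := volume) hGm (ENNReal.ofReal t)
  have ht' : ENNReal.ofReal t ≠ 0 := by simpa using ht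
  calc volume {x | (c1 + c2 + 1) * ENNReal.ofReal t < rieszPot a f x}
      ≤ volume {x | ENNReal.ofReal t ≤ G x} := measure_mono hsub
    _ ≤ (∫⁻ x, G x) / ENNReal.ofReal t := by
        rw [ENNReal.le_div_iff_mul_le (Or.inl ht') (Or.inl ENNReal.ofReal_ne_top), mul_comm]
        exact hM
    _ = c1 * ENNReal.ofReal (t ^ (-(r / p))) * ∫⁻ y, S.indicator f y := by
        rw [hGint, div_eq_mul_inv, ← ENNReal.ofReal_inv_of_pos ht]
        have : ENNReal.ofReal (t ^ (-(r / p))) =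
            ENNReal.ofReal (t ^ (1 - r / p)) * ENNReal.ofReal t⁻¹ := by
          rw [← ENNReal.ofReal_mul (by positivity), ← Real.rpow_neg_one, ← Real.rpow_add ht]
          congr 2
          ring
        rw [this]
        ring

/-- The Hardy–Littlewood–Sobolev inequality. -/
theorem rieszPot_strong_bound {d : ℕ} (hd : 1 ≤ d) {a p r : ℝ} (hp : 1 < p) (hr : p < r)
    (ha : a = d * (1 / p - 1 / r) - d) :
    ∃ C : ℝ≥0, ∀ f : Rd d → ℝ≥0∞, Measurable f → ∫⁻ y, f y ^ p ≤ 1 →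
      ∫⁻ x, rieszPot a f x ^ r ≤ C := by
  obtain ⟨A, c, hA, h⟩ := rieszPot_weak_bound hd hp hr ha
  have hp0 : 0 < p := by linarith
  have hr0 : 0 < r := by linarith
  have hρ : 0 < r - r / p := by
    have : r / p < r := div_lt_self hr0 hp
    linarith
  refine ⟨A ^ r * (r.toNNReal * (c / (r - r / p).toNNReal)), fun f hf hf1 => ?_⟩
  have hIm := measurable_rieszPot a hf
  have hA' : (A : ℝ≥0∞) ≠ 0 := by exact_mod_cast hA.ne'
  set F : Rd d → ℝ≥0∞ := fun x => rieszPot a f x / A with hF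
  have hFm : Measurable F := hIm.div_const _
  have e1 : ∀ x, rieszPot a f x ^ r = A ^ r * F x ^ r := by
    intro x
    rw [hF, ← ENNReal.mul_rpow_of_nonneg _ _ hr0.le, ENNReal.mul_div_cancel hA' ENNReal.coe_ne_top]
  have e2 : ∀ x, F x ^ r = ENNReal.ofReal r * ∫⁻ u in Set.Ioi (0 : ℝ),
      {u | ENNReal.ofReal u < F x}.indicator (fun u => ENNReal.ofReal (u ^ (r - 1))) u := by
    intro x
    rw [lintegral_Ioi_rpow_indicator hr0, ENNReal.mul_div_cancel (by simpa using hr0)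
      ENNReal.ofReal_ne_top]
  have hset : MeasurableSet {z : Rd d × ℝ | ENNReal.ofReal z.2 < F z.1} :=
    measurableSet_lt (by fun_prop) (hFm.comp measurable_fst)
  have hm1 : Measurable (fun z : Rd d × ℝ => {u | ENNReal.ofReal u < F z.1}.indicator
      (fun u => ENNReal.ofReal (u ^ (r - 1))) z.2) :=
    (by fun_prop : Measurable fun z : Rd d × ℝ => ENNReal.ofReal (z.2 ^ (r - 1))).indicator hset
  have hset2 : MeasurableSet {z : ℝ × Rd d | ENNReal.ofReal (z.1 ^ (r / p)) < f z.2} :=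
    measurableSet_lt (by fun_prop) (hf.comp measurable_snd)
  have hm2 : Measurable (fun z : ℝ × Rd d => ENNReal.ofReal (z.1 ^ (r - r / p - 1)) *
      {y | ENNReal.ofReal (z.1 ^ (r / p)) < f y}.indicator f z.2) :=
    (by fun_prop : Measurable fun z : ℝ × Rd d => ENNReal.ofReal (z.1 ^ (r - r / p - 1))).mul
      ((hf.comp measurable_snd).indicator hset2)
  -- After inserting the weak bound and exchanging integrals, the `u`-integral runs over `u < f(y) ^
  -- (p / r)` and produces `f(y) ^ (p - 1)`, so that `∫ f ^ p` appears.
  have e3 : ∫⁻ x, ∫⁻ u in Set.Ioi (0 : ℝ), {u | ENNReal.ofReal u < F x}.indicator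
      (fun u => ENNReal.ofReal (u ^ (r - 1))) u ≤ c / ENNReal.ofReal (r - r / p) := by
    rw [lintegral_lintegral_swap hm1.aemeasurable]
    calc ∫⁻ u in Set.Ioi (0 : ℝ), ∫⁻ x, {u | ENNReal.ofReal u < F x}.indicator
          (fun u => ENNReal.ofReal (u ^ (r - 1))) u
        ≤ ∫⁻ u in Set.Ioi (0 : ℝ), c * ∫⁻ y, ENNReal.ofReal (u ^ (r - r / p - 1)) *
            {y | ENNReal.ofReal (u ^ (r / p)) < f y}.indicator f y := by
          refine setLIntegral_mono' measurableSet_Ioi fun u (hu : 0 < u) => ?_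
          have e4 : ∀ x, {u | ENNReal.ofReal u < F x}.indicator
              (fun u => ENNReal.ofReal (u ^ (r - 1))) u =
              {x | A * ENNReal.ofReal u < rieszPot a f x}.indicator
                (fun _ => ENNReal.ofReal (u ^ (r - 1))) x := by
            intro x
            have : ENNReal.ofReal u < F x ↔ A * ENNReal.ofReal u < rieszPot a f x := by
              rw [hF, ENNReal.lt_div_iff_mul_lt (Or.inl hA') (Or.inl ENNReal.coe_ne_top), mul_comm]
            by_cases hx : ENNReal.ofReal u < F x
            · rw [Set.indicator_of_mem (by exact hx), Set.indicator_of_mem (by exact this.1 hx)]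
            · rw [Set.indicator_of_notMem (by exact hx),
                Set.indicator_of_notMem (by exact fun h' => hx (this.2 h'))]
          simp_rw [e4]
          rw [lintegral_indicator_const (measurableSet_lt measurable_const hIm)]
          have hfm' : Measurable ({y | ENNReal.ofReal (u ^ (r / p)) < f y}.indicator f) :=
            hf.indicator (measurableSet_lt measurable_const hf)
          rw [lintegral_const_mul _ hfm']
          calc ENNReal.ofReal (u ^ (r - 1)) * volume {x | A * ENNReal.ofReal u < rieszPot a f x}
              ≤ ENNReal.ofReal (u ^ (r - 1)) * (c * ENNReal.ofReal (u ^ (-(r / p))) *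
                ∫⁻ y, {y | ENNReal.ofReal (u ^ (r / p)) < f y}.indicator f y) := by
                gcongr
                exact h f hf hf1 u hu
            _ = c * ((ENNReal.ofReal (u ^ (r - 1)) * ENNReal.ofReal (u ^ (-(r / p)))) *
                ∫⁻ y, {y | ENNReal.ofReal (u ^ (r / p)) < f y}.indicator f y) := by ring
            _ = _ := by
                rw [← ENNReal.ofReal_mul (by positivity), ← Real.rpow_add hu]
                ring_nf
      _ = c * ∫⁻ y, ∫⁻ u in Set.Ioi (0 : ℝ), ENNReal.ofReal (u ^ (r - r / p - 1)) *
            {y | ENNReal.ofReal (u ^ (r / p)) < f y}.indicator f y := by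
          rw [lintegral_const_mul _ hm2.lintegral_prod_right',
            lintegral_lintegral_swap hm2.aemeasurable]
      _ = c * ∫⁻ y, f y ^ p / ENNReal.ofReal (r - r / p) := by
          congr 1
          refine lintegral_congr fun y => ?_
          have e5 : ∀ u ∈ Set.Ioi (0 : ℝ), ENNReal.ofReal (u ^ (r - r / p - 1)) *
              {y | ENNReal.ofReal (u ^ (r / p)) < f y}.indicator f y =
              f y * {u | ENNReal.ofReal u < f y ^ (p / r)}.indicator
                (fun u => ENNReal.ofReal (u ^ (r - r / p - 1))) u := by
            intro u hu
            have hu : 0 < u := hu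
            have : ENNReal.ofReal (u ^ (r / p)) < f y ↔ ENNReal.ofReal u < f y ^ (p / r) := by
              rw [← ENNReal.ofReal_rpow_of_pos hu]
              rw [← ENNReal.rpow_lt_rpow_iff (z := p / r) (by positivity), ← ENNReal.rpow_mul,
                show r / p * (p / r) = 1 by field_simp, ENNReal.rpow_one]
            by_cases hx : ENNReal.ofReal u < f y ^ (p / r)
            · rw [Set.indicator_of_mem (by exact this.2 hx), Set.indicator_of_mem (by exact hx),
                mul_comm]
            · rw [Set.indicator_of_notMem (by exact fun h' => hx (this.1 h')),
                Set.indicator_of_notMem (by exact hx)]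
              simp
          rw [setLIntegral_congr_fun measurableSet_Ioi e5, lintegral_const_mul _
            ((by fun_prop : Measurable fun u : ℝ => ENNReal.ofReal (u ^ (r - r / p - 1))).indicator
              (measurableSet_lt (by fun_prop) measurable_const)),
            lintegral_Ioi_rpow_indicator hρ, ← ENNReal.rpow_mul,
            show p / r * (r - r / p) = p - 1 by field_simp, ← mul_div_assoc]
          congr 1
          nth_rw 1 [← ENNReal.rpow_one (f y)]
          rw [← ENNReal.rpow_add_of_nonneg _ _ zero_le_one (by linarith)]
          congr 1
          ring
      _ ≤ c * (1 / ENNReal.ofReal (r - r / p)) := by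
          simp_rw [div_eq_mul_inv]
          rw [lintegral_mul_const _ (by fun_prop)]
          gcongr
      _ = c / ENNReal.ofReal (r - r / p) := by rw [mul_one_div]
  calc ∫⁻ x, rieszPot a f x ^ r
      = A ^ r * (ENNReal.ofReal r * ∫⁻ x, ∫⁻ u in Set.Ioi (0 : ℝ),
          {u | ENNReal.ofReal u < F x}.indicator (fun u => ENNReal.ofReal (u ^ (r - 1))) u) := by
        simp_rw [e1, e2]
        rw [lintegral_const_mul _ (hm1.lintegral_prod_right'.const_mul _),
          lintegral_const_mul _ hm1.lintegral_prod_right']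
    _ ≤ A ^ r * (ENNReal.ofReal r * (c / ENNReal.ofReal (r - r / p))) := by gcongr
    _ = _ := by
        rw [ENNReal.coe_mul, ENNReal.coe_rpow_of_nonneg _ hr0.le, ENNReal.coe_mul,
          ENNReal.coe_div (by simpa using hρ)]
        rfl

/-- Homogeneity removes the normalisation; a vanishing norm, by which one cannot divide, is treated
apart. -/
theorem rieszPot_bound {d : ℕ} (hd : 1 ≤ d) {a p r : ℝ} (hp : 1 < p) (hr : p < r)
    (ha : a = d * (1 / p - 1 / r) - d) :
    ∃ C : ℝ≥0, ∀ f : Rd d → ℝ≥0∞, Measurable f → ∫⁻ y, f y ^ p ≠ ∞ →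
      ∫⁻ x, rieszPot a f x ^ r ≤ C * (∫⁻ y, f y ^ p) ^ (r / p) := by
  obtain ⟨C, hC⟩ := rieszPot_strong_bound hd hp hr ha
  have hp0 : 0 < p := by linarith
  have hr0 : 0 < r := by linarith
  refine ⟨C, fun f hf hfin => ?_⟩
  set N : ℝ≥0∞ := ∫⁻ y, f y ^ p with hN
  rcases eq_or_ne N 0 with h0 | h0
  · have h1 : f =ᵐ[volume] 0 := by
      have := (lintegral_eq_zero_iff (hf.pow_const p)).1 (hN ▸ h0)
      filter_upwards [this] with y hy
      simpa [hp0, hp0.not_gt] using hy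
    have h2 : ∀ x, rieszPot a f x = 0 := by
      intro x
      unfold rieszPot
      rw [lintegral_eq_zero_iff (by fun_prop)]
      filter_upwards [h1] with y hy
      simp [hy]
    simp [h2, hr0]
  · set M : ℝ≥0∞ := N ^ (1 / p) with hM
    have hM0 : M ≠ 0 := by simp [hM, h0, hfin]
    have hMt : M ≠ ∞ := ENNReal.rpow_ne_top_of_nonneg (by positivity) hfin
    have h1 := hC (fun y => M⁻¹ * f y) (hf.const_mul _) (by
      simp_rw [ENNReal.mul_rpow_of_nonneg _ _ hp0.le]
      rw [lintegral_const_mul _ (hf.pow_const p), ENNReal.inv_rpow, hM, ← ENNReal.rpow_mul,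
        one_div_mul_cancel hp0.ne', ENNReal.rpow_one, ENNReal.inv_mul_cancel h0 hfin])
    have h2 : ∀ x, rieszPot a (fun y => M⁻¹ * f y) x = M⁻¹ * rieszPot a f x := by
      intro x
      unfold rieszPot
      rw [← lintegral_const_mul _ (by fun_prop)]
      exact lintegral_congr fun y => by ring
    simp_rw [h2, ENNReal.mul_rpow_of_nonneg _ _ hr0.le] at h1
    rw [lintegral_const_mul _ ((measurable_rieszPot a hf).pow_const r), ENNReal.inv_rpow,
      ← ENNReal.div_eq_inv_mul,
      ENNReal.div_le_iff (by simp [hM0, hr0, hr0.not_gt, hMt])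
        (ENNReal.rpow_ne_top_of_nonneg hr0.le hMt), hM,
      ← ENNReal.rpow_mul] at h1
    rwa [show r / p = 1 / p * r by ring]

/-! ### Kernels subordinate to the heat kernel -/

/-- The heat kernel of `ℝᵈ`. -/
def heat {d : ℕ} (t : ℝ) (z : Rd d) : ℝ :=
  (4 * Real.pi * t) ^ (-((d : ℝ) / 2)) * Real.exp (-(‖z‖ ^ 2 / (4 * t)))

theorem heat_nonneg {d : ℕ} {t : ℝ} (ht : 0 ≤ t) (z : Rd d) : 0 ≤ heat t z := by
  unfold heat; positivity

theorem heat_neg {d : ℕ} (t : ℝ) (z : Rd d) : heat t (-z) = heat t z := by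
  simp [heat]

@[fun_prop]
theorem measurable_heat {d : ℕ} : Measurable (fun p : ℝ × Rd d => heat p.1 p.2) := by
  unfold heat; fun_prop

/-- Apply `∫ ĝ φ = ∫ g φ̂` to a Gaussian `g` modulated by `x`, whose Fourier transform is the heat
kernel centred at `x`. -/
theorem heat_conv {d : ℕ} {t : ℝ} (ht : 0 < t) {φ : Rd d → ℂ} (hφ : Integrable φ) (x : Rd d) :
    ∫ y, (heat t (x - y) : ℂ) * φ y =
      ∫ ξ, ((Real.exp (-(t * (2 * Real.pi * ‖ξ‖) ^ 2)) : ℝ) : ℂ) *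
        (Complex.exp ((2 * Real.pi * inner ℝ ξ x : ℝ) * Complex.I) * 𝓕 φ ξ) := by
  have hb : 0 < (((4 * Real.pi ^ 2 * t : ℝ)) : ℂ).re := by
    rw [Complex.ofReal_re]; positivity
  have J := GaussianFourier.integrable_cexp_neg_mul_sq_norm_add (V := Rd d) hb
    (2 * Real.pi * Complex.I) x
  have h := VectorFourier.integral_fourierIntegral_smul_eq_flip (L := innerₗ (Rd d))
      Real.continuous_fourierChar continuous_inner J hφ
  have hL : ∀ y, (VectorFourier.fourierIntegral Real.fourierChar volume (innerₗ (Rd d))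
      (fun v : Rd d => Complex.exp (-((4 * Real.pi ^ 2 * t : ℝ) : ℂ) * (‖v‖ : ℂ) ^ 2 +
        2 * Real.pi * Complex.I * (inner ℝ x v : ℝ))) y) = heat t (x - y) := by
    intro y
    refine (fourier_gaussian_innerProductSpace' hb x y).trans ?_
    rw [heat, finrank_euclideanSpace_fin, Complex.ofReal_mul (_ ^ _), Complex.ofReal_exp]
    congr 1
    · rw [Real.rpow_neg (by positivity), ← Real.inv_rpow (by positivity),
        Complex.ofReal_cpow (by positivity)]
      have : ((Real.pi : ℂ) / ((4 * Real.pi ^ 2 * t : ℝ) : ℂ)) = ((4 * Real.pi * t)⁻¹ : ℝ) := by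
        rw [← Complex.ofReal_div]
        congr 1
        have := Real.pi_pos
        field_simp
      rw [this]
      push_cast
      rfl
    · congr 1
      push_cast
      have := Real.pi_pos
      field_simp
  simp_rw [hL, smul_eq_mul] at h
  rw [h]
  refine integral_congr_ae (.of_forall fun ξ => ?_)
  have : VectorFourier.fourierIntegral Real.fourierChar volume (innerₗ (Rd d)).flip φ ξ = 𝓕 φ ξ := by
    rw [show (innerₗ (Rd d)).flip = innerₗ (Rd d) from flip_innerₗ _]
    rfl
  simp only [this]
  rw [Complex.exp_add, mul_assoc]
  congr 1
  · rw [Complex.ofReal_exp]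
    congr 1
    push_cast
    ring
  · congr 2
    rw [real_inner_comm]
    push_cast
    ring

/-- The substitution `t ↦ 1 / t` reduces this to the Gamma integral. -/
theorem setIntegral_rpow_mul_exp_neg_div {b r : ℝ} (hb : 0 < b) (hr : 0 < r) :
    ∫ t in Set.Ioi (0 : ℝ), t ^ (-b - 1) * Real.exp (-(r / t)) = (1 / r) ^ b * Real.Gamma b := by
  rw [← Real.integral_rpow_mul_exp_neg_mul_Ioi hb hr,
    ← integral_comp_rpow_Ioi (fun t => t ^ (b - 1) * Real.exp (-(r * t))) (p := -1) (by norm_num)]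
  refine setIntegral_congr_fun measurableSet_Ioi fun t (ht : 0 < t) => ?_
  simp only [abs_neg, abs_one, one_mul, smul_eq_mul]
  rw [← mul_assoc, ← Real.rpow_mul ht.le, ← Real.rpow_add ht, Real.rpow_neg_one, ← div_eq_mul_inv]
  congr 2
  ring

theorem rpow_mul_heat {d : ℕ} {s : ℝ} {t : ℝ} (ht : 0 < t) (z : Rd d) :
    t ^ (s / 2 - 1) * heat t z = (4 * Real.pi) ^ (-((d : ℝ) / 2)) *
      (t ^ (-((d - s) / 2) - 1) * Real.exp (-(‖z‖ ^ 2 / 4 / t))) := by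
  rw [heat, Real.mul_rpow (by positivity) ht.le, div_div]
  have : t ^ (-((d - s) / 2) - 1) = t ^ (s / 2 - 1) * t ^ (-((d : ℝ) / 2)) := by
    rw [← Real.rpow_add ht]; ring_nf
  rw [this]
  ring

/-- The constant of the Riesz kernel: `∫ t ^ (s / 2 - 1) p_t(z) dt = c ‖z‖ ^ (s - d)`. -/
def rieszConst (d : ℕ) (s : ℝ) : ℝ :=
  (4 * Real.pi) ^ (-((d : ℝ) / 2)) * (4 ^ ((d - s) / 2) * Real.Gamma ((d - s) / 2))

theorem rieszConst_pos {d : ℕ} {s : ℝ} (hsd : s < d) : 0 < rieszConst d s := by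
  have := Real.Gamma_pos_of_pos (s := (d - s) / 2) (by linarith)
  unfold rieszConst; positivity

theorem setIntegral_rpow_mul_heat {d : ℕ} {s : ℝ} (hsd : s < d) {z : Rd d} (hz : z ≠ 0) :
    ∫ t in Set.Ioi (0 : ℝ), t ^ (s / 2 - 1) * heat t z = rieszConst d s * ‖z‖ ^ (s - d) := by
  have hz' : 0 < ‖z‖ := norm_pos_iff.2 hz
  rw [setIntegral_congr_fun measurableSet_Ioi fun t ht => rpow_mul_heat (s := s) ht z,
    integral_const_mul, setIntegral_rpow_mul_exp_neg_div (by linarith) (by positivity), rieszConst]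
  have : (1 / (‖z‖ ^ 2 / 4)) ^ ((d - s) / 2) = 4 ^ ((d - s) / 2) * ‖z‖ ^ (s - d) := by
    rw [one_div_div, Real.div_rpow (by norm_num) (by positivity), div_eq_mul_inv,
      ← Real.rpow_neg (by positivity), ← Real.rpow_natCast, ← Real.rpow_mul hz'.le]
    congr 2
    push_cast
    ring
  rw [this]
  ring

theorem integrableOn_rpow_mul_heat {d : ℕ} {s : ℝ} (hsd : s < d) {z : Rd d} (hz : z ≠ 0) :
    IntegrableOn (fun t => t ^ (s / 2 - 1) * heat t z) (Set.Ioi 0) := by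
  -- A non-integrable function has Bochner integral `0`, so the positive value of the integral
  -- already gives integrability.
  refine .of_integral_ne_zero ?_
  rw [setIntegral_rpow_mul_heat hsd hz]
  have := rieszConst_pos hsd
  have := norm_pos_iff.2 hz
  positivity

/-- A weight on `(0, ∞)` dominated by `C t ^ (s / 2 - 1)`. -/
structure IsWeight (s : ℝ) (C : ℝ) (w : ℝ → ℝ) : Prop where
  measurable : Measurable w
  nonneg : ∀ t, 0 < t → 0 ≤ w t
  le : ∀ t, 0 < t → w t ≤ C * t ^ (s / 2 - 1)

/-- The kernel `∫ w(t) p_t(z) dt`. -/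
def subKernel {d : ℕ} (w : ℝ → ℝ) (z : Rd d) : ℝ := ∫ t in Set.Ioi (0 : ℝ), w t * heat t z

/-- The Fourier multiplier `∫ w(t) exp(-4 π² t ‖ξ‖²) dt`. -/
def subMult {d : ℕ} (w : ℝ → ℝ) (ξ : Rd d) : ℝ :=
  ∫ t in Set.Ioi (0 : ℝ), w t * Real.exp (-(t * (2 * Real.pi * ‖ξ‖) ^ 2))

theorem subKernel_neg {d : ℕ} (w : ℝ → ℝ) (z : Rd d) : subKernel w (-z) = subKernel w z := by
  simp [subKernel, heat_neg]

namespace IsWeight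

variable {d : ℕ} {s C : ℝ} {w : ℝ → ℝ}

theorem measurable_subKernel (hw : IsWeight s C w) : Measurable (subKernel (d := d) w) := by
  have h1 := hw.measurable
  have : StronglyMeasurable (fun p : Rd d × ℝ => w p.2 * heat p.2 p.1) :=
    ((h1.comp measurable_snd).mul
      (measurable_heat.comp (measurable_snd.prodMk measurable_fst))).stronglyMeasurable
  exact this.integral_prod_right.measurable

theorem subKernel_nonneg (hw : IsWeight s C w) (z : Rd d) : 0 ≤ subKernel w z :=
  setIntegral_nonneg measurableSet_Ioi fun t ht => mul_nonneg (hw.nonneg t ht)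
    (heat_nonneg (le_of_lt ht) z)

theorem integrableOn_mul_heat (hw : IsWeight s C w) (hsd : s < d) {z : Rd d} (hz : z ≠ 0) :
    IntegrableOn (fun t => w t * heat t z) (Set.Ioi 0) := by
  refine ((integrableOn_rpow_mul_heat hsd hz).const_mul C).mono' ?_ ?_
  · have h1 := hw.measurable
    exact (h1.mul (measurable_heat.comp (measurable_id.prodMk measurable_const))).aestronglyMeasurable
  · filter_upwards [ae_restrict_mem measurableSet_Ioi] with t ht
    have h2 := heat_nonneg (le_of_lt ht) z
    rw [Real.norm_of_nonneg (mul_nonneg (hw.nonneg t ht) h2), ← mul_assoc]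
    exact mul_le_mul_of_nonneg_right (hw.le t ht) h2

theorem subKernel_le (hw : IsWeight s C w) (hsd : s < d) {z : Rd d} (hz : z ≠ 0) :
    subKernel w z ≤ C * rieszConst d s * ‖z‖ ^ (s - d) := by
  rw [mul_assoc, ← setIntegral_rpow_mul_heat hsd hz, ← integral_const_mul]
  refine setIntegral_mono_on (hw.integrableOn_mul_heat hsd hz)
    ((integrableOn_rpow_mul_heat hsd hz).const_mul C) measurableSet_Ioi fun t ht => ?_
  rw [← mul_assoc]
  exact mul_le_mul_of_nonneg_right (hw.le t ht) (heat_nonneg (le_of_lt ht) z)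

theorem integrableOn_mul_exp (hw : IsWeight s C w) (hs : 0 < s) {ξ : Rd d} (hξ : ξ ≠ 0) :
    IntegrableOn (fun t => w t * Real.exp (-(t * (2 * Real.pi * ‖ξ‖) ^ 2))) (Set.Ioi 0) := by
  have hξ' : 0 < ‖ξ‖ := norm_pos_iff.2 hξ
  have h0 : IntegrableOn (fun t : ℝ => t ^ (s / 2 - 1) *
      Real.exp (-((2 * Real.pi * ‖ξ‖) ^ 2 * t))) (Set.Ioi 0) := by
    refine .of_integral_ne_zero ?_
    rw [Real.integral_rpow_mul_exp_neg_mul_Ioi (by positivity) (by positivity)]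
    have := Real.Gamma_pos_of_pos (s := s / 2) (by linarith)
    positivity
  refine (h0.const_mul C).mono' ?_ ?_
  · have h1 := hw.measurable
    exact (h1.mul (by fun_prop)).aestronglyMeasurable
  · filter_upwards [ae_restrict_mem measurableSet_Ioi] with t ht
    rw [Real.norm_of_nonneg (mul_nonneg (hw.nonneg t ht) (Real.exp_pos _).le), ← mul_assoc,
      mul_comm t]
    exact mul_le_mul_of_nonneg_right (hw.le t ht) (Real.exp_pos _).le

/-- Near `x` the singularity is integrable and `φ` is bounded; away from `x` the kernel is at most
`1` and `φ` is integrable. -/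
theorem integrable_rpow_mul (hd : 1 ≤ d) (hs : 0 < s) (hsd : s < d) (φ : 𝓢(Rd d, ℂ)) (x : Rd d) :
    Integrable (fun y => ‖x - y‖ ^ (s - d) * ‖φ y‖) := by
  have hφm : Measurable φ := φ.continuous.measurable
  refine ⟨(Measurable.mul (by fun_prop) hφm.norm).aestronglyMeasurable, ?_⟩
  obtain ⟨B, hB⟩ : ∃ B : ℝ≥0, ∀ y, ‖φ y‖ₑ ≤ B := by
    refine ⟨((SchwartzMap.seminorm ℝ 0 0) φ).toNNReal, fun y => ?_⟩
    rw [← ofReal_norm]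
    exact ENNReal.ofReal_le_ofReal (SchwartzMap.norm_le_seminorm ℝ φ y)
  have hle : ∀ y, ‖‖x - y‖ ^ (s - d) * ‖φ y‖‖ₑ ≤ innerKernel (s - d) 1 ‖x - y‖ * B + ‖φ y‖ₑ := by
    intro y
    rw [enorm_mul, enorm_norm, Real.enorm_of_nonneg (by positivity)]
    rcases lt_or_ge ‖x - y‖ 1 with h | h
    · refine le_trans ?_ le_self_add
      rw [innerKernel, Set.indicator_of_mem (by exact h)]
      gcongr
      exact hB y
    · refine le_trans ?_ le_add_self
      refine (mul_le_mul_left (ENNReal.ofReal_le_one.2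
        (Real.rpow_le_one_of_one_le_of_nonpos h (by linarith))) _).trans_eq (one_mul _)
  refine (lintegral_mono hle).trans_lt ?_
  rw [lintegral_add_right _ (by fun_prop), lintegral_mul_const _ (by fun_prop),
    lintegral_sub_left (fun z : Rd d => innerKernel (s - d) 1 ‖z‖)]
  exact ENNReal.add_lt_top.2 ⟨ENNReal.mul_lt_top
    (lintegral_innerKernel_ne_top hd (by linarith)).lt_top ENNReal.coe_lt_top,
    φ.integrable.hasFiniteIntegral⟩

/-- Fourier inversion writes `ψ` as an integral over `ξ` and `t`; for each fixed `t` the heat kernel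
identity applies, and two uses of Fubini move the `t`-integral inside and outside. This avoids the
Fourier transform of the singular kernel as a distribution. -/
theorem eq_conv (hw : IsWeight s C w) (hd : 1 ≤ d) (hs : 0 < s) (hsd : s < d)
    {φ ψ : 𝓢(Rd d, ℂ)} (h : ∀ ξ : Rd d, ξ ≠ 0 → 𝓕 ψ ξ = subMult w ξ * 𝓕 φ ξ) (x : Rd d) :
    ψ x = ∫ y, (subKernel w (x - y) : ℂ) * φ y := by
  have hne : ∀ᵐ ξ : Rd d, ξ ≠ 0 := by
    have : Nonempty (Fin d) := ⟨⟨0, hd⟩⟩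
    exact Measure.ae_ne volume 0
  have hnex : ∀ᵐ y : Rd d, x - y ≠ 0 := by
    have : Nonempty (Fin d) := ⟨⟨0, hd⟩⟩
    filter_upwards [Measure.ae_ne volume x] with y hy
    exact sub_ne_zero.2 hy.symm
  have hwm := hw.measurable
  set e : Rd d → ℂ := fun ξ => Complex.exp ((2 * Real.pi * inner ℝ ξ x : ℝ) * Complex.I) with he
  have hem : Continuous e := by fun_prop
  have hnorm : ∀ ξ, ‖e ξ‖ = 1 := fun ξ => Complex.norm_exp_ofReal_mul_I _
  have h1 : ψ x = ∫ ξ, e ξ * 𝓕 ψ ξ := by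
    have : ψ x = 𝓕⁻ (𝓕 ψ) x := by rw [FourierTransform.fourierInv_fourier_eq]
    rw [this, SchwartzMap.fourierInv_coe, Real.fourierInv_eq']
    rfl
  set F : Rd d → ℝ → ℂ := fun ξ t =>
    ((w t * Real.exp (-(t * (2 * Real.pi * ‖ξ‖) ^ 2)) : ℝ) : ℂ) * (e ξ * 𝓕 φ ξ) with hF
  have hFφ : Continuous fun ξ => 𝓕 φ ξ := (𝓕 φ : 𝓢(Rd d, ℂ)).continuous
  have hFm : AEStronglyMeasurable (Function.uncurry F)
      ((volume : Measure (Rd d)).prod (volume.restrict (Set.Ioi 0))) := by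
    refine Measurable.aestronglyMeasurable ?_
    simp only [hF, Function.uncurry_def]
    have : Measurable fun p : Rd d × ℝ => e p.1 * 𝓕 φ p.1 :=
      ((hem.mul hFφ).comp continuous_fst).measurable
    exact (Complex.measurable_ofReal.comp (by fun_prop)).mul this
  -- No estimate of the multiplier is needed: as `w ≥ 0`, the `t`-integral of `‖F‖` equals `‖𝓕 ψ‖`,
  -- which is integrable because `ψ` is Schwartz.
  have hFint : Integrable (Function.uncurry F)
      ((volume : Measure (Rd d)).prod (volume.restrict (Set.Ioi 0))) := by
    rw [integrable_prod_iff hFm]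
    constructor
    · filter_upwards [hne] with ξ hξ
      exact (Complex.ofRealCLM.integrable_comp (hw.integrableOn_mul_exp hs hξ)).mul_const
        (e ξ * 𝓕 φ ξ)
    · refine (𝓕 ψ : 𝓢(Rd d, ℂ)).integrable.norm.congr ?_
      filter_upwards [hne] with ξ hξ
      have hpos : 0 ≤ subMult w ξ := setIntegral_nonneg measurableSet_Ioi fun t ht =>
        mul_nonneg (hw.nonneg t ht) (Real.exp_pos _).le
      rw [h ξ hξ, norm_mul, Complex.norm_real, Real.norm_of_nonneg hpos, subMult,
        ← integral_mul_const]
      refine setIntegral_congr_fun measurableSet_Ioi fun t ht => ?_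
      simp only [hF, Function.uncurry_apply_pair]
      rw [norm_mul, norm_mul, hnorm, one_mul, Complex.norm_real, Real.norm_of_nonneg
        (mul_nonneg (hw.nonneg t ht) (Real.exp_pos _).le)]
  have h2 : ∫ ξ, e ξ * 𝓕 ψ ξ = ∫ ξ, ∫ t in Set.Ioi 0, F ξ t := by
    refine integral_congr_ae ?_
    filter_upwards [hne] with ξ hξ
    rw [h ξ hξ, hF, integral_mul_const, integral_complex_ofReal]
    change _ = (subMult w ξ : ℂ) * _
    ring
  set G : Rd d → ℝ → ℂ := fun y t => ((w t * heat t (x - y) : ℝ) : ℂ) * φ y with hG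
  have hGm : AEStronglyMeasurable (Function.uncurry G)
      ((volume : Measure (Rd d)).prod (volume.restrict (Set.Ioi 0))) := by
    refine Measurable.aestronglyMeasurable ?_
    simp only [hG, Function.uncurry_def]
    have h3 : Measurable fun p : Rd d × ℝ => φ p.1 := (φ.continuous.comp continuous_fst).measurable
    have h4 : Measurable fun p : Rd d × ℝ => heat p.2 (x - p.1) :=
      measurable_heat.comp (measurable_snd.prodMk (by fun_prop))
    exact (Complex.measurable_ofReal.comp ((hwm.comp measurable_snd).mul h4)).mul h3
  -- On the space side the `t`-integral is at most a multiple of `‖x - y‖ ^ (s - d) * ‖φ y‖`.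
  have hGint : Integrable (Function.uncurry G)
      ((volume : Measure (Rd d)).prod (volume.restrict (Set.Ioi 0))) := by
    rw [integrable_prod_iff hGm]
    constructor
    · filter_upwards [hnex] with y hy
      exact (Complex.ofRealCLM.integrable_comp (hw.integrableOn_mul_heat hsd hy)).mul_const
        (φ y)
    · refine ((integrable_rpow_mul hd hs hsd φ x).const_mul (C * rieszConst d s)).mono'
        hGm.norm.integral_prod_right' ?_
      filter_upwards [hnex] with y hy
      rw [Real.norm_of_nonneg (integral_nonneg fun t => norm_nonneg _), ← mul_assoc]
      have : ∫ t in Set.Ioi 0, ‖Function.uncurry G (y, t)‖ = subKernel w (x - y) * ‖φ y‖ := by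
        rw [subKernel, ← integral_mul_const]
        refine setIntegral_congr_fun measurableSet_Ioi fun t ht => ?_
        simp only [hG, Function.uncurry_apply_pair]
        rw [norm_mul, Complex.norm_real, Real.norm_of_nonneg
          (mul_nonneg (hw.nonneg t ht) (heat_nonneg (le_of_lt ht) _))]
      rw [this]
      gcongr
      exact hw.subKernel_le hsd hy
  rw [h1, h2, integral_integral_swap hFint]
  have h3 : ∀ t ∈ Set.Ioi (0 : ℝ), ∫ ξ, F ξ t = ∫ y, G y t := by
    intro t ht
    simp only [hF, hG, Complex.ofReal_mul (w t), mul_assoc (w t : ℂ)]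
    rw [integral_const_mul, integral_const_mul, heat_conv ht φ.integrable]
    rfl
  rw [setIntegral_congr_fun measurableSet_Ioi h3, ← integral_integral_swap hGint]
  refine integral_congr_ae (.of_forall fun y => ?_)
  simp only [hG]
  rw [integral_mul_const, integral_complex_ofReal]
  rfl

end IsWeight

/-- The complex-valued Schwartz function given by a real-valued one. -/
def toComplex {d : ℕ} : 𝓢(Rd d, ℝ) →L[ℝ] 𝓢(Rd d, ℂ) :=
  SchwartzMap.postcompCLM (𝕜 := ℝ) Complex.ofRealCLM

@[simp]
theorem toComplex_apply {d : ℕ} (φ : 𝓢(Rd d, ℝ)) (x : Rd d) : toComplex φ x = φ x := rfl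

theorem IsWeight.eq_conv_real {d : ℕ} {s C : ℝ} {w : ℝ → ℝ} (hw : IsWeight s C w) (hd : 1 ≤ d)
    (hs : 0 < s) (hsd : s < d) {φ ψ : 𝓢(Rd d, ℝ)}
    (h : ∀ ξ : Rd d, ξ ≠ 0 → 𝓕 (toComplex ψ) ξ = subMult w ξ * 𝓕 (toComplex φ) ξ) (x : Rd d) :
    ψ x = ∫ y, subKernel w (x - y) * φ y := by
  have := hw.eq_conv hd hs hsd h x
  simp only [toComplex_apply, ← Complex.ofReal_mul] at this
  rw [integral_complex_ofReal] at this
  exact_mod_cast this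

/-! ### The Riesz and Bessel weights, their multipliers, and the inverse of the Bessel potential -/

/-- The weight of the Riesz kernel. -/
def rieszWeight (s t : ℝ) : ℝ := t ^ (s / 2 - 1) / Real.Gamma (s / 2)

theorem isWeight_rieszWeight {s : ℝ} (hs : 0 < s) :
    IsWeight s (1 / Real.Gamma (s / 2)) (rieszWeight s) := by
  have hG := Real.Gamma_pos_of_pos (s := s / 2) (by linarith)
  refine ⟨by unfold rieszWeight; fun_prop, fun t ht => by unfold rieszWeight; positivity,
    fun t ht => ?_⟩
  rw [rieszWeight, div_mul_eq_mul_div, one_mul]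

theorem subMult_rieszWeight {d : ℕ} {s : ℝ} (hs : 0 < s) {ξ : Rd d} (hξ : ξ ≠ 0) :
    subMult (rieszWeight s) ξ = (2 * Real.pi * ‖ξ‖) ^ (-s) := by
  have hG := Real.Gamma_pos_of_pos (s := s / 2) (by linarith)
  have hξ' : 0 < 2 * Real.pi * ‖ξ‖ := by
    have := norm_pos_iff.2 hξ
    positivity
  have h := Real.integral_rpow_mul_exp_neg_mul_Ioi (a := s / 2) (by linarith)
    (r := (2 * Real.pi * ‖ξ‖) ^ 2) (by positivity)
  have h2 : subMult (rieszWeight s) ξ = (1 / Real.Gamma (s / 2)) *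
      ∫ t in Set.Ioi (0 : ℝ), t ^ (s / 2 - 1) * Real.exp (-((2 * Real.pi * ‖ξ‖) ^ 2 * t)) := by
    rw [subMult, ← integral_const_mul]
    refine integral_congr_ae (.of_forall fun t => ?_)
    simp only [rieszWeight]
    rw [mul_comm t]
    ring
  rw [h2, h, one_div ((2 * Real.pi * ‖ξ‖) ^ 2), Real.inv_rpow (by positivity),
    ← Real.rpow_natCast, ← Real.rpow_mul hξ'.le, Real.rpow_neg hξ'.le]
  push_cast
  rw [mul_div_cancel₀ s two_ne_zero]
  field_simp

/-- The weight of the Bessel kernel. -/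
def besselWeight (m : ℕ) (t : ℝ) : ℝ := t ^ ((m : ℝ) - 1) * Real.exp (-t) / Real.Gamma m

theorem rpow_mul_exp_neg_le {b t : ℝ} (hb : 0 ≤ b) (ht : 0 < t) :
    t ^ b * Real.exp (-t) ≤ 1 + (⌈b⌉₊.factorial : ℝ) := by
  have h1 : t ^ b ≤ 1 + t ^ ⌈b⌉₊ := by
    rcases le_or_gt t 1 with h | h
    · exact (Real.rpow_le_one ht.le h hb).trans (by simp only [le_add_iff_nonneg_right]; positivity)
    · refine le_trans ?_ (le_add_of_nonneg_left zero_le_one)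
      rw [← Real.rpow_natCast]
      exact Real.rpow_le_rpow_of_exponent_le h.le (Nat.le_ceil b)
  have h2 : t ^ ⌈b⌉₊ ≤ ⌈b⌉₊.factorial * Real.exp t := by
    have := Real.pow_div_factorial_le_exp t ht.le ⌈b⌉₊
    rwa [div_le_iff₀' (by positivity)] at this
  calc t ^ b * Real.exp (-t) ≤ (1 + ⌈b⌉₊.factorial * Real.exp t) * Real.exp (-t) := by
        gcongr; linarith
    _ = Real.exp (-t) + ⌈b⌉₊.factorial * (Real.exp t * Real.exp (-t)) := by ring
    _ ≤ 1 + ⌈b⌉₊.factorial := by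
        rw [← Real.exp_add, add_neg_cancel, Real.exp_zero, mul_one]
        gcongr
        exact Real.exp_le_one_iff.2 (by linarith)

/-- The quotient of the weight by `t ^ (s / 2 - 1)` is a multiple of `t ^ (m - s / 2) * exp (-t)`,
bounded when `m ≥ s / 2`. Hence Bessel potentials inherit every bound proved for Riesz potentials of
order `s`. -/
theorem exists_isWeight_besselWeight {s : ℝ} {m : ℕ} (hm : 1 ≤ m) (hsm : s / 2 ≤ m) :
    ∃ C, IsWeight s C (besselWeight m) := by
  have hm' : (0 : ℝ) < m := by exact_mod_cast hm
  have hG := Real.Gamma_pos_of_pos hm'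
  refine ⟨(1 + (⌈(m : ℝ) - s / 2⌉₊.factorial : ℝ)) / Real.Gamma m,
    by unfold besselWeight; fun_prop, fun t ht => by unfold besselWeight; positivity,
    fun t ht => ?_⟩
  have h := rpow_mul_exp_neg_le (b := m - s / 2) (by linarith) ht
  have h2 : t ^ ((m : ℝ) - 1) = t ^ (s / 2 - 1) * t ^ ((m : ℝ) - s / 2) := by
    rw [← Real.rpow_add ht]; ring_nf
  rw [besselWeight, h2, div_mul_eq_mul_div]
  refine div_le_div_of_nonneg_right ?_ hG.le
  calc t ^ (s / 2 - 1) * t ^ ((m : ℝ) - s / 2) * Real.exp (-t)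
      = (t ^ ((m : ℝ) - s / 2) * Real.exp (-t)) * t ^ (s / 2 - 1) := by ring
    _ ≤ _ := by gcongr

theorem subMult_besselWeight {d : ℕ} {m : ℕ} (hm : 1 ≤ m) (ξ : Rd d) :
    subMult (besselWeight m) ξ = ((1 + (2 * Real.pi * ‖ξ‖) ^ 2) ^ m)⁻¹ := by
  have hm' : (0 : ℝ) < m := by exact_mod_cast hm
  have hG := Real.Gamma_pos_of_pos hm'
  have h := Real.integral_rpow_mul_exp_neg_mul_Ioi (a := m) hm'
    (r := 1 + (2 * Real.pi * ‖ξ‖) ^ 2) (by positivity)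
  have h2 : subMult (besselWeight m) ξ = (1 / Real.Gamma m) *
      ∫ t in Set.Ioi (0 : ℝ), t ^ ((m : ℝ) - 1) *
        Real.exp (-((1 + (2 * Real.pi * ‖ξ‖) ^ 2) * t)) := by
    rw [subMult, ← integral_const_mul]
    refine integral_congr_ae (.of_forall fun t => ?_)
    simp only [besselWeight]
    rw [show -((1 + (2 * Real.pi * ‖ξ‖) ^ 2) * t) = -t + -(t * (2 * Real.pi * ‖ξ‖) ^ 2) by ring,
      Real.exp_add]
    ring
  rw [h2, h, Real.rpow_natCast, one_div_pow]
  field_simp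

/-- The operator `(1 - Δ) ^ m` on real-valued Schwartz functions. -/
def besselOp (d m : ℕ) : 𝓢(Rd d, ℝ) →L[ℝ] 𝓢(Rd d, ℝ) :=
  (ContinuousLinearMap.id ℝ _ - LineDeriv.laplacianCLM ℝ (Rd d) 𝓢(Rd d, ℝ)) ^ m

open Laplacian in
theorem toComplex_laplacian {d : ℕ} (φ : 𝓢(Rd d, ℝ)) : toComplex (Δ φ) = Δ (toComplex φ) := by
  ext x
  rw [toComplex_apply, SchwartzMap.laplacian_apply, SchwartzMap.laplacian_apply]
  have := (φ.contDiffAt 2 (x := x)).laplacian_CLM_comp_left (l := Complex.ofRealCLM)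
  exact this.symm

open Laplacian in
theorem fourier_laplacian {d : ℕ} (φ : 𝓢(Rd d, ℂ)) (ξ : Rd d) :
    𝓕 (Δ φ) ξ = -((2 * Real.pi * ‖ξ‖) ^ 2 : ℝ) * 𝓕 φ ξ := by
  rw [SchwartzMap.laplacian_eq_fourierMultiplierCLM, SchwartzMap.fourierMultiplierCLM_apply,
    FourierTransform.fourier_smul, FourierTransform.fourier_fourierInv_eq]
  rw [smul_apply, SchwartzMap.smulLeftCLM_apply_apply (by fun_prop)]
  simp only [Complex.real_smul]
  push_cast
  ring

/-- The symbol is the reciprocal of the multiplier in `subMult_besselWeight`, so convolution with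
the Bessel kernel inverts `besselOp`. -/
theorem fourier_besselOp {d m : ℕ} (φ : 𝓢(Rd d, ℝ)) (ξ : Rd d) :
    𝓕 (toComplex (besselOp d m φ)) ξ =
      ((1 + (2 * Real.pi * ‖ξ‖) ^ 2 : ℝ) : ℂ) ^ m * 𝓕 (toComplex φ) ξ := by
  induction m with
  | zero => simp [besselOp]
  | succ m ih =>
    have h1 : besselOp d (m + 1) φ = besselOp d m φ - Laplacian.laplacian (besselOp d m φ) := by
      unfold besselOp
      rw [pow_succ']
      rfl
    rw [h1, map_sub, toComplex_laplacian, sub_eq_add_neg, ← neg_one_smul ℂ,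
      FourierTransform.fourier_add, FourierTransform.fourier_smul, add_apply, smul_apply,
      fourier_laplacian, ih]
    push_cast
    simp only [smul_eq_mul]
    ring

/-! ### Gaussian sums -/

/-- The absolute moment `𝔼 |γ|^q` of a standard Gaussian random variable. -/
def gaussMoment (q : ℝ) : ℝ≥0∞ := ∫⁻ x, ‖x‖ₑ ^ q ∂(gaussianReal 0 1)

theorem gaussMoment_ne_top {q : ℝ} (hq : 0 < q) : gaussMoment q ≠ ∞ := by
  have h := (memLp_id_gaussianReal (μ := 0) (v := 1) q.toNNReal).eLpNorm_lt_top
  have h2 : ((q.toNNReal : ℝ≥0∞)).toReal = q := by simp [hq.le]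
  have h3 := lintegral_rpow_enorm_lt_top_of_eLpNorm_lt_top (by simpa using hq)
    ENNReal.coe_ne_top h
  rw [h2] at h3
  exact h3.ne

theorem gaussMoment_two : gaussMoment 2 = 1 := by
  have h1 : ∫ x, x ^ 2 ∂(gaussianReal 0 1) = 1 := by
    have := variance_fun_id_gaussianReal (μ := 0) (v := 1)
    rw [variance_of_integral_eq_zero (by fun_prop) (by simp)] at this
    simpa using this
  have h2 : Integrable (fun x : ℝ => x ^ 2) (gaussianReal 0 1) :=
    .of_integral_ne_zero (by rw [h1]; norm_num)
  have h3 := ofReal_integral_eq_lintegral_ofReal h2 (.of_forall fun x => sq_nonneg x)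
  rw [h1, ENNReal.ofReal_one] at h3
  rw [gaussMoment, h3]
  refine lintegral_congr fun x => ?_
  rw [ENNReal.rpow_two, ← ofReal_norm, ← ENNReal.ofReal_pow (norm_nonneg _), Real.norm_eq_abs,
    sq_abs]

/-- Completeness of `L²(Ω; X)`. It asks `X` to be complete, which is the reason for summing in
`repPairs` first. -/
theorem exists_tendsto_eLpNorm_of_tail {Ω : Type*} [MeasurableSpace Ω] {Pr : Measure Ω}
    {X : Type*} [NormedAddCommGroup X] [CompleteSpace X]
    {F : ℕ → Ω → X} (hF : ∀ n, MemLp (F n) 2 Pr) {b : ℕ → ℝ≥0∞} (hb : Tendsto b atTop (𝓝 0))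
    (h : ∀ M N, M ≤ N → eLpNorm (F N - F M) 2 Pr ≤ b M) :
    ∃ Y : Ω → X, MemLp Y 2 Pr ∧ Tendsto (fun N => eLpNorm (F N - Y) 2 Pr) atTop (𝓝 0) := by
  have hc : CauchySeq fun n => (hF n).toLp (F n) := by
    refine EMetric.cauchySeq_iff'.2 fun ε hε => ?_
    obtain ⟨M, hM⟩ := (hb.eventually (gt_mem_nhds hε)).exists
    refine ⟨M, fun N hN => ?_⟩
    rw [Lp.edist_toLp_toLp]
    exact (h M N hN).trans_lt hM
  obtain ⟨Y, hY⟩ := cauchySeq_tendsto_of_complete hc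
  refine ⟨Y, Lp.memLp Y, ?_⟩
  rw [← Lp.tendsto_Lp_iff_tendsto_eLpNorm'' F hF Y (Lp.memLp Y), Lp.toLp_coeFn]
  exact hY

variable {Ω : Type*} [MeasurableSpace Ω] {Pr : Measure Ω} [IsProbabilityMeasure Pr]
  {γ : ℕ → Ω → ℝ}

theorem IsGaussianSeq.hasLaw_sum (h : IsGaussianSeq Pr γ) (a : ℕ → ℝ) (I : Finset ℕ) :
    HasLaw (fun ω => ∑ n ∈ I, γ n ω * a n)
      (gaussianReal 0 (∑ n ∈ I, ‖a n‖₊ ^ 2)) Pr := by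
  have hlaw : ∀ n, HasLaw (fun ω => γ n ω * a n) (gaussianReal 0 (‖a n‖₊ ^ 2)) Pr := by
    intro n
    have := gaussianReal_const_mul (h.1 n) (a n)
    rw [mul_zero, mul_one, show NNReal.mk (a n ^ 2) (sq_nonneg _) = ‖a n‖₊ ^ 2 by ext; simp] at this
    simp_rw [mul_comm (γ n _)]
    exact this
  have hind : iIndepFun (fun n ω => γ n ω * a n) Pr :=
    h.2.comp (fun n x => x * a n) fun n => by fun_prop
  induction I using Finset.induction_on with
  | empty =>
    simp only [Finset.sum_empty]
    refine ⟨by fun_prop, ?_⟩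
    rw [gaussianReal_zero_var, Measure.map_const]
    simp
  | insert n I hn ih =>
    have hI := hind.indepFun_finsetSum_of_notMem₀ (fun k => (hlaw k).aemeasurable) hn
    have h1 := gaussianReal_add_gaussianReal_of_indepFun hI (m₁ := 0) (m₂ := 0)
      (v₁ := ∑ n ∈ I, ‖a n‖₊ ^ 2) (by
        rw [← ih.map_eq]
        congr 1
        ext ω
        simp) (hlaw n).map_eq
    refine ⟨Finset.aemeasurable_fun_sum _ fun k _ => (hlaw k).aemeasurable, ?_⟩
    rw [Finset.sum_insert hn, add_comm]
    rw [add_zero] at h1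
    rw [← h1]
    congr 1
    ext ω
    simp [Finset.sum_insert hn, add_comm]

/-- The sum has the law of a standard Gaussian multiplied by the square root of `∑ a_n²`. -/
theorem IsGaussianSeq.lintegral_rpow_sum (h : IsGaussianSeq Pr γ) (a : ℕ → ℝ) (I : Finset ℕ)
    {q : ℝ} (hq : 0 < q) :
    ∫⁻ ω, ‖∑ n ∈ I, γ n ω * a n‖ₑ ^ q ∂Pr =
      gaussMoment q * (∑ n ∈ I, ‖a n‖ₑ ^ (2 : ℝ)) ^ (q / 2) := by
  set v : ℝ≥0 := ∑ n ∈ I, ‖a n‖₊ ^ 2 with hv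
  have h1 : ∫⁻ ω, ‖∑ n ∈ I, γ n ω * a n‖ₑ ^ q ∂Pr = ∫⁻ x, ‖x‖ₑ ^ q ∂(gaussianReal 0 v) := by
    rw [← (h.hasLaw_sum a I).map_eq, lintegral_map' (by fun_prop) (h.hasLaw_sum a I).aemeasurable]
  have h2 : gaussianReal 0 v = (gaussianReal 0 1).map (Real.sqrt v * ·) := by
    rw [gaussianReal_map_const_mul, mul_zero, mul_one]
    congr 1
    ext
    simp
  have h3 : ∑ n ∈ I, ‖a n‖ₑ ^ (2 : ℝ) = v := by
    rw [hv, ENNReal.ofNNReal_finsetSum]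
    refine Finset.sum_congr rfl fun n _ => ?_
    rw [ENNReal.rpow_two, ENNReal.coe_pow]
    rfl
  have h4 : ‖Real.sqrt v‖ₑ ^ q = (v : ℝ≥0∞) ^ (q / 2) := by
    rw [Real.enorm_of_nonneg (Real.sqrt_nonneg _), ← ENNReal.ofReal_coe_nnreal,
      ENNReal.ofReal_rpow_of_nonneg (Real.sqrt_nonneg _) hq.le,
      ENNReal.ofReal_rpow_of_nonneg v.coe_nonneg (by positivity), Real.sqrt_eq_rpow,
      ← Real.rpow_mul v.coe_nonneg]
    congr 2
    ring
  rw [h1, h2, lintegral_map (by fun_prop) (by fun_prop), h3]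
  simp_rw [enorm_mul, ENNReal.mul_rpow_of_nonneg _ _ hq.le]
  rw [lintegral_const_mul _ (by fun_prop), h4, gaussMoment, mul_comm]

/-! ### Gaussian sums in `L^q` and square functions -/

section Lp

variable {α : Type*} [MeasurableSpace α] {μ : Measure α}

theorem coeFn_sum_smul {p : ℝ≥0∞} (f : ℕ → Lp ℝ p μ) (c : ℕ → ℝ) (I : Finset ℕ) :
    (∑ n ∈ I, c n • f n : Lp ℝ p μ) =ᵐ[μ] fun x => ∑ n ∈ I, c n * f n x := by
  induction I using Finset.induction_on with
  | empty =>
    simp only [Finset.sum_empty]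
    exact Lp.coeFn_zero _ _ _
  | insert n I hn ih =>
    rw [Finset.sum_insert hn]
    filter_upwards [Lp.coeFn_add (c n • f n) (∑ n ∈ I, c n • f n), ih, Lp.coeFn_smul (c n) (f n)]
      with x h1 h2 h3
    rw [h1, Pi.add_apply, h2, h3, Finset.sum_insert hn]
    simp

/-- On a probability space the second moment is dominated by the `q`-th one, and in `L^q(Ω; L^q)`
Fubini allows the scalar Gaussian moment to be computed at each point `x`. -/
theorem IsGaussianSeq.eLpNorm_sum_le [SFinite μ] (h : IsGaussianSeq Pr γ) {q : ℝ≥0}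
    [Fact ((1 : ℝ≥0∞) ≤ q)] (hq : (2 : ℝ≥0∞) ≤ q) (f : ℕ → Lp ℝ q μ) (I : Finset ℕ) :
    eLpNorm (fun ω => ∑ n ∈ I, γ n ω • f n) 2 Pr ≤
      (gaussMoment q * ∫⁻ x, (∑ n ∈ I, ‖f n x‖ₑ ^ (2 : ℝ)) ^ ((q : ℝ) / 2) ∂μ) ^ (1 / (q : ℝ)) := by
  have hq2 : (2 : ℝ≥0) ≤ q := by exact_mod_cast hq
  have hq0 : (0 : ℝ) < q := by
    have : (2 : ℝ) ≤ q := by exact_mod_cast hq2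
    linarith
  have hq0' : (q : ℝ≥0∞) ≠ 0 := by
    have : q ≠ 0 := by rintro rfl; simp at hq0
    exact_mod_cast this
  have hγ : ∀ n, AEMeasurable (γ n) Pr := fun n => (h.1 n).aemeasurable
  have hm : AEStronglyMeasurable (fun ω => ∑ n ∈ I, γ n ω • f n) Pr :=
    Finset.aestronglyMeasurable_fun_sum _ fun n _ =>
      (hγ n).aestronglyMeasurable.smul_const (f n)
  refine (eLpNorm_le_eLpNorm_of_exponent_le hq hm).trans_eq ?_
  rw [eLpNorm_eq_lintegral_rpow_enorm_toReal hq0' ENNReal.coe_ne_top, ENNReal.coe_toReal]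
  congr 1
  have h1 : ∀ ω, ‖∑ n ∈ I, γ n ω • f n‖ₑ ^ (q : ℝ) =
      ∫⁻ x, ‖∑ n ∈ I, γ n ω * f n x‖ₑ ^ (q : ℝ) ∂μ := by
    intro ω
    rw [Lp.enorm_def, eLpNorm_eq_lintegral_rpow_enorm_toReal hq0' ENNReal.coe_ne_top,
      ENNReal.coe_toReal, ← ENNReal.rpow_mul, one_div_mul_cancel hq0.ne', ENNReal.rpow_one]
    refine lintegral_congr_ae ?_
    filter_upwards [coeFn_sum_smul f (fun n => γ n ω) I] with x hx
    rw [hx]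
  simp_rw [h1]
  rw [lintegral_lintegral_swap]
  · simp_rw [h.lintegral_rpow_sum _ I hq0]
    rw [lintegral_const_mul'' _]
    refine AEMeasurable.pow_const ?_ _
    exact Finset.aemeasurable_fun_sum _ fun n _ =>
      ((Lp.aestronglyMeasurable (f n)).enorm).pow_const _
  · refine AEMeasurable.pow_const (AEMeasurable.enorm ?_) _
    refine Finset.aemeasurable_fun_sum _ fun n _ => ?_
    exact (hγ n).comp_fst.mul (Lp.aestronglyMeasurable (f n)).aemeasurable.comp_snd

/-- The bound for the tail of a Gaussian series with square function `(∑ |f_n|²)^{1/2}`. -/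
def tailBound (q : ℝ≥0) (f : ℕ → Lp ℝ q μ) (M : ℕ) : ℝ≥0∞ :=
  (gaussMoment q * ∫⁻ x, (∑' k, ‖f (k + M) x‖ₑ ^ (2 : ℝ)) ^ ((q : ℝ) / 2) ∂μ) ^ (1 / (q : ℝ))

theorem IsGaussianSeq.eLpNorm_sum_le_tailBound [SFinite μ] (h : IsGaussianSeq Pr γ) {q : ℝ≥0}
    [Fact ((1 : ℝ≥0∞) ≤ q)] (hq : (2 : ℝ≥0∞) ≤ q) (f : ℕ → Lp ℝ q μ) {I : Finset ℕ} {M : ℕ} (hI : ∀ n ∈ I, M ≤ n) :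
    eLpNorm (fun ω => ∑ n ∈ I, γ n ω • f n) 2 Pr ≤ tailBound q f M := by
  refine (h.eLpNorm_sum_le hq f I).trans ?_
  unfold tailBound
  gcongr with x
  have : ∑ n ∈ I, ‖f n x‖ₑ ^ (2 : ℝ) =
      ∑ k ∈ I.image (fun n => n - M), ‖f (k + M) x‖ₑ ^ (2 : ℝ) := by
    rw [Finset.sum_image fun a ha b hb hab => by
      have h1 := hI a ha
      have h2 := hI b hb
      have : a - M = b - M := hab
      omega]
    exact Finset.sum_congr rfl fun n hn => by rw [Nat.sub_add_cancel (hI n hn)]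
  rw [this]
  exact ENNReal.sum_le_tsum _

/-- Dominated convergence: the full square function is an integrable majorant, hence finite almost
everywhere, so the tails tend to `0` pointwise. -/
theorem tendsto_tailBound {q : ℝ≥0} (hq : (2 : ℝ≥0∞) ≤ q) (f : ℕ → Lp ℝ q μ)
    (hf : ∫⁻ x, (∑' n, ‖f n x‖ₑ ^ (2 : ℝ)) ^ ((q : ℝ) / 2) ∂μ ≠ ∞) :
    Tendsto (tailBound q f) atTop (𝓝 0) := by
  have hq0 : (0 : ℝ) < q := by
    have : (2 : ℝ) ≤ q := by exact_mod_cast hq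
    linarith
  have hm : ∀ n, AEMeasurable (fun x => ‖f n x‖ₑ ^ (2 : ℝ)) μ := fun n =>
    ((Lp.aestronglyMeasurable (f n)).enorm).pow_const _
  have h1 : Tendsto (fun M => ∫⁻ x, (∑' k, ‖f (k + M) x‖ₑ ^ (2 : ℝ)) ^ ((q : ℝ) / 2) ∂μ) atTop
      (𝓝 (∫⁻ _, 0 ∂μ)) := by
    refine tendsto_lintegral_of_dominated_convergence' _
      (fun M => (AEMeasurable.tsum fun k => hm (k + M)).pow_const _)
      (fun M => .of_forall fun x => ?_) hf ?_
    · simp only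
      refine ENNReal.rpow_le_rpow ?_ (by positivity)
      exact ENNReal.tsum_comp_le_tsum_of_injective (add_left_injective M)
        fun n => ‖f n x‖ₑ ^ (2 : ℝ)
    · filter_upwards [ae_lt_top' ((AEMeasurable.tsum hm).pow_const _) hf] with x hx
      have h2 : ∑' n, ‖f n x‖ₑ ^ (2 : ℝ) ≠ ∞ := by
        intro h3
        rw [h3, ENNReal.top_rpow_of_pos (by positivity)] at hx
        exact lt_irrefl _ hx
      have h3 := (ENNReal.tendsto_sum_nat_add _ h2)
      have h4 := h3.ennrpow_const ((q : ℝ) / 2)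
      rwa [ENNReal.zero_rpow_of_pos (by positivity)] at h4
  rw [lintegral_zero] at h1
  have h2 := (ENNReal.Tendsto.const_mul h1 (Or.inr (gaussMoment_ne_top hq0))).ennrpow_const
    (1 / (q : ℝ))
  rwa [mul_zero, ENNReal.zero_rpow_of_pos (by positivity)] at h2

end Lp

/-! ### Convolution with a subordinate kernel of a product -/

/-- The square function of the multiplication operator followed by the Riesz potential. -/
def sqRiesz {d : ℕ} (s : ℝ) {η : ℝ≥0∞} (g : Lp ℝ η (volume : Measure (Rd d))) (x : Rd d) : ℝ≥0∞ :=
  rieszPot (2 * (s - d)) (fun y => ‖g y‖ₑ ^ (2 : ℝ)) x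

/-- The convolution `K * (g h)`, where `K` is the kernel with weight `w`. -/
def convMul {d : ℕ} (w : ℝ → ℝ) {η : ℝ≥0∞} (g : Lp ℝ η (volume : Measure (Rd d)))
    (h : Lp ℝ 2 (volume : Measure (Rd d))) (x : Rd d) : ℝ :=
  ∫ y, subKernel w (x - y) * (g y * h y)

theorem measurable_sqRiesz {d : ℕ} (s : ℝ) {η : ℝ≥0∞} (g : Lp ℝ η (volume : Measure (Rd d))) :
    Measurable (sqRiesz s g) :=
  measurable_rieszPot _ ((Lp.stronglyMeasurable g).measurable.enorm.pow_const _)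

theorem enorm_lp_two {d : ℕ} (h : Lp ℝ 2 (volume : Measure (Rd d))) :
    ‖h‖ₑ = (∫⁻ y, ‖h y‖ₑ ^ (2 : ℝ)) ^ (1 / (2 : ℝ)) := by
  rw [Lp.enorm_def, eLpNorm_eq_lintegral_rpow_enorm_toReal two_ne_zero ENNReal.ofNat_ne_top]
  simp

namespace IsWeight

variable {d : ℕ} {s C : ℝ} {w : ℝ → ℝ} {η : ℝ≥0∞}

theorem enorm_subKernel_le (hw : IsWeight s C w) (hsd : s < d) {z : Rd d} (hz : z ≠ 0) :
    ‖subKernel w z‖ₑ ≤ ENNReal.ofReal (C * rieszConst d s) * ENNReal.ofReal (‖z‖ ^ (s - d)) := by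
  rw [Real.enorm_of_nonneg (hw.subKernel_nonneg z), ← ENNReal.ofReal_mul' (by positivity)]
  exact ENNReal.ofReal_le_ofReal (hw.subKernel_le hsd hz)

theorem measurable_subKernel_mul (hw : IsWeight s C w) {f : Rd d → ℝ} (hf : Measurable f) :
    Measurable (fun p : Rd d × Rd d => subKernel w (p.1 - p.2) * f p.2) :=
  (hw.measurable_subKernel.comp (by fun_prop)).mul (hf.comp measurable_snd)

theorem measurable_subKernel_mul_right (hw : IsWeight s C w) {f : Rd d → ℝ} (hf : Measurable f)
    (x : Rd d) : Measurable fun y => subKernel w (x - y) * f y :=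
  (hw.measurable_subKernel.comp (measurable_const.sub measurable_id)).mul hf

/-- Squaring the pointwise bound by `‖z‖ ^ (s - d)` gives the Riesz kernel of exponent `2 (s - d)`
acting on `|g|²`. -/
theorem lintegral_sq_le (hw : IsWeight s C w) (hd : 1 ≤ d) (hsd : s < d)
    (g : Lp ℝ η (volume : Measure (Rd d))) (x : Rd d) :
    ∫⁻ y, ‖subKernel w (x - y) * g y‖ₑ ^ (2 : ℝ) ≤
      ENNReal.ofReal (C * rieszConst d s) ^ (2 : ℝ) * sqRiesz s g x := by
  have hgm : Measurable g := (Lp.stronglyMeasurable g).measurable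
  have : Nonempty (Fin d) := ⟨⟨0, hd⟩⟩
  rw [sqRiesz, rieszPot, ← lintegral_const_mul _ (by fun_prop)]
  refine lintegral_mono_ae ?_
  filter_upwards [Measure.ae_ne volume x] with y hy
  rw [enorm_mul, ENNReal.mul_rpow_of_nonneg _ _ zero_le_two, ← mul_assoc]
  gcongr
  calc ‖subKernel w (x - y)‖ₑ ^ (2 : ℝ)
      ≤ (ENNReal.ofReal (C * rieszConst d s) * ENNReal.ofReal (‖x - y‖ ^ (s - d))) ^ (2 : ℝ) := by
        gcongr
        exact hw.enorm_subKernel_le hsd (sub_ne_zero.2 hy.symm)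
    _ = _ := by
        have h0 : 0 ≤ ‖x - y‖ ^ (s - d) := by positivity
        rw [ENNReal.mul_rpow_of_nonneg _ _ zero_le_two,
          ENNReal.ofReal_rpow_of_nonneg h0 zero_le_two,
          ← Real.rpow_mul (norm_nonneg _), mul_comm (s - d)]

theorem lintegral_conv_le (hw : IsWeight s C w) (hd : 1 ≤ d) (hsd : s < d)
    (g : Lp ℝ η (volume : Measure (Rd d))) (h : Lp ℝ 2 (volume : Measure (Rd d))) (x : Rd d) :
    ∫⁻ y, ‖subKernel w (x - y) * (g y * h y)‖ₑ ≤
      ENNReal.ofReal (C * rieszConst d s) * sqRiesz s g x ^ (1 / (2 : ℝ)) * ‖h‖ₑ := by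
  have hgm : Measurable g := (Lp.stronglyMeasurable g).measurable
  have hhm : Measurable h := (Lp.stronglyMeasurable h).measurable
  have hKm : Measurable fun y => subKernel w (x - y) * g y :=
    hw.measurable_subKernel_mul_right hgm x
  have h1 := ENNReal.lintegral_mul_le_Lp_mul_Lq volume Real.HolderConjugate.two_two
    (f := fun y => ‖subKernel w (x - y) * g y‖ₑ) (g := fun y => ‖h y‖ₑ)
    hKm.enorm.aemeasurable hhm.enorm.aemeasurable
  have h2 : (∫⁻ y, ‖subKernel w (x - y) * (g y * h y)‖ₑ) =
      ∫⁻ y, ((fun y => ‖subKernel w (x - y) * g y‖ₑ) * fun y => ‖h y‖ₑ) y := by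
    refine lintegral_congr fun y => ?_
    rw [Pi.mul_apply, ← enorm_mul, mul_assoc]
  rw [h2, enorm_lp_two h]
  refine h1.trans ?_
  refine mul_le_mul_left ?_ _
  calc (∫⁻ y, ‖subKernel w (x - y) * g y‖ₑ ^ (2 : ℝ)) ^ (1 / (2 : ℝ))
      ≤ (ENNReal.ofReal (C * rieszConst d s) ^ (2 : ℝ) * sqRiesz s g x) ^ (1 / (2 : ℝ)) :=
        ENNReal.rpow_le_rpow (hw.lintegral_sq_le hd hsd g x) (by norm_num)
    _ = _ := by
        rw [ENNReal.mul_rpow_of_nonneg _ _ (by norm_num), ← ENNReal.rpow_mul,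
          mul_one_div_cancel two_ne_zero, ENNReal.rpow_one]

theorem measurable_convMul (hw : IsWeight s C w) (g : Lp ℝ η (volume : Measure (Rd d)))
    (h : Lp ℝ 2 (volume : Measure (Rd d))) : StronglyMeasurable (convMul w g h) :=
  (hw.measurable_subKernel_mul ((Lp.stronglyMeasurable g).measurable.mul
    (Lp.stronglyMeasurable h).measurable)).stronglyMeasurable.integral_prod_right

theorem enorm_convMul_le (hw : IsWeight s C w) (hd : 1 ≤ d) (hsd : s < d)
    (g : Lp ℝ η (volume : Measure (Rd d))) (h : Lp ℝ 2 (volume : Measure (Rd d))) (x : Rd d) :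
    ‖convMul w g h x‖ₑ ≤
      ENNReal.ofReal (C * rieszConst d s) * sqRiesz s g x ^ (1 / (2 : ℝ)) * ‖h‖ₑ :=
  (enorm_integral_le_lintegral_enorm _).trans (hw.lintegral_conv_le hd hsd g h x)

variable {q : ℝ≥0} [Fact ((1 : ℝ≥0∞) ≤ q)]

theorem eLpNorm_convMul_le (hw : IsWeight s C w) (hd : 1 ≤ d) (hsd : s < d)
    (g : Lp ℝ η (volume : Measure (Rd d))) (h : Lp ℝ 2 (volume : Measure (Rd d))) :
    eLpNorm (convMul w g h) q volume ≤ ENNReal.ofReal (C * rieszConst d s) *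
      (∫⁻ x, sqRiesz s g x ^ ((q : ℝ) / 2)) ^ (1 / (q : ℝ)) * ‖h‖ₑ := by
  have hq1 : (1 : ℝ≥0∞) ≤ q := Fact.out
  have hq0 : (0 : ℝ) < q := by
    have : (1 : ℝ) ≤ q := by exact_mod_cast hq1
    linarith
  have hq0' : (q : ℝ≥0∞) ≠ 0 := (zero_lt_one.trans_le hq1).ne'
  rw [eLpNorm_eq_lintegral_rpow_enorm_toReal hq0' ENNReal.coe_ne_top, ENNReal.coe_toReal]
  calc (∫⁻ x, ‖convMul w g h x‖ₑ ^ (q : ℝ)) ^ (1 / (q : ℝ))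
      ≤ (∫⁻ x, (ENNReal.ofReal (C * rieszConst d s) * ‖h‖ₑ) ^ (q : ℝ) *
          sqRiesz s g x ^ ((q : ℝ) / 2)) ^ (1 / (q : ℝ)) := by
        gcongr with x
        refine (ENNReal.rpow_le_rpow (hw.enorm_convMul_le hd hsd g h x) hq0.le).trans_eq ?_
        rw [mul_right_comm, ENNReal.mul_rpow_of_nonneg _ _ hq0.le, ← ENNReal.rpow_mul,
          one_div_mul_eq_div]
    _ = _ := by
        rw [lintegral_const_mul _ ((measurable_sqRiesz s g).pow_const _),
          ENNReal.mul_rpow_of_nonneg _ _ (by positivity), ← ENNReal.rpow_mul,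
          mul_one_div_cancel hq0.ne', ENNReal.rpow_one]
        ring

theorem memLp_convMul (hw : IsWeight s C w) (hd : 1 ≤ d) (hsd : s < d)
    {g : Lp ℝ η (volume : Measure (Rd d))} (hR : ∫⁻ x, sqRiesz s g x ^ ((q : ℝ) / 2) ≠ ∞)
    (h : Lp ℝ 2 (volume : Measure (Rd d))) : MemLp (convMul w g h) q volume := by
  refine ⟨(hw.measurable_convMul g h).aestronglyMeasurable,
    (hw.eLpNorm_convMul_le hd hsd g h).trans_lt ?_⟩
  exact ENNReal.mul_lt_top (ENNReal.mul_lt_top ENNReal.ofReal_lt_top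
    (ENNReal.rpow_lt_top_of_nonneg (by positivity) hR)) enorm_lt_top

theorem ae_sqRiesz_lt_top {g : Lp ℝ η (volume : Measure (Rd d))}
    (hR : ∫⁻ x, sqRiesz s g x ^ ((q : ℝ) / 2) ≠ ∞) : ∀ᵐ x, sqRiesz s g x < ∞ := by
  have hq1 : (1 : ℝ≥0∞) ≤ q := Fact.out
  have hq0 : (0 : ℝ) < q := by
    have : (1 : ℝ) ≤ q := by exact_mod_cast hq1
    linarith
  filter_upwards [ae_lt_top ((measurable_sqRiesz s g).pow_const _) hR] with x hx
  by_contra h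
  rw [not_lt, top_le_iff] at h
  rw [h, ENNReal.top_rpow_of_pos (by positivity)] at hx
  exact lt_irrefl _ hx

theorem integrable_conv (hw : IsWeight s C w) (hd : 1 ≤ d) (hsd : s < d)
    {g : Lp ℝ η (volume : Measure (Rd d))} (h : Lp ℝ 2 (volume : Measure (Rd d))) {x : Rd d}
    (hx : sqRiesz s g x < ∞) : Integrable fun y => subKernel w (x - y) * (g y * h y) :=
  ⟨(hw.measurable_subKernel_mul_right ((Lp.stronglyMeasurable g).measurable.mul
    (Lp.stronglyMeasurable h).measurable) x).aestronglyMeasurable,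
    (hw.lintegral_conv_le hd hsd g h x).trans_lt (ENNReal.mul_lt_top (ENNReal.mul_lt_top
      ENNReal.ofReal_lt_top (ENNReal.rpow_lt_top_of_nonneg (by positivity) hx.ne)) enorm_lt_top)⟩

/-- The operator `h ↦ K * (g h)` from `L²` to `L^q`. -/
def convMulCLM (hw : IsWeight s C w) (hd : 1 ≤ d) (hsd : s < d)
    {g : Lp ℝ η (volume : Measure (Rd d))} (hR : ∫⁻ x, sqRiesz s g x ^ ((q : ℝ) / 2) ≠ ∞) :
    Lp ℝ 2 (volume : Measure (Rd d)) →L[ℝ] Lp ℝ q (volume : Measure (Rd d)) :=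
  LinearMap.mkContinuous
    { toFun := fun h => (hw.memLp_convMul hd hsd hR h).toLp
      map_add' := fun h h' => by
        rw [← MemLp.toLp_add]
        refine MemLp.toLp_congr _ _ ?_
        filter_upwards [ae_sqRiesz_lt_top hR] with x hx
        rw [Pi.add_apply, convMul, convMul, convMul, ← integral_add
          (hw.integrable_conv hd hsd h hx) (hw.integrable_conv hd hsd h' hx)]
        refine integral_congr_ae ?_
        filter_upwards [Lp.coeFn_add h h'] with y hy
        rw [hy, Pi.add_apply]
        ring
      map_smul' := fun c h => by
        rw [RingHom.id_apply, ← MemLp.toLp_const_smul]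
        refine MemLp.toLp_congr _ _ (.of_forall fun x => ?_)
        rw [Pi.smul_apply, convMul, convMul, smul_eq_mul, ← integral_const_mul]
        refine integral_congr_ae ?_
        filter_upwards [Lp.coeFn_smul c h] with y hy
        rw [hy, Pi.smul_apply, smul_eq_mul]
        ring }
    (ENNReal.ofReal (C * rieszConst d s) *
      (∫⁻ x, sqRiesz s g x ^ ((q : ℝ) / 2)) ^ (1 / (q : ℝ))).toReal (fun h => by
        change ‖(hw.memLp_convMul hd hsd hR h).toLp‖ ≤ _
        rw [Lp.norm_toLp, ← toReal_enorm h, ← ENNReal.toReal_mul]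
        exact ENNReal.toReal_mono (ENNReal.mul_lt_top (ENNReal.mul_lt_top ENNReal.ofReal_lt_top
          (ENNReal.rpow_lt_top_of_nonneg (by positivity) hR)) enorm_lt_top).ne
          (hw.eLpNorm_convMul_le hd hsd g h))

theorem coeFn_convMulCLM (hw : IsWeight s C w) (hd : 1 ≤ d) (hsd : s < d)
    {g : Lp ℝ η (volume : Measure (Rd d))} (hR : ∫⁻ x, sqRiesz s g x ^ ((q : ℝ) / 2) ≠ ∞)
    (h : Lp ℝ 2 (volume : Measure (Rd d))) :
    hw.convMulCLM hd hsd hR h =ᵐ[volume] convMul w g h :=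
  (hw.memLp_convMul hd hsd hR h).coeFn_toLp

/-- Bessel's inequality at fixed `x`: the summands are the squared coefficients of `y ↦ K(x - y)
g(y)` in the basis `e`. -/
theorem tsum_convMul_le (hw : IsWeight s C w) (hd : 1 ≤ d) (hsd : s < d)
    {g : Lp ℝ η (volume : Measure (Rd d))}
    (e : HilbertBasis ℕ ℝ (Lp ℝ 2 (volume : Measure (Rd d)))) (x : Rd d) :
    ∑' n, ‖convMul w g (e n) x‖ₑ ^ (2 : ℝ) ≤
      ENNReal.ofReal (C * rieszConst d s) ^ (2 : ℝ) * sqRiesz s g x := by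
  have hgm : Measurable g := (Lp.stronglyMeasurable g).measurable
  have hKm : Measurable fun y => subKernel w (x - y) * g y :=
    hw.measurable_subKernel_mul_right hgm x
  refine le_trans ?_ (hw.lintegral_sq_le hd hsd g x)
  -- If this function of `y` is not in `L²`, the right side is infinite and nothing is to be shown.
  rcases eq_or_ne (∫⁻ y, ‖subKernel w (x - y) * g y‖ₑ ^ (2 : ℝ)) ∞ with ht | ht
  · rw [ht]; exact le_top
  have hmem : MemLp (fun y => subKernel w (x - y) * g y) 2 volume := by
    refine ⟨hKm.aestronglyMeasurable, ?_⟩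
    rw [eLpNorm_eq_lintegral_rpow_enorm_toReal two_ne_zero ENNReal.ofNat_ne_top]
    exact ENNReal.rpow_lt_top_of_nonneg (by positivity) (by simpa using ht)
  set κ := hmem.toLp with hκ
  have h1 : ∀ n, convMul w g (e n) x = inner ℝ (e n) κ := by
    intro n
    rw [L2.inner_def, convMul]
    refine integral_congr_ae ?_
    filter_upwards [hmem.coeFn_toLp] with y hy
    rw [hκ, hy]
    simp only [RCLike.inner_apply, conj_trivial]
    ring
  have h2 : ‖κ‖ₑ ^ (2 : ℝ) = ∫⁻ y, ‖subKernel w (x - y) * g y‖ₑ ^ (2 : ℝ) := by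
    rw [enorm_lp_two, ← ENNReal.rpow_mul, one_div_mul_cancel two_ne_zero, ENNReal.rpow_one]
    refine lintegral_congr_ae ?_
    filter_upwards [hmem.coeFn_toLp] with y hy
    rw [hκ, hy]
  rw [← h2]
  refine ENNReal.tsum_le_of_sum_range_le fun N => ?_
  have h3 := e.orthonormal.sum_inner_products_le κ (s := Finset.range N)
  have h4 : ∀ n, ‖convMul w g (e n) x‖ₑ ^ (2 : ℝ) = ENNReal.ofReal (‖inner ℝ (e n) κ‖ ^ 2) := by
    intro n
    rw [h1, ENNReal.rpow_two, ENNReal.ofReal_pow (norm_nonneg _), ofReal_norm]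
  simp_rw [h4]
  rw [← ENNReal.ofReal_sum_of_nonneg fun n _ => by positivity, ENNReal.rpow_two, ← ofReal_norm,
    ← ENNReal.ofReal_pow (norm_nonneg _)]
  exact ENNReal.ofReal_le_ofReal h3

/-- Fubini and the evenness of the kernel. Absolute convergence comes from Cauchy–Schwarz in `y`,
which leaves `φ` against the square root of `sqRiesz s g`, a function in `L^q`. -/
theorem integral_mul_convMul (hw : IsWeight s C w) (hd : 1 ≤ d) (hsd : s < d)
    {g : Lp ℝ η (volume : Measure (Rd d))} (hR : ∫⁻ x, sqRiesz s g x ^ ((q : ℝ) / 2) ≠ ∞)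
    (h : Lp ℝ 2 (volume : Measure (Rd d))) {φ ψ : 𝓢(Rd d, ℝ)}
    (hφψ : ∀ x, ψ x = ∫ y, subKernel w (x - y) * φ y) :
    ∫ x, φ x * convMul w g h x = ∫ x, ψ x * (g x * h x) := by
  have hq1 : (1 : ℝ≥0∞) ≤ q := Fact.out
  have hφm : Measurable φ := φ.continuous.measurable
  have hgh : Measurable fun y => g y * h y := (Lp.stronglyMeasurable g).measurable.mul
    (Lp.stronglyMeasurable h).measurable
  have hFm : Measurable fun p : Rd d × Rd d =>
      φ p.1 * (subKernel w (p.1 - p.2) * (g p.2 * h p.2)) :=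
    (hφm.comp measurable_fst).mul (hw.measurable_subKernel_mul hgh)
  have hS : MemLp (fun x => (sqRiesz s g x ^ (1 / (2 : ℝ))).toReal) q volume := by
    refine ⟨((measurable_sqRiesz s g).pow_const _).ennreal_toReal.aestronglyMeasurable, ?_⟩
    have hq0' : (q : ℝ≥0∞) ≠ 0 := (zero_lt_one.trans_le hq1).ne'
    rw [eLpNorm_eq_lintegral_rpow_enorm_toReal hq0' ENNReal.coe_ne_top, ENNReal.coe_toReal]
    refine ENNReal.rpow_lt_top_of_nonneg (by positivity) (ne_top_of_le_ne_top hR ?_)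
    refine lintegral_mono fun x => ?_
    calc ‖(sqRiesz s g x ^ (1 / (2 : ℝ))).toReal‖ₑ ^ (q : ℝ)
        ≤ (sqRiesz s g x ^ (1 / (2 : ℝ))) ^ (q : ℝ) := by
          gcongr
          rw [Real.enorm_of_nonneg ENNReal.toReal_nonneg]
          exact ENNReal.ofReal_toReal_le
      _ = _ := by rw [← ENNReal.rpow_mul, one_div_mul_eq_div]
  have hconj := ENNReal.HolderConjugate.inv_one_sub_inv' hq1
  have hφS : Integrable (fun x => φ x * (sqRiesz s g x ^ (1 / (2 : ℝ))).toReal) :=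
    MemLp.integrable_mul (φ.memLp (1 - (q : ℝ≥0∞)⁻¹)⁻¹) hS
  have hFint : Integrable (Function.uncurry fun x y => φ x * (subKernel w (x - y) * (g y * h y)))
      ((volume : Measure (Rd d)).prod volume) := by
    refine ⟨hFm.aestronglyMeasurable, ?_⟩
    change ∫⁻ p : Rd d × Rd d, ‖φ p.1 * (subKernel w (p.1 - p.2) * (g p.2 * h p.2))‖ₑ
      ∂((volume : Measure (Rd d)).prod volume) < ∞
    rw [lintegral_prod _ hFm.enorm.aemeasurable]
    have hle : ∀ᵐ x, ∫⁻ y, ‖φ x * (subKernel w (x - y) * (g y * h y))‖ₑ ≤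
        ENNReal.ofReal (C * rieszConst d s) * ‖h‖ₑ *
          ‖φ x * (sqRiesz s g x ^ (1 / (2 : ℝ))).toReal‖ₑ := by
      filter_upwards [ae_sqRiesz_lt_top hR] with x hx
      simp_rw [enorm_mul (φ x)]
      have hm : Measurable fun y => ‖subKernel w (x - y) * (g y * h y)‖ₑ :=
        (hw.measurable_subKernel_mul_right hgh x).enorm
      rw [lintegral_const_mul _ hm, Real.enorm_of_nonneg ENNReal.toReal_nonneg,
        ENNReal.ofReal_toReal (ENNReal.rpow_ne_top_of_nonneg (by positivity) hx.ne)]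
      refine (mul_le_mul_right (hw.lintegral_conv_le hd hsd g h x) _).trans_eq ?_
      ring
    refine (lintegral_mono_ae hle).trans_lt ?_
    rw [lintegral_const_mul' _ _ (ENNReal.mul_ne_top ENNReal.ofReal_ne_top enorm_ne_top)]
    exact ENNReal.mul_lt_top (ENNReal.mul_lt_top ENNReal.ofReal_lt_top enorm_lt_top)
      hφS.hasFiniteIntegral
  have h1 : ∫ x, φ x * convMul w g h x =
      ∫ x, ∫ y, φ x * (subKernel w (x - y) * (g y * h y)) := by
    refine integral_congr_ae (.of_forall fun x => ?_)
    simp only [convMul]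
    rw [integral_const_mul]
  rw [h1, integral_integral_swap hFint]
  refine integral_congr_ae (.of_forall fun y => ?_)
  simp only
  rw [hφψ y, ← integral_mul_const]
  refine integral_congr_ae (.of_forall fun x => ?_)
  simp only
  rw [← neg_sub, subKernel_neg]
  ring

end IsWeight

/-! ### A complete space of representatives of homogeneous Sobolev distributions -/

theorem continuous_ofLp_apply {d : ℕ} {p : ℝ≥0∞} [hp : Fact (1 ≤ p)] (φ : 𝓢(Rd d, ℝ)) :
    Continuous fun u : Lp ℝ p (volume : Measure (Rd d)) => ofLp u φ := by
  have := ENNReal.HolderConjugate.inv_one_sub_inv' hp.out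
  have : Fact (1 ≤ (1 - p⁻¹)⁻¹) := by simp [fact_iff]
  exact ((ContinuousLinearMap.lsmul ℝ ℝ).flip.lpPairing volume p (1 - p⁻¹)⁻¹).continuous.clm_apply
    continuous_const

/-- The pairs `(u, v)` of `L^q` functions such that `u = (-Δ)^{-s/2} (1 - Δ)^m v`. -/
def repPairs (d m : ℕ) (s : ℝ) (q : ℝ≥0∞) [Fact (1 ≤ q)] :
    Submodule ℝ (Lp ℝ q (volume : Measure (Rd d)) × Lp ℝ q (volume : Measure (Rd d))) where
  carrier := {z | ∀ φ ψ : 𝓢(Rd d, ℝ), φ ∈ schwartzZero d → ψ ∈ schwartzZero d →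
    IsFracLaplace (-s) φ ψ → ofLp z.2 (besselOp d m ψ) = ofLp z.1 φ}
  zero_mem' := fun φ ψ _ _ _ => by simp
  add_mem' := fun hz hz' φ ψ hφ hψ h => by
    simp only [Prod.fst_add, Prod.snd_add, map_add, add_apply]
    rw [hz φ ψ hφ hψ h, hz' φ ψ hφ hψ h]
  smul_mem' := fun c z hz φ ψ hφ hψ h => by
    simp only [Prod.smul_fst, Prod.smul_snd, map_smul, smul_apply]
    rw [hz φ ψ hφ hψ h]

/-- Each defining relation equates two continuous functionals on `L^q × L^q`. The resulting
completeness stands in for that of the homogeneous space: Gaussian series are summed here and then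
mapped there. -/
theorem isClosed_repPairs (d m : ℕ) (s : ℝ) (q : ℝ≥0∞) [Fact (1 ≤ q)] :
    IsClosed {z | z ∈ repPairs d m s q} := by
  have : {z | z ∈ repPairs d m s q} =
      ⋂ (φ : 𝓢(Rd d, ℝ)) (ψ : 𝓢(Rd d, ℝ)) (_ : φ ∈ schwartzZero d) (_ : ψ ∈ schwartzZero d)
        (_ : IsFracLaplace (-s) φ ψ), {z | ofLp z.2 (besselOp d m ψ) = ofLp z.1 φ} := by
    ext z
    simp only [Set.mem_iInter]
    rfl
  rw [this]
  refine isClosed_iInter fun φ => isClosed_iInter fun ψ => isClosed_iInter fun _ =>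
    isClosed_iInter fun _ => isClosed_iInter fun _ => ?_
  exact isClosed_eq ((continuous_ofLp_apply _).comp continuous_snd)
    ((continuous_ofLp_apply _).comp continuous_fst)

instance (d m : ℕ) (s : ℝ) (q : ℝ≥0∞) [Fact (1 ≤ q)] : CompleteSpace (repPairs d m s q) :=
  (isClosed_repPairs d m s q).completeSpace_coe

theorem fracLaplaceEq_of_mem_repPairs {d m : ℕ} {s : ℝ} {q : ℝ≥0∞} [Fact (1 ≤ q)]
    (z : repPairs d m s q) :
    FracLaplaceEq (-s) (Submodule.Quotient.mk (ofLp z.1.2 ∘L besselOp d m)) z.1.1 := by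
  intro φ ψ hφ hψ h
  rw [pairing_mk]
  exact z.2 φ ψ hφ hψ h

theorem HomSobolev.incl_injective {d : ℕ} {σ : ℝ} {q : ℝ≥0∞} [Fact (1 ≤ q)] :
    Function.Injective (HomSobolev.incl : HomSobolev d σ q →ₗ[ℝ] TempDistModPoly d) :=
  Subtype.val_injective

/-- The distribution `(1 - Δ)^m v` in the homogeneous Sobolev space, for a pair `(u, v)`. -/
def homSobolevOfRepPair {d m : ℕ} {s : ℝ} {q : ℝ≥0∞} [Fact (1 ≤ q)] (z : repPairs d m s q) :
    HomSobolev d (-s) q :=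
  (⟨Submodule.Quotient.mk (ofLp z.1.2 ∘L besselOp d m), z.1.1,
    fracLaplaceEq_of_mem_repPairs z⟩ : homSobolevSubmodule d (-s) q)

theorem incl_homSobolevOfRepPair {d m : ℕ} {s : ℝ} {q : ℝ≥0∞} [Fact (1 ≤ q)]
    (z : repPairs d m s q) : HomSobolev.incl (homSobolevOfRepPair z) =
      Submodule.Quotient.mk (ofLp z.1.2 ∘L besselOp d m) := rfl

/-- The linear map `(u, v) ↦ (1 - Δ)^m v`. -/
def repPairsToHomSobolevₗ (d m : ℕ) (s : ℝ) (q : ℝ≥0∞) [Fact (1 ≤ q)] :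
    repPairs d m s q →ₗ[ℝ] HomSobolev d (-s) q where
  toFun := homSobolevOfRepPair
  map_add' z z' := by
    apply HomSobolev.incl_injective
    rw [map_add, incl_homSobolevOfRepPair, incl_homSobolevOfRepPair, incl_homSobolevOfRepPair,
      ← Submodule.Quotient.mk_add, Submodule.coe_add, Prod.snd_add, map_add,
      ContinuousLinearMap.add_comp]
  map_smul' c z := by
    apply HomSobolev.incl_injective
    rw [RingHom.id_apply, LinearMap.map_smul HomSobolev.incl c (homSobolevOfRepPair z),
      incl_homSobolevOfRepPair, incl_homSobolevOfRepPair, Submodule.coe_smul, Prod.smul_snd,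
      LinearMap.map_smul ofLp c z.1.2, ContinuousLinearMap.smul_comp]
    rfl

theorem norm_repPairsToHomSobolevₗ_le {d m : ℕ} {s : ℝ} {q : ℝ≥0∞} [Fact (1 ≤ q)]
    (z : repPairs d m s q) : ‖repPairsToHomSobolevₗ d m s q z‖ ≤ ‖z.1.1‖ :=
  HomSobolev.norm_le (fracLaplaceEq_of_mem_repPairs z)

/-- The continuous linear map `(u, v) ↦ (1 - Δ)^m v`. -/
def repPairsToHomSobolev (d m : ℕ) (s : ℝ) (q : ℝ≥0∞) [Fact (1 ≤ q)] :
    repPairs d m s q →L[ℝ] HomSobolev d (-s) q :=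
  (repPairsToHomSobolevₗ d m s q).mkContinuous 1 fun z => by
    rw [one_mul]
    exact (norm_repPairsToHomSobolevₗ_le z).trans (norm_fst_le z.1)

theorem incl_repPairsToHomSobolev {d m : ℕ} {s : ℝ} {q : ℝ≥0∞} [Fact (1 ≤ q)]
    (z : repPairs d m s q) : HomSobolev.incl (repPairsToHomSobolev d m s q z) =
      Submodule.Quotient.mk (ofLp z.1.2 ∘L besselOp d m) := rfl

theorem norm_repPairsToHomSobolev_le {d m : ℕ} {s : ℝ} {q : ℝ≥0∞} [Fact (1 ≤ q)]
    (z : repPairs d m s q) : ‖repPairsToHomSobolev d m s q z‖ ≤ ‖z.1.1‖ :=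
  norm_repPairsToHomSobolevₗ_le z

/-! ### Gaussian sums of operators dominated by `L^q`-valued operators -/

section Gauss

variable {Ω : Type*} [MeasurableSpace Ω] {Pr : Measure Ω}
  {γ : ℕ → Ω → ℝ}

theorem IsGaussianSeq.memLp_two (h : IsGaussianSeq Pr γ) (n : ℕ) : MemLp (γ n) 2 Pr := by
  have h2 : MemLp id 2 (gaussianReal 0 1) := memLp_id_gaussianReal (μ := 0) (v := 1) 2
  rw [← (h.1 n).map_eq] at h2
  exact (memLp_map_measure_iff aestronglyMeasurable_id (h.1 n).aemeasurable).1 h2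

theorem IsGaussianSeq.memLp_sum_smul (h : IsGaussianSeq Pr γ) {X : Type*} [NormedAddCommGroup X]
    [NormedSpace ℝ X] (x : ℕ → X) (I : Finset ℕ) :
    MemLp (fun ω => ∑ n ∈ I, γ n ω • x n) 2 Pr := by
  refine memLp_finsetSum I fun n _ => ?_
  have h1 := h.memLp_two n
  refine (h1.norm.mul_const ‖x n‖).of_le ?_ (.of_forall fun ω => ?_)
  · have hc : Continuous fun c : ℝ => c • x n := continuous_id.smul continuous_const
    exact hc.comp_aestronglyMeasurable h1.aestronglyMeasurable
  · rw [norm_smul]; simp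

theorem enorm_le_enorm_of_norm_le {X Y : Type*} [SeminormedAddCommGroup X]
    [SeminormedAddCommGroup Y] {x : X} {y : Y} (h : ‖x‖ ≤ ‖y‖) : ‖x‖ₑ ≤ ‖y‖ₑ := by
  rw [← ofReal_norm, ← ofReal_norm]
  exact ENNReal.ofReal_le_ofReal h

theorem eLpNorm_le_of_norm_le_add {X Y Z : Type*} [SeminormedAddCommGroup X]
    [SeminormedAddCommGroup Y] [SeminormedAddCommGroup Z] {f : Ω → X} {g : Ω → Y} {k : Ω → Z}
    (hg : AEStronglyMeasurable g Pr) (hk : AEStronglyMeasurable k Pr)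
    (h : ∀ ω, ‖f ω‖ ≤ ‖g ω‖ + ‖k ω‖) : eLpNorm f 2 Pr ≤ eLpNorm g 2 Pr + eLpNorm k 2 Pr := by
  have h1 : eLpNorm f 2 Pr ≤ eLpNorm ((fun ω => ‖g ω‖) + fun ω => ‖k ω‖) 2 Pr := by
    refine eLpNorm_mono_enorm fun ω => enorm_le_enorm_of_norm_le ?_
    rw [Pi.add_apply, Real.norm_of_nonneg (by positivity)]
    exact h ω
  refine h1.trans ((eLpNorm_add_le hg.norm hk.norm one_le_two).trans (add_le_add ?_ ?_)) <;>
  · refine eLpNorm_mono_enorm fun ω => enorm_le_enorm_of_norm_le ?_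
    rw [norm_norm]

/-- Abstract transfer. Both components `P₁`, `P₂` are needed for the partial sums to be Cauchy in
the complete space `Z`, but `D` sees only `P₁`; hence the final norm bound does not involve `P₂`. -/
theorem IsGaussianSeq.exists_isGaussianSum [IsProbabilityMeasure Pr] (h : IsGaussianSeq Pr γ)
    {E : Type*} [MeasurableSpace E] {μ : Measure E} [SFinite μ]
    {q : ℝ≥0} [Fact ((1 : ℝ≥0∞) ≤ q)] (hq : (2 : ℝ≥0∞) ≤ q)
    {H : Type*} [NormedAddCommGroup H] [InnerProductSpace ℝ H] (e : HilbertBasis ℕ ℝ H)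
    {Z : Type*} [NormedAddCommGroup Z] [NormedSpace ℝ Z] [CompleteSpace Z]
    {X : Type*} [SeminormedAddCommGroup X] [NormedSpace ℝ X]
    (P₁ P₂ : Z →ₗ[ℝ] Lp ℝ q μ) (hP₁ : ∀ z, ‖P₁ z‖ ≤ ‖z‖) (hP : ∀ z, ‖z‖ ≤ ‖P₁ z‖ + ‖P₂ z‖)
    (D : Z →L[ℝ] X) (hD : ∀ z, ‖D z‖ ≤ ‖P₁ z‖) (A : H →L[ℝ] Z)
    (h1 : Tendsto (tailBound q fun n => P₁ (A (e n))) atTop (𝓝 0))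
    (h2 : Tendsto (tailBound q fun n => P₂ (A (e n))) atTop (𝓝 0)) :
    IsGammaRadonifying Pr γ e (D ∘L A) ∧
      gammaNorm Pr γ e (D ∘L A) ≤ tailBound q (fun n => P₁ (A (e n))) 0 := by
  set F : ℕ → Ω → Z := fun N ω => ∑ n ∈ Finset.range N, γ n ω • A (e n) with hFdef
  have hF : ∀ N, MemLp (F N) 2 Pr := fun N => h.memLp_sum_smul (fun n => A (e n)) _
  have hfst : ∀ (P : Z →ₗ[ℝ] Lp ℝ q μ) (I : Finset ℕ) ω, P (∑ n ∈ I, γ n ω • A (e n)) =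
      ∑ n ∈ I, γ n ω • P (A (e n)) := by
    intro P I ω
    simp only [map_sum, map_smul]
  have hb : Tendsto (fun M => tailBound q (fun n => P₁ (A (e n))) M +
      tailBound q (fun n => P₂ (A (e n))) M) atTop (𝓝 0) := by simpa using h1.add h2
  obtain ⟨Y, hY, hlim⟩ := exists_tendsto_eLpNorm_of_tail hF hb (by
    intro M N hMN
    have hI : ∀ n ∈ Finset.Ico M N, M ≤ n := fun n hn => (Finset.mem_Ico.1 hn).1
    refine le_trans ?_ (add_le_add (h.eLpNorm_sum_le_tailBound hq (fun n => P₁ (A (e n))) hI)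
      (h.eLpNorm_sum_le_tailBound hq (fun n => P₂ (A (e n))) hI))
    refine eLpNorm_le_of_norm_le_add
      (h.memLp_sum_smul (fun n => P₁ (A (e n))) _).aestronglyMeasurable
      (h.memLp_sum_smul (fun n => P₂ (A (e n))) _).aestronglyMeasurable fun ω => ?_
    rw [Pi.sub_apply, hFdef]
    simp only
    rw [← Finset.sum_Ico_eq_sub _ hMN, ← hfst, ← hfst]
    exact hP _)
  have hDY : IsGaussianSum Pr γ e (D ∘L A) (fun ω => D (Y ω)) := by
    refine ⟨⟨D.continuous.comp_aestronglyMeasurable hY.aestronglyMeasurable,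
      (eLpNorm_mono_enorm fun ω => enorm_le_enorm_of_norm_le ((hD _).trans (hP₁ _))).trans_lt
        hY.eLpNorm_lt_top⟩, ?_⟩
    refine tendsto_of_tendsto_of_tendsto_of_le_of_le tendsto_const_nhds hlim
      (fun _ => zero_le) fun N => eLpNorm_mono_enorm fun ω =>
        enorm_le_enorm_of_norm_le ?_
    have : (∑ n ∈ Finset.range N, γ n ω • (D ∘L A) (e n)) - D (Y ω) = D ((F N - Y) ω) := by
      rw [Pi.sub_apply, map_sub, hFdef]
      simp only [map_sum, map_smul, ContinuousLinearMap.comp_apply]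
    rw [this]
    exact (hD _).trans (hP₁ _)
  refine ⟨⟨_, hDY⟩, (iInf₂_le _ hDY).trans ?_⟩
  -- Here `Y` is replaced by a partial sum, for which the tail bound from index `0` holds, at the
  -- price of an error that vanishes as `N → ∞`.
  have hle : ∀ N, eLpNorm (fun ω => D (Y ω)) 2 Pr ≤
      tailBound q (fun n => P₁ (A (e n))) 0 + eLpNorm (F N - Y) 2 Pr := by
    intro N
    have hs := h.memLp_sum_smul (fun n => P₁ (A (e n))) (Finset.range N)
    refine (eLpNorm_le_of_norm_le_add hs.aestronglyMeasurable
      ((hF N).sub hY).aestronglyMeasurable fun ω => ?_).trans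
      (add_le_add (h.eLpNorm_sum_le_tailBound hq _ fun n _ => Nat.zero_le n) le_rfl)
    rw [← hfst]
    refine (hD _).trans ?_
    have : P₁ (Y ω) = P₁ (F N ω) - P₁ ((F N - Y) ω) := by
      rw [Pi.sub_apply, map_sub]
      abel
    rw [this]
    exact (norm_sub_le _ _).trans (add_le_add le_rfl (hP₁ _))
  have hlim' := (tendsto_const_nhds (x := tailBound q (fun n => P₁ (A (e n))) 0)).add hlim
  rw [add_zero] at hlim'
  exact ge_of_tendsto' hlim' hle

end Gauss

/-! ### Sufficiency -/

theorem mulGammaBound_of_sharp {d : ℕ} (hd : 1 ≤ d) {s : ℝ} {η q : ℝ≥0}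
    (hη : (2 : ℝ≥0∞) ≤ η) (hq : (2 : ℝ≥0∞) ≤ q) [Fact ((1 : ℝ≥0∞) ≤ q)]
    (hsh : SharpExponents d s η q) : ∃ C : ℝ≥0,
      ∀ (Ω : Type*) [MeasurableSpace Ω] (Pr : Measure Ω) [IsProbabilityMeasure Pr]
        (γ : ℕ → Ω → ℝ) (_ : IsGaussianSeq Pr γ)
        (e : HilbertBasis ℕ ℝ (Lp ℝ 2 (volume : Measure (Rd d)))),
        MulGammaBound Pr γ e s hη q C := by
  obtain ⟨hscale, ⟨hs1, hsd⟩, hη2, hηq⟩ := hsh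
  have hd0 : (0 : ℝ) < d := by exact_mod_cast hd
  have hs0 : 0 < s := lt_trans (by positivity) hs1
  have hη2' : (2 : ℝ) < η := by exact_mod_cast hη2
  have hηq' : (η : ℝ) < q := by exact_mod_cast hηq
  have hη0 : (0 : ℝ) < η := by linarith
  have hq0 : (0 : ℝ) < q := by linarith
  -- Here `1 < p < r` is `2 < η < q`, and the relation for `a` is the scaling identity multiplied by
  -- `2 d`.
  obtain ⟨C₀, hC₀⟩ := rieszPot_bound hd (a := 2 * (s - d)) (p := (η : ℝ) / 2) (r := (q : ℝ) / 2)
    (by linarith) (by linarith) (by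
      field_simp at hscale ⊢
      linarith)
  have hw1 := isWeight_rieszWeight hs0
  -- The order `m = d` of the Bessel operator suffices because `s < d`.
  obtain ⟨C₂, hw2⟩ := exists_isWeight_besselWeight (s := s) hd (by linarith)
  set c₁ : ℝ≥0∞ := ENNReal.ofReal (1 / Real.Gamma (s / 2) * rieszConst d s) with hc₁
  have hRle : ∀ g : Lp ℝ η (volume : Measure (Rd d)),
      ∫⁻ x, sqRiesz s g x ^ ((q : ℝ) / 2) ≤ C₀ * ‖g‖ₑ ^ (q : ℝ) := by
    intro g
    have hg : ∫⁻ y, (‖g y‖ₑ ^ (2 : ℝ)) ^ ((η : ℝ) / 2) = ‖g‖ₑ ^ (η : ℝ) := by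
      have hη0' : (η : ℝ≥0∞) ≠ 0 := (zero_lt_two.trans_le hη).ne'
      rw [Lp.enorm_def, eLpNorm_eq_lintegral_rpow_enorm_toReal hη0' ENNReal.coe_ne_top,
        ENNReal.coe_toReal, ← ENNReal.rpow_mul, one_div_mul_cancel hη0.ne', ENNReal.rpow_one]
      refine lintegral_congr fun y => ?_
      rw [← ENNReal.rpow_mul, mul_div_cancel₀ _ two_ne_zero]
    have := hC₀ (fun y => ‖g y‖ₑ ^ (2 : ℝ))
      ((Lp.stronglyMeasurable g).measurable.enorm.pow_const _) (by
        rw [hg]; exact ENNReal.rpow_ne_top_of_nonneg hη0.le enorm_ne_top)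
    refine this.trans_eq ?_
    rw [hg, ← ENNReal.rpow_mul]
    congr 2
    field_simp
  have hR : ∀ g : Lp ℝ η (volume : Measure (Rd d)),
      ∫⁻ x, sqRiesz s g x ^ ((q : ℝ) / 2) ≠ ∞ := fun g =>
    ne_top_of_le_ne_top (ENNReal.mul_ne_top ENNReal.coe_ne_top
      (ENNReal.rpow_ne_top_of_nonneg hq0.le enorm_ne_top)) (hRle g)
  have hsq : ∀ {C : ℝ} {w : ℝ → ℝ} (hw : IsWeight s C w) (g : Lp ℝ η (volume : Measure (Rd d)))
      (e : HilbertBasis ℕ ℝ (Lp ℝ 2 (volume : Measure (Rd d)))),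
      ∫⁻ x, (∑' n, ‖hw.convMulCLM hd hsd (hR g) (e n) x‖ₑ ^ (2 : ℝ)) ^ ((q : ℝ) / 2) ≤
        ENNReal.ofReal (C * rieszConst d s) ^ (q : ℝ) *
          ∫⁻ x, sqRiesz s g x ^ ((q : ℝ) / 2) := by
    intro C w hw g e
    rw [← lintegral_const_mul _ ((measurable_sqRiesz s g).pow_const _)]
    refine lintegral_mono_ae ?_
    filter_upwards [ae_all_iff.2 fun n => hw.coeFn_convMulCLM hd hsd (hR g) (e n)] with x hx
    simp_rw [hx]
    refine (ENNReal.rpow_le_rpow (hw.tsum_convMul_le hd hsd e x) (by positivity)).trans_eq ?_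
    rw [ENNReal.mul_rpow_of_nonneg _ _ (by positivity), ← ENNReal.rpow_mul,
      mul_div_cancel₀ _ two_ne_zero]
  -- The constant combines the Gaussian moment, the Riesz kernel constant and the
  -- Hardy–Littlewood–Sobolev constant. It is fixed before the probability space and the basis are
  -- introduced.
  refine ⟨((gaussMoment q * (c₁ ^ (q : ℝ) * C₀)) ^ (1 / (q : ℝ))).toNNReal, ?_⟩
  intro Ω _ Pr _ γ hγ e g
  set A₁ := hw1.convMulCLM hd hsd (hR g) with hA₁
  set A₂ := hw2.convMulCLM hd hsd (hR g) with hA₂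
  have hint₁ : ∀ (h : Lp ℝ 2 (volume : Measure (Rd d))) (φ : 𝓢(Rd d, ℝ)),
      ofLp (A₁ h) φ = ∫ x, φ x * convMul (rieszWeight s) g h x := by
    intro h φ
    rw [ofLp_apply]
    refine integral_congr_ae ?_
    filter_upwards [hw1.coeFn_convMulCLM hd hsd (hR g) h] with x hx
    rw [hx]
  have hint₂ : ∀ (h : Lp ℝ 2 (volume : Measure (Rd d))) (ψ : 𝓢(Rd d, ℝ)),
      ofLp (A₂ h) (besselOp d d ψ) = ∫ x, ψ x * (g x * h x) := by
    intro h ψ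
    rw [ofLp_apply, ← hw2.integral_mul_convMul hd hsd (hR g) h (φ := besselOp d d ψ)
      (hw2.eq_conv_real hd hs0 hsd fun ξ _ => ?_)]
    · refine integral_congr_ae ?_
      filter_upwards [hw2.coeFn_convMulCLM hd hsd (hR g) h] with x hx
      rw [hx]
    · rw [subMult_besselWeight hd, fourier_besselOp, ← mul_assoc]
      have h0 : (1 + (2 * Real.pi * ‖ξ‖) ^ 2 : ℝ) ^ d ≠ 0 := by positivity
      rw [← Complex.ofReal_pow, ← Complex.ofReal_mul, inv_mul_cancel₀ h0, Complex.ofReal_one,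
        one_mul]
  -- The pair formed by the Riesz and the Bessel potential of `g h` lies in `repPairs` since both
  -- sides of the defining relation equal `∫ ψ g h`.
  set A : Lp ℝ 2 (volume : Measure (Rd d)) →L[ℝ] repPairs d d s q :=
    (A₁.prod A₂).codRestrict (repPairs d d s q) (by
      intro h φ ψ _ _ hφψ
      change ofLp (A₂ h) (besselOp d d ψ) = ofLp (A₁ h) φ
      rw [hint₂, hint₁, ← hw1.integral_mul_convMul hd hsd (hR g) h (φ := φ)
        (hw1.eq_conv_real hd hs0 hsd fun ξ hξ => ?_)]
      rw [subMult_rieszWeight hs0 hξ]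
      exact hφψ ξ) with hA
  have hfin : ∀ {C : ℝ} {w : ℝ → ℝ} (hw : IsWeight s C w),
      ∫⁻ x, (∑' n, ‖hw.convMulCLM hd hsd (hR g) (e n) x‖ₑ ^ (2 : ℝ)) ^ ((q : ℝ) / 2) ≠ ∞ :=
    fun hw => ne_top_of_le_ne_top (ENNReal.mul_ne_top
      (ENNReal.rpow_ne_top_of_nonneg hq0.le ENNReal.ofReal_ne_top) (hR g)) (hsq hw g e)
  obtain ⟨hrad, hnorm⟩ := IsGaussianSeq.exists_isGaussianSum hγ hq e
    (LinearMap.fst ℝ _ _ ∘ₗ (repPairs d d s q).subtype)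
    (LinearMap.snd ℝ _ _ ∘ₗ (repPairs d d s q).subtype) (fun z => norm_fst_le z.1)
    (fun z => max_le_add_of_nonneg (norm_nonneg _) (norm_nonneg _))
    (repPairsToHomSobolev d d s q) norm_repPairsToHomSobolev_le A
    (tendsto_tailBound hq (fun n => A₁ (e n)) (hfin hw1))
    (tendsto_tailBound hq (fun n => A₂ (e n)) (hfin hw2))
  refine ⟨_, fun h => ?_, hrad, hnorm.trans ?_⟩
  · rw [ContinuousLinearMap.comp_apply, incl_repPairsToHomSobolev]
    congr 1
    ext ψ
    rw [mulDist_apply]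
    exact hint₂ h ψ
  · change tailBound q (fun n => A₁ (e n)) 0 ≤ _
    have hfinC : (gaussMoment q * (c₁ ^ (q : ℝ) * C₀)) ^ (1 / (q : ℝ)) ≠ ∞ :=
      ENNReal.rpow_ne_top_of_nonneg (by positivity) (ENNReal.mul_ne_top (gaussMoment_ne_top hq0)
        (ENNReal.mul_ne_top (ENNReal.rpow_ne_top_of_nonneg hq0.le ENNReal.ofReal_ne_top)
          ENNReal.coe_ne_top))
    rw [ENNReal.coe_toNNReal hfinC, tailBound]
    simp only [add_zero]
    calc (gaussMoment q * ∫⁻ x, (∑' n, ‖A₁ (e n) x‖ₑ ^ (2 : ℝ)) ^ ((q : ℝ) / 2)) ^ (1 / (q : ℝ))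
        ≤ (gaussMoment q * (c₁ ^ (q : ℝ) * (C₀ * ‖g‖ₑ ^ (q : ℝ)))) ^ (1 / (q : ℝ)) := by
          refine ENNReal.rpow_le_rpow ?_ (by positivity)
          refine mul_le_mul_right ((hsq hw1 g e).trans ?_) _
          exact mul_le_mul_right (hRle g) _
      _ = _ := by
          rw [← mul_assoc (c₁ ^ (q : ℝ)), ← mul_assoc,
            ENNReal.mul_rpow_of_nonneg _ (‖g‖ₑ ^ (q : ℝ)) (by positivity), ← ENNReal.rpow_mul,
            mul_one_div_cancel hq0.ne', ENNReal.rpow_one]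

/-! ### Test pairs for the fractional Laplacian -/

/-- The product of a real Schwartz function with a coordinate. -/
def mulCoord {d : ℕ} (i : Fin d) : 𝓢(Rd d, ℝ) →L[ℝ] 𝓢(Rd d, ℝ) :=
  SchwartzMap.smulLeftCLM ℝ fun x : Rd d => x i

theorem mulCoord_apply {d : ℕ} (i : Fin d) (φ : 𝓢(Rd d, ℝ)) (x : Rd d) :
    mulCoord i φ x = x i * φ x := by
  have hi : Function.HasTemperateGrowth (fun x : Rd d => x i) :=
    (EuclideanSpace.proj i : Rd d →L[ℝ] ℝ).hasTemperateGrowth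
  rw [mulCoord, SchwartzMap.smulLeftCLM_apply_apply hi, smul_eq_mul]

open LineDeriv in
-- Multiplication by a coordinate is, up to a constant, a derivative on the Fourier side, and
-- derivatives vanish wherever the function vanishes locally.
theorem fourier_mulCoord_eventually {d : ℕ} (i : Fin d) {φ : 𝓢(Rd d, ℝ)}
    (h : ∀ᶠ ξ in 𝓝 (0 : Rd d), 𝓕 (toComplex φ) ξ = 0) :
    ∀ᶠ ξ in 𝓝 (0 : Rd d), 𝓕 (toComplex (mulCoord i φ)) ξ = 0 := by
  set m : Rd d := EuclideanSpace.single i 1 with hm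
  have hg : (inner ℝ · m : Rd d → ℝ).HasTemperateGrowth :=
    ((innerSL ℝ).flip m).hasTemperateGrowth
  have h1 : -(2 * Real.pi * Complex.I) • SchwartzMap.smulLeftCLM ℂ (inner ℝ · m) (toComplex φ) =
      (-(2 * Real.pi * Complex.I)) • toComplex (mulCoord i φ) := by
    ext x
    simp only [smul_apply, SchwartzMap.smulLeftCLM_apply_apply hg, toComplex_apply,
      mulCoord_apply]
    rw [hm]
    simp [PiLp.inner_apply]
  have h2 := SchwartzMap.lineDerivOp_fourier_eq (toComplex φ) m
  rw [h1] at h2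
  filter_upwards [h.eventually_nhds] with ξ hξ
  have h3 : ∂_{m} (𝓕 (toComplex φ)) ξ = 0 := by
    have h4 : (𝓕 (toComplex φ) : 𝓢(Rd d, ℂ)) =ᶠ[𝓝 ξ] fun _ => 0 := hξ
    rw [SchwartzMap.lineDerivOp_apply_eq_fderiv, h4.fderiv_eq]
    simp
  rw [h2, FourierTransform.fourier_smul, smul_apply, smul_eq_mul] at h3
  refine (mul_eq_zero.1 h3).resolve_left ?_
  simp [Real.pi_ne_zero]

theorem integral_eq_fourier_zero {d : ℕ} (φ : 𝓢(Rd d, ℝ)) :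
    ((∫ x, φ x : ℝ) : ℂ) = 𝓕 (toComplex φ) 0 := by
  rw [← integral_complex_ofReal]
  change _ = 𝓕 (fun x => toComplex φ x) 0
  rw [Real.fourier_eq']
  simp

/-- Moments are derivatives of the Fourier transform at the origin. In the induction on the
polynomial each coordinate factor is absorbed into `φ`, which therefore has to vary. -/
theorem mem_schwartzZero_of_fourier {d : ℕ} {φ : 𝓢(Rd d, ℝ)}
    (h : ∀ᶠ ξ in 𝓝 (0 : Rd d), 𝓕 (toComplex φ) ξ = 0) : φ ∈ schwartzZero d := by
  intro P
  induction P using MvPolynomial.induction_on generalizing φ with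
  | C a =>
    simp only [MvPolynomial.eval_C]
    rw [integral_mul_const]
    have := integral_eq_fourier_zero φ
    rw [h.self_of_nhds] at this
    rw [Complex.ofReal_eq_zero.1 this, zero_mul]
  | add P Q hP hQ =>
    have hi : ∀ R : MvPolynomial (Fin d) ℝ,
        Integrable (fun x : Rd d => φ x * MvPolynomial.eval (fun i => x i) R) := fun R =>
      (SchwartzMap.bilinLeftCLM (ContinuousLinearMap.lsmul ℝ ℝ)
        (hasTemperateGrowth_eval R) φ).integrable
    simp only [map_add, mul_add]
    rw [integral_add (hi P) (hi Q), hP h, hQ h, add_zero]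
  | mul_X P i hP =>
    rw [← hP (fourier_mulCoord_eventually i h)]
    refine integral_congr_ae (.of_forall fun x => ?_)
    simp only [map_mul, MvPolynomial.eval_X, mulCoord_apply]
    ring

/-- `ψ = (-Δ)^{-s/2} φ`, where the Fourier transform of `φ` vanishes near the origin. -/
structure IsTestPair {d : ℕ} (s : ℝ) (φ ψ : 𝓢(Rd d, ℝ)) : Prop where
  vanish : ∀ᶠ ξ in 𝓝 (0 : Rd d), 𝓕 (toComplex φ) ξ = 0
  fourier : ∀ ξ, 𝓕 (toComplex ψ) ξ =
    (((2 * Real.pi * ‖ξ‖) ^ (-s) : ℝ) : ℂ) * 𝓕 (toComplex φ) ξ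

namespace IsTestPair

variable {d : ℕ} {s : ℝ} {φ ψ φ' ψ' : 𝓢(Rd d, ℝ)}

theorem fst_mem (h : IsTestPair s φ ψ) : φ ∈ schwartzZero d := mem_schwartzZero_of_fourier h.vanish

theorem snd_mem (h : IsTestPair s φ ψ) : ψ ∈ schwartzZero d := by
  refine mem_schwartzZero_of_fourier ?_
  filter_upwards [h.vanish] with ξ hξ
  rw [h.fourier, hξ, mul_zero]

theorem isFracLaplace (h : IsTestPair s φ ψ) : IsFracLaplace (-s) φ ψ := h.fourier

theorem add (h : IsTestPair s φ ψ) (h' : IsTestPair s φ' ψ') :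
    IsTestPair s (φ + φ') (ψ + ψ') := by
  have h1 : ∀ (f g : 𝓢(Rd d, ℝ)) ξ, 𝓕 (toComplex (f + g)) ξ =
      𝓕 (toComplex f) ξ + 𝓕 (toComplex g) ξ := by
    intro f g ξ
    rw [map_add, FourierTransform.fourier_add, add_apply]
  refine ⟨?_, fun ξ => ?_⟩
  · filter_upwards [h.vanish, h'.vanish] with ξ h2 h3
    rw [h1, h2, h3, add_zero]
  · rw [h1, h1, h.fourier, h'.fourier, mul_add]

theorem smul (h : IsTestPair s φ ψ) (c : ℝ) : IsTestPair s (c • φ) (c • ψ) := by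
  have h1 : ∀ (f : 𝓢(Rd d, ℝ)) ξ, 𝓕 (toComplex (c • f)) ξ = c * 𝓕 (toComplex f) ξ := by
    intro f ξ
    have : toComplex (c • f) = (c : ℂ) • toComplex f := by
      ext x; simp
    rw [this, FourierTransform.fourier_smul, smul_apply, smul_eq_mul]
  refine ⟨?_, fun ξ => ?_⟩
  · filter_upwards [h.vanish] with ξ h2
    rw [h1, h2, mul_zero]
  · rw [h1, h1, h.fourier]
    ring

end IsTestPair

/-! ### Translations and dilations of test pairs -/

/-- The Schwartz function `x ↦ φ (c (x - b))`. -/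
def affine {d : ℕ} (b : Rd d) {c : ℝ} (hc : c ≠ 0) (φ : 𝓢(Rd d, ℝ)) : 𝓢(Rd d, ℝ) :=
  (SchwartzMap.compCLMOfContinuousLinearEquiv ℝ
    (ContinuousLinearEquiv.smulLeft (Units.mk0 c hc)) φ).compSubConstCLM ℝ b

theorem affine_apply {d : ℕ} (b : Rd d) {c : ℝ} (hc : c ≠ 0) (φ : 𝓢(Rd d, ℝ)) (x : Rd d) :
    affine b hc φ x = φ (c • (x - b)) := rfl

theorem fourier_affine {d : ℕ} (b : Rd d) {c : ℝ} (hc : c ≠ 0) (φ : 𝓢(Rd d, ℝ)) (ξ : Rd d) :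
    𝓕 (toComplex (affine b hc φ)) ξ =
      (|c| ^ d)⁻¹ * (Complex.exp ((-2 * Real.pi * inner ℝ b ξ : ℝ) * Complex.I) *
        𝓕 (toComplex φ) (c⁻¹ • ξ)) := by
  change 𝓕 (fun x => toComplex (affine b hc φ) x) ξ = _ * (_ * 𝓕 (fun x => toComplex φ x) _)
  rw [Real.fourier_eq', Real.fourier_eq']
  simp only [toComplex_apply, affine_apply, smul_eq_mul]
  rw [← integral_add_right_eq_self _ b]
  simp only [add_sub_cancel_right]
  have h1 := Measure.integral_comp_smul (volume : Measure (Rd d)) (fun v : Rd d =>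
    Complex.exp (((-2 * Real.pi * inner ℝ (c⁻¹ • v + b) ξ : ℝ) : ℂ) * Complex.I) * (φ v : ℂ)) c
  simp only [inv_smul_smul₀ hc] at h1
  rw [h1, finrank_euclideanSpace, Fintype.card_fin, abs_inv, abs_pow, Complex.real_smul]
  push_cast
  congr 1
  · rw [← integral_const_mul]
    refine integral_congr_ae (.of_forall fun v => ?_)
    simp only
    rw [← mul_assoc, ← Complex.exp_add, inner_add_left, real_inner_smul_left,
      real_inner_smul_right]
    congr 2
    push_cast
    ring

/-- The factor `|c| ^ (-s)` reflects the homogeneity of the symbol `‖ξ‖ ^ (-s)`; translations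
commute with the multiplier. -/
theorem IsTestPair.affine {d : ℕ} {s : ℝ} {φ ψ : 𝓢(Rd d, ℝ)} (h : IsTestPair s φ ψ) (b : Rd d)
    {c : ℝ} (hc : c ≠ 0) :
    IsTestPair s (HomSob.affine b hc φ) (|c| ^ (-s) • HomSob.affine b hc ψ) := by
  refine ⟨?_, fun ξ => ?_⟩
  · have h1 : Tendsto (fun ξ : Rd d => c⁻¹ • ξ) (𝓝 0) (𝓝 0) := by
      have : Continuous fun ξ : Rd d => c⁻¹ • ξ := by fun_prop
      simpa using this.tendsto 0
    filter_upwards [h1.eventually h.vanish] with ξ hξ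
    rw [fourier_affine, hξ, mul_zero, mul_zero]
  · have h2 : toComplex (|c| ^ (-s) • HomSob.affine b hc ψ) =
        ((|c| ^ (-s) : ℝ) : ℂ) • toComplex (HomSob.affine b hc ψ) := by
      ext x; simp
    have hc' : 0 < |c| := abs_pos.2 hc
    rw [h2, FourierTransform.fourier_smul, smul_apply, smul_eq_mul, fourier_affine,
      fourier_affine, h.fourier, norm_smul, norm_inv, Real.norm_eq_abs]
    have h3 : (2 * Real.pi * ‖ξ‖) ^ (-s) =
        |c| ^ (-s) * (2 * Real.pi * (|c|⁻¹ * ‖ξ‖)) ^ (-s) := by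
      rw [← Real.mul_rpow hc'.le (by positivity)]
      congr 1
      field_simp
    rw [h3]
    push_cast
    ring

/-- Every real even test function is the Fourier transform of a real Schwartz function. -/
theorem exists_fourier_eq {d : ℕ} {m : Rd d → ℝ} (hm : ContDiff ℝ (⊤ : ℕ∞) m)
    (hc : HasCompactSupport m) (heven : ∀ ξ, m (-ξ) = m ξ) :
    ∃ φ : 𝓢(Rd d, ℝ), ∀ ξ, 𝓕 (toComplex φ) ξ = m ξ := by
  have hc' : HasCompactSupport fun ξ => (m ξ : ℂ) := hc.comp_left Complex.ofReal_zero
  set M : 𝓢(Rd d, ℂ) := hc'.toSchwartzMap (Complex.ofRealCLM.contDiff.comp hm) with hM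
  have hMa : ∀ ξ, M ξ = m ξ := fun ξ => rfl
  set f : 𝓢(Rd d, ℂ) := 𝓕⁻ M with hf
  -- Conjugation flips the sign of the frequency, and `v ↦ -v` undoes this because `m` is even and
  -- real.
  have hreal : ∀ x, (starRingEnd ℂ) (f x) = f x := by
    intro x
    have h1 : f x = 𝓕⁻ (fun ξ => M ξ) x := by rw [hf, SchwartzMap.fourierInv_coe]
    rw [h1, Real.fourierInv_eq', ← integral_conj, ← integral_neg_eq_self]
    refine integral_congr_ae (.of_forall fun v => ?_)
    simp only [smul_eq_mul, map_mul, hMa, heven, Complex.conj_ofReal, ← Complex.exp_conj,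
      Complex.conj_I, inner_neg_left]
    congr 2
    push_cast
    ring
  refine ⟨SchwartzMap.postcompCLM (𝕜 := ℝ) Complex.reCLM f, fun ξ => ?_⟩
  have h2 : toComplex (SchwartzMap.postcompCLM (𝕜 := ℝ) Complex.reCLM f) = f := by
    ext x
    exact Complex.conj_eq_iff_re.1 (hreal x)
  rw [h2, hf, FourierTransform.fourier_fourierInv_eq, hMa]

/-! ### Testing the `γ`-radonifying bound -/

/-- Any representative `u` of `(-Δ)^{-s/2} F` turns the pairing of `F` with `Ψ x` into that of `u`
with `Φ x`. The norm is an infimum over representatives, so the bound is shown for every `t > ‖F‖ₑ`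
and then `t` decreases to it; uniqueness of `u` is not used. -/
theorem HomSobolev.lintegral_pairing_le {A : Type*} [MeasurableSpace A] {ν : Measure A} {d : ℕ}
    {s : ℝ} {q : ℝ≥0∞} [Fact (1 ≤ q)] {Φ Ψ : A → 𝓢(Rd d, ℝ)} (hp : ∀ x, IsTestPair s (Φ x) (Ψ x))
    {B : ℝ≥0} (hB : ∀ u : Lp ℝ q (volume : Measure (Rd d)),
      ∫⁻ x, ‖ofLp u (Φ x)‖ₑ ^ (2 : ℝ) ∂ν ≤ (B * ‖u‖ₑ) ^ (2 : ℝ)) (F : HomSobolev d (-s) q) :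
    ∫⁻ x, ‖pairing (Ψ x) (hp x).snd_mem (HomSobolev.incl F)‖ₑ ^ (2 : ℝ) ∂ν ≤
      (B * ‖F‖ₑ) ^ (2 : ℝ) := by
  have hcont : Continuous fun t : ℝ≥0∞ => ((B : ℝ≥0∞) * t) ^ (2 : ℝ) :=
    ENNReal.continuous_rpow_const.comp (ENNReal.continuous_const_mul ENNReal.coe_ne_top)
  have : (𝓝[>] ‖F‖ₑ).NeBot := nhdsGT_neBot_of_exists_gt ⟨∞, enorm_lt_top⟩
  refine ge_of_tendsto ((hcont.tendsto ‖F‖ₑ).mono_left (nhdsWithin_le_nhds (s := Set.Ioi ‖F‖ₑ))) ?_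
  filter_upwards [self_mem_nhdsWithin] with t ht
  have hex : ∃ u : HomSobolev.Rep F, ‖u.1‖ₑ ≤ t := by
    rcases eq_or_ne t ∞ with rfl | htop
    · exact ⟨Classical.arbitrary _, le_top⟩
    · have h1 : ‖F‖ < t.toReal := by
        rw [← toReal_enorm F]
        exact (ENNReal.toReal_lt_toReal enorm_ne_top htop).2 ht
      rw [HomSobolev.norm_def] at h1
      obtain ⟨u, hu⟩ := exists_lt_of_ciInf_lt h1
      refine ⟨u, ?_⟩
      rw [← ofReal_norm]
      exact ENNReal.ofReal_le_of_le_toReal hu.le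
  obtain ⟨u, hu⟩ := hex
  calc ∫⁻ x, ‖pairing (Ψ x) (hp x).snd_mem (HomSobolev.incl F)‖ₑ ^ (2 : ℝ) ∂ν
      = ∫⁻ x, ‖ofLp u.1 (Φ x)‖ₑ ^ (2 : ℝ) ∂ν := by
        refine lintegral_congr fun x => ?_
        rw [u.2 (Φ x) (Ψ x) (hp x).fst_mem (hp x).snd_mem (hp x).isFracLaplace]
    _ ≤ (B * ‖u.1‖ₑ) ^ (2 : ℝ) := hB u.1
    _ ≤ _ := ENNReal.rpow_le_rpow (mul_le_mul_right hu _) zero_le_two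

/-- Parseval's identity for the restriction of `ψ` to `E`. -/
theorem tsum_enorm_integral_indicator {d : ℕ}
    (e : HilbertBasis ℕ ℝ (Lp ℝ 2 (volume : Measure (Rd d)))) {E : Set (Rd d)}
    (hE : MeasurableSet E) (ψ : 𝓢(Rd d, ℝ)) :
    ∑' n, ‖∫ y, ψ y * (E.indicator (fun _ => (1 : ℝ)) y * e n y)‖ₑ ^ (2 : ℝ) =
      ∫⁻ y in E, ‖ψ y‖ₑ ^ (2 : ℝ) := by
  have hmem : MemLp (E.indicator ψ) 2 volume := (ψ.memLp 2).indicator hE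
  set κ := hmem.toLp with hκ
  have h1 : ∀ n, ∫ y, ψ y * (E.indicator (fun _ => (1 : ℝ)) y * e n y) = inner ℝ (e n) κ := by
    intro n
    rw [L2.inner_def]
    refine integral_congr_ae ?_
    filter_upwards [hmem.coeFn_toLp] with y hy
    rw [hκ, hy]
    simp only [RCLike.inner_apply, conj_trivial]
    by_cases hyE : y ∈ E <;> simp [hyE]
  have h2 : ‖κ‖ₑ ^ (2 : ℝ) = ∫⁻ y in E, ‖ψ y‖ₑ ^ (2 : ℝ) := by
    rw [enorm_lp_two, ← ENNReal.rpow_mul, one_div_mul_cancel two_ne_zero, ENNReal.rpow_one,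
      ← lintegral_indicator hE]
    refine lintegral_congr_ae ?_
    filter_upwards [hmem.coeFn_toLp] with y hy
    rw [hκ, hy]
    by_cases hyE : y ∈ E <;> simp [hyE]
  have h3 := e.hasSum_inner_mul_inner κ κ
  have h4 : ∀ n, ‖inner ℝ (e n) κ‖ₑ ^ (2 : ℝ) =
      ENNReal.ofReal (inner ℝ κ (e n) * inner ℝ (e n) κ) := by
    intro n
    rw [real_inner_comm, ← sq, ENNReal.rpow_two, ← sq_abs, ← Real.norm_eq_abs,
      ENNReal.ofReal_pow (norm_nonneg _), ofReal_norm]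
  have h5 : ∀ n, 0 ≤ inner ℝ κ (e n) * inner ℝ (e n) κ := fun n => by
    rw [real_inner_comm]; exact mul_self_nonneg _
  simp_rw [h1, h4]
  rw [← ENNReal.ofReal_tsum_of_nonneg h5 h3.summable, h3.tsum_eq, ← h2, real_inner_self_eq_norm_sq,
    ENNReal.ofReal_pow (norm_nonneg _), ofReal_norm, ENNReal.rpow_two]

/-- The source of all necessary conditions. Pairing the Gaussian series of `M_g`, `g = 1_E`, with `Ψ
x` gives a scalar Gaussian series whose variance is `∫_E |Ψ x|²`. The hypothesis on `Φ` controls the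
`ν`-average of the squared pairings by the `L^q` norm, hence by the `γ`-norm. -/
theorem MulGammaBound.testing {Ω : Type*} [MeasurableSpace Ω] {Pr : Measure Ω}
    [IsProbabilityMeasure Pr] {γ : ℕ → Ω → ℝ} (hγ : IsGaussianSeq Pr γ) {d : ℕ}
    {e : HilbertBasis ℕ ℝ (Lp ℝ 2 (volume : Measure (Rd d)))} {s : ℝ} {η q : ℝ≥0}
    {hη : (2 : ℝ≥0∞) ≤ η} [Fact ((1 : ℝ≥0∞) ≤ q)] {C : ℝ≥0} (hC : MulGammaBound Pr γ e s hη q C)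
    {A : Type*} [MeasurableSpace A] {ν : Measure A} [SFinite ν] {Φ Ψ : A → 𝓢(Rd d, ℝ)}
    (hp : ∀ x, IsTestPair s (Φ x) (Ψ x)) (hm : Measurable fun p : A × Rd d => Ψ p.1 p.2)
    {B : ℝ≥0} (hB : ∀ u : Lp ℝ q (volume : Measure (Rd d)),
      ∫⁻ x, ‖ofLp u (Φ x)‖ₑ ^ (2 : ℝ) ∂ν ≤ (B * ‖u‖ₑ) ^ (2 : ℝ))
    {E : Set (Rd d)} (hE : MeasurableSet E) (hEfin : volume E ≠ ∞) :
    ∫⁻ x, (∫⁻ y in E, ‖Ψ x y‖ₑ ^ (2 : ℝ)) ∂ν ≤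
      (B * (C * volume E ^ (1 / (η : ℝ)))) ^ (2 : ℝ) := by
  set g : Lp ℝ η (volume : Measure (Rd d)) := indicatorConstLp η hE hEfin (1 : ℝ) with hg
  obtain ⟨T, hT, -, hTC⟩ := hC g
  have hη0 : (η : ℝ≥0∞) ≠ 0 := (zero_lt_two.trans_le hη).ne'
  have hgn : ‖g‖ₑ = volume E ^ (1 / (η : ℝ)) := by
    rw [hg, Lp.enorm_def, eLpNorm_congr_ae indicatorConstLp_coeFn,
      eLpNorm_indicator_const hE hη0 ENNReal.coe_ne_top]
    simp
  set a : ℕ → A → ℝ := fun n x => pairing (Ψ x) (hp x).snd_mem (HomSobolev.incl (T (e n))) with ha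
  have ha' : ∀ n x, a n x = ∫ y, Ψ x y * (E.indicator (fun _ => (1 : ℝ)) y * e n y) := by
    intro n x
    rw [ha]
    simp only
    rw [hT, pairing_mk, mulDist_apply]
    refine integral_congr_ae ?_
    filter_upwards [indicatorConstLp_coeFn (p := η) (hs := hE) (hμs := hEfin) (c := (1 : ℝ))]
      with y hy
    rw [hg, hy]
  have ham : ∀ n, Measurable (a n) := by
    intro n
    have h1 : Measurable fun p : A × Rd d =>
        Ψ p.1 p.2 * (E.indicator (fun _ => (1 : ℝ)) p.2 * e n p.2) :=
      hm.mul (((measurable_const.indicator hE).mul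
        (Lp.stronglyMeasurable (e n)).measurable).comp measurable_snd)
    have h2 : a n = fun x => ∫ y, Ψ x y * (E.indicator (fun _ => (1 : ℝ)) y * e n y) :=
      funext (ha' n)
    rw [h2]
    exact h1.stronglyMeasurable.integral_prod_right.measurable
  set S : ℕ → Ω → HomSobolev d (-s) q := fun N ω => ∑ n ∈ Finset.range N, γ n ω • T (e n) with hS
  have hpart : ∀ N, ∑ n ∈ Finset.range N, ∫⁻ x, ‖a n x‖ₑ ^ (2 : ℝ) ∂ν ≤
      (B * eLpNorm (S N) 2 Pr) ^ (2 : ℝ) := by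
    intro N
    rw [← lintegral_finsetSum _ fun n _ => (ham n).enorm.pow_const _]
    -- Variance of a Gaussian sum, read backwards so that the sum of squares becomes an expectation
    -- of pairings with `S N`.
    have h1 : ∀ x, ∑ n ∈ Finset.range N, ‖a n x‖ₑ ^ (2 : ℝ) =
        ∫⁻ ω, ‖∑ n ∈ Finset.range N, γ n ω * a n x‖ₑ ^ (2 : ℝ) ∂Pr := by
      intro x
      rw [hγ.lintegral_rpow_sum (fun n => a n x) _ zero_lt_two, gaussMoment_two, one_mul,
        div_self two_ne_zero, ENNReal.rpow_one]
    simp_rw [h1]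
    rw [lintegral_lintegral_swap]
    · have h2 : ∀ ω, ∫⁻ x, ‖∑ n ∈ Finset.range N, γ n ω * a n x‖ₑ ^ (2 : ℝ) ∂ν ≤
          (B * ‖S N ω‖ₑ) ^ (2 : ℝ) := by
        intro ω
        refine le_trans (le_of_eq (lintegral_congr fun x => ?_))
          (HomSobolev.lintegral_pairing_le hp hB (S N ω))
        rw [hS]
        simp only [map_sum, map_smul, smul_eq_mul, ha]
      refine (lintegral_mono h2).trans_eq ?_
      rw [eLpNorm_eq_lintegral_rpow_enorm_toReal two_ne_zero ENNReal.ofNat_ne_top]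
      simp_rw [ENNReal.mul_rpow_of_nonneg _ _ zero_le_two]
      rw [lintegral_const_mul' _ _ (ENNReal.rpow_ne_top_of_nonneg zero_le_two ENNReal.coe_ne_top), ENNReal.toReal_ofNat, ← ENNReal.rpow_mul,
        one_div_mul_cancel two_ne_zero, ENNReal.rpow_one]
    · refine AEMeasurable.pow_const (AEMeasurable.enorm ?_) _
      refine Finset.aemeasurable_fun_sum _ fun n _ => ?_
      exact ((hγ.1 n).aemeasurable.comp_quasiMeasurePreserving
        Measure.quasiMeasurePreserving_snd).mul ((ham n).comp measurable_fst).aemeasurable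
  have hY : ∀ Y, IsGaussianSum Pr γ e T Y →
      ∑' n, ∫⁻ x, ‖a n x‖ₑ ^ (2 : ℝ) ∂ν ≤ (B * eLpNorm Y 2 Pr) ^ (2 : ℝ) := by
    intro Y hY
    have hcont : Continuous fun t : ℝ≥0∞ => ((B : ℝ≥0∞) * t) ^ (2 : ℝ) :=
      ENNReal.continuous_rpow_const.comp (ENNReal.continuous_const_mul ENNReal.coe_ne_top)
    have hlim := (tendsto_const_nhds (x := eLpNorm Y 2 Pr)).add hY.2
    rw [add_zero] at hlim
    refine le_of_tendsto_of_tendsto' (ENNReal.tendsto_nat_tsum _) ((hcont.tendsto _).comp hlim)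
      fun N => (hpart N).trans ?_
    refine ENNReal.rpow_le_rpow (mul_le_mul_right ?_ _) zero_le_two
    have hSm : AEStronglyMeasurable (S N) Pr :=
      Finset.aestronglyMeasurable_fun_sum _ fun n _ =>
        (hγ.1 n).aemeasurable.aestronglyMeasurable.smul_const _
    refine eLpNorm_le_of_norm_le_add hY.1.1 (hSm.sub hY.1.1) fun ω => ?_
    have : S N ω = Y ω + (S N ω - Y ω) := by abel
    calc ‖S N ω‖ = ‖Y ω + (S N ω - Y ω)‖ := by rw [← this]
      _ ≤ _ := norm_add_le _ _
  have hmain : ∫⁻ x, (∫⁻ y in E, ‖Ψ x y‖ₑ ^ (2 : ℝ)) ∂ν = ∑' n, ∫⁻ x, ‖a n x‖ₑ ^ (2 : ℝ) ∂ν := by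
    rw [← lintegral_tsum fun n => ((ham n).enorm.pow_const _).aemeasurable]
    refine lintegral_congr fun x => ?_
    rw [← tsum_enorm_integral_indicator e hE]
    simp_rw [ha']
  rw [hmain]
  have hcont : Continuous fun t : ℝ≥0∞ => ((B : ℝ≥0∞) * t) ^ (2 : ℝ) :=
    ENNReal.continuous_rpow_const.comp (ENNReal.continuous_const_mul ENNReal.coe_ne_top)
  rw [hgn] at hTC
  set c : ℝ≥0∞ := C * volume E ^ (1 / (η : ℝ)) with hc
  have hcfin : c < ∞ := ENNReal.mul_lt_top ENNReal.coe_lt_top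
    (ENNReal.rpow_lt_top_of_nonneg (by positivity) hEfin)
  have : (𝓝[>] c).NeBot := nhdsGT_neBot_of_exists_gt ⟨∞, hcfin⟩
  -- As `gammaNorm` is an infimum over possible sums, it is approached from above.
  refine ge_of_tendsto ((hcont.tendsto c).mono_left (nhdsWithin_le_nhds (s := Set.Ioi c))) ?_
  filter_upwards [self_mem_nhdsWithin] with t ht
  have hlt : gammaNorm Pr γ e T < t := hTC.trans_lt ht
  simp only [gammaNorm, iInf_lt_iff] at hlt
  obtain ⟨Y, hYs, hYt⟩ := hlt
  exact (hY Y hYs).trans (ENNReal.rpow_le_rpow (mul_le_mul_right hYt.le _) zero_le_two)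

/-! ### Existence of test pairs -/

/-- The symbol is singular only at the origin, where `b` vanishes identically; hence test pairs
exist for every `s`. -/
theorem contDiff_symbol {d : ℕ} (s : ℝ) {b : Rd d → ℝ} (hb : ContDiff ℝ (⊤ : ℕ∞) b)
    (h0 : ∀ᶠ ξ in 𝓝 0, b ξ = 0) :
    ContDiff ℝ (⊤ : ℕ∞) fun ξ => (2 * Real.pi * ‖ξ‖) ^ (-s) * b ξ := by
  rw [contDiff_iff_contDiffAt]
  intro ξ
  rcases eq_or_ne ξ 0 with rfl | hξ
  · refine (contDiffAt_const (c := (0 : ℝ))).congr_of_eventuallyEq ?_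
    filter_upwards [h0] with ξ hξ
    rw [hξ, mul_zero]
  · have hpos : 2 * Real.pi * ‖ξ‖ ≠ 0 := by
      have := norm_pos_iff.2 hξ
      positivity
    exact ((contDiffAt_const.mul (contDiffAt_norm ℝ hξ)).rpow_const_of_ne hpos).mul hb.contDiffAt

theorem exists_isTestPair {d : ℕ} (s : ℝ) {φ : 𝓢(Rd d, ℝ)} {b : Rd d → ℝ}
    (hφ : ∀ ξ, 𝓕 (toComplex φ) ξ = b ξ) (hb : ContDiff ℝ (⊤ : ℕ∞) b) (hc : HasCompactSupport b)
    (heven : ∀ ξ, b (-ξ) = b ξ) (h0 : ∀ᶠ ξ in 𝓝 0, b ξ = 0) :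
    ∃ ψ : 𝓢(Rd d, ℝ), IsTestPair s φ ψ := by
  obtain ⟨ψ, hψ⟩ := exists_fourier_eq (contDiff_symbol s hb h0) hc.mul_left
    (fun ξ => by rw [norm_neg, heven])
  refine ⟨ψ, ?_, fun ξ => ?_⟩
  · filter_upwards [h0] with ξ hξ
    rw [hφ, hξ, Complex.ofReal_zero]
  · rw [hψ, hφ, Complex.ofReal_mul]

/-! ### Dyadic annular symbols and a nonzero test pair -/

/-- A smooth even cutoff function. -/
def cutoff (d : ℕ) : ContDiffBump (0 : Rd d) := ⟨1, 2, zero_lt_one, one_lt_two⟩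

theorem cutoff_eq_one {d : ℕ} {ξ : Rd d} (h : ‖ξ‖ ≤ 1) : cutoff d ξ = 1 :=
  (cutoff d).one_of_mem_closedBall (by simpa [cutoff] using h)

theorem cutoff_eq_zero {d : ℕ} {ξ : Rd d} (h : 2 ≤ ‖ξ‖) : cutoff d ξ = 0 :=
  (cutoff d).zero_of_le_dist (by simpa [cutoff] using h)

/-- The symbol `θ(2⁻ᴺ ξ) - θ(ξ)`, where `θ` is the cutoff function. -/
def annulus (d N : ℕ) (ξ : Rd d) : ℝ := cutoff d (((2 : ℝ) ^ N)⁻¹ • ξ) - cutoff d ξ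

theorem contDiff_annulus (d N : ℕ) : ContDiff ℝ (⊤ : ℕ∞) (annulus d N) :=
  ((cutoff d).contDiff.comp (contDiff_const_smul _)).sub (cutoff d).contDiff

theorem annulus_neg {d N : ℕ} (ξ : Rd d) : annulus d N (-ξ) = annulus d N ξ := by
  rw [annulus, annulus, smul_neg, (cutoff d).neg, (cutoff d).neg]

theorem hasCompactSupport_annulus (d N : ℕ) : HasCompactSupport (annulus d N) := by
  refine HasCompactSupport.intro (isCompact_closedBall (0 : Rd d) (2 ^ N * 2)) fun ξ hξ => ?_
  rw [mem_closedBall_zero_iff, not_le] at hξ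
  have h1 : (1 : ℝ) ≤ 2 ^ N := one_le_pow₀ one_le_two
  rw [annulus, cutoff_eq_zero, cutoff_eq_zero, sub_zero]
  · nlinarith
  · rw [norm_smul, norm_inv, norm_pow, Real.norm_ofNat, inv_mul_eq_div, le_div_iff₀ (by positivity)]
    linarith

theorem annulus_eventually_eq_zero (d N : ℕ) : ∀ᶠ ξ in 𝓝 (0 : Rd d), annulus d N ξ = 0 := by
  filter_upwards [Metric.closedBall_mem_nhds (0 : Rd d) one_pos] with ξ hξ
  rw [mem_closedBall_zero_iff] at hξ
  have h1 : (1 : ℝ) ≤ 2 ^ N := one_le_pow₀ one_le_two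
  rw [annulus, cutoff_eq_one hξ, cutoff_eq_one, sub_self]
  rw [norm_smul, norm_inv, norm_pow, Real.norm_ofNat, inv_mul_eq_div]
  exact (div_le_self (norm_nonneg _) h1).trans hξ

theorem annulus_one_nonneg {d : ℕ} (ξ : Rd d) : 0 ≤ annulus d 1 ξ := by
  rw [annulus, sub_nonneg]
  rcases le_total 2 ‖ξ‖ with h | h
  · rw [cutoff_eq_zero h]
    exact (cutoff d).nonneg
  · rw [cutoff_eq_one (ξ := ((2 : ℝ) ^ 1)⁻¹ • ξ)]
    · exact (cutoff d).le_one
    · rw [norm_smul]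
      norm_num
      linarith

theorem annulus_one_eq_one {d : ℕ} {ξ : Rd d} (h : ‖ξ‖ = 2) : annulus d 1 ξ = 1 := by
  rw [annulus, cutoff_eq_zero h.ge, cutoff_eq_one, sub_zero]
  rw [norm_smul, h]
  norm_num

theorem annulus_eq_sum {d : ℕ} (N : ℕ) (ξ : Rd d) :
    annulus d N ξ = ∑ j ∈ Finset.range N, annulus d 1 (((2 : ℝ) ^ j)⁻¹ • ξ) := by
  have h : ∀ j, annulus d 1 (((2 : ℝ) ^ j)⁻¹ • ξ) =
      cutoff d (((2 : ℝ) ^ (j + 1))⁻¹ • ξ) - cutoff d (((2 : ℝ) ^ j)⁻¹ • ξ) := by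
    intro j
    rw [annulus, smul_smul, ← mul_inv, ← pow_add, add_comm 1 j]
  simp_rw [h]
  rw [Finset.sum_range_sub fun j => cutoff d (((2 : ℝ) ^ j)⁻¹ • ξ)]
  simp [annulus]

theorem exists_norm_eq_two {d : ℕ} (hd : 1 ≤ d) : ∃ ξ : Rd d, ‖ξ‖ = 2 :=
  ⟨EuclideanSpace.single ⟨0, hd⟩ 2, by simp⟩

/-- The annular symbol equals `1` on the sphere of radius `2`, so the Fourier transform of `ψ` does
not vanish there. -/
theorem exists_isTestPair_ne_zero {d : ℕ} (hd : 1 ≤ d) (s : ℝ) :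
    ∃ φ ψ : 𝓢(Rd d, ℝ), IsTestPair s φ ψ ∧ ∃ x, ψ x ≠ 0 := by
  obtain ⟨φ, hφ⟩ := exists_fourier_eq (contDiff_annulus d 1) (hasCompactSupport_annulus d 1)
    annulus_neg
  obtain ⟨ψ, hψ⟩ := exists_isTestPair s hφ (contDiff_annulus d 1) (hasCompactSupport_annulus d 1)
    annulus_neg (annulus_eventually_eq_zero d 1)
  refine ⟨φ, ψ, hψ, ?_⟩
  by_contra! h
  obtain ⟨ξ, hξ⟩ := exists_norm_eq_two hd
  have h1 : toComplex ψ = 0 := by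
    ext x
    rw [toComplex_apply, h x]
    rfl
  have h2 := hψ.fourier ξ
  rw [h1, hφ, annulus_one_eq_one hξ, hξ, Complex.ofReal_one, mul_one, FourierTransform.fourier_zero,
    zero_apply] at h2
  have h3 : (2 * Real.pi * 2) ^ (-s) ≠ 0 := by positivity
  exact h3 (Complex.ofReal_eq_zero.1 h2.symm)

/-! ### Scaling of integrals -/

theorem lintegral_rpow_enorm_ne_top {d : ℕ} (φ : 𝓢(Rd d, ℝ)) {p : ℝ} (hp : 0 < p) :
    ∫⁻ x, ‖φ x‖ₑ ^ p ≠ ∞ := by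
  have h := (φ.memLp p.toNNReal volume).eLpNorm_lt_top
  have h2 : ((p.toNNReal : ℝ≥0∞)).toReal = p := by simp [hp.le]
  have h3 := lintegral_rpow_enorm_lt_top_of_eLpNorm_lt_top (by simpa using hp)
    ENNReal.coe_ne_top h
  rw [h2] at h3
  exact h3.ne

theorem setLIntegral_ball_comp_smul {d : ℕ} (f : Rd d → ℝ≥0∞) {c : ℝ} (hc : 0 < c) (r : ℝ) :
    ∫⁻ y in Metric.ball 0 (r / c), f (c • y) =
      ENNReal.ofReal ((c ^ d)⁻¹) * ∫⁻ y in Metric.ball 0 r, f y := by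
  rw [← lintegral_indicator measurableSet_ball, ← lintegral_indicator measurableSet_ball]
  have h := lintegral_comp_const_smul ((Metric.ball (0 : Rd d) r).indicator f) hc.ne'
  rw [abs_of_pos hc] at h
  rw [← h]
  refine lintegral_congr fun y => ?_
  have : y ∈ Metric.ball (0 : Rd d) (r / c) ↔ c • y ∈ Metric.ball (0 : Rd d) r := by
    rw [mem_ball_zero_iff, mem_ball_zero_iff, norm_smul, Real.norm_of_nonneg hc.le,
      lt_div_iff₀ hc, mul_comm]
  by_cases hy : c • y ∈ Metric.ball (0 : Rd d) r
  · rw [Set.indicator_of_mem hy, Set.indicator_of_mem (this.2 hy)]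
  · rw [Set.indicator_of_notMem hy, Set.indicator_of_notMem fun h => hy (this.1 h)]

theorem volume_ball_div {d : ℕ} {c : ℝ} (hc : 0 < c) (r : ℝ) :
    volume (Metric.ball (0 : Rd d) (r / c)) =
      ENNReal.ofReal ((c ^ d)⁻¹) * volume (Metric.ball (0 : Rd d) r) := by
  simpa using setLIntegral_ball_comp_smul (fun _ : Rd d => 1) hc r

/-- A positive exponent is refuted by `c → ∞`, a negative one by `c → 0`. This is how scaling fixes
an exponent. -/
theorem eq_zero_of_rpow_mul_le {e : ℝ} {J K : ℝ≥0∞} (hJ : J ≠ 0) (hK : K ≠ ∞)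
    (h : ∀ c : ℝ, 0 < c → ENNReal.ofReal (c ^ e) * J ≤ K) : e = 0 := by
  have key : ∀ e : ℝ, 0 < e → ¬ ∀ c : ℝ, 0 < c → ENNReal.ofReal (c ^ e) * J ≤ K := by
    intro e he h
    have h1 : Tendsto (fun c : ℝ => ENNReal.ofReal (c ^ e) * J) atTop (𝓝 (∞ * J)) :=
      ENNReal.Tendsto.mul_const (ENNReal.tendsto_ofReal_atTop.comp (tendsto_rpow_atTop he))
        (Or.inl ENNReal.top_ne_zero)
    rw [ENNReal.top_mul hJ] at h1
    refine hK (top_le_iff.1 (le_of_tendsto h1 ?_))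
    filter_upwards [eventually_gt_atTop 0] with c hc using h c hc
  rcases lt_trichotomy e 0 with he | he | he
  · refine absurd (fun c hc => ?_) (key (-e) (neg_pos.2 he))
    have := h c⁻¹ (inv_pos.2 hc)
    rwa [Real.inv_rpow hc.le, ← Real.rpow_neg hc.le] at this
  · exact he
  · exact absurd h (key e he)

theorem setLIntegral_ball_ne_zero {d : ℕ} {ψ : 𝓢(Rd d, ℝ)} {x : Rd d} (hx : ψ x ≠ 0) :
    ∫⁻ y in Metric.ball 0 (‖x‖ + 1), ‖ψ y‖ₑ ^ (2 : ℝ) ≠ 0 := by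
  intro h
  have hm : Measurable fun y => ‖ψ y‖ₑ ^ (2 : ℝ) := ψ.continuous.measurable.enorm.pow_const _
  rw [setLIntegral_eq_zero_iff measurableSet_ball hm] at h
  have hU : IsOpen (Metric.ball (0 : Rd d) (‖x‖ + 1) ∩ {y | ψ y ≠ 0}) :=
    Metric.isOpen_ball.inter (isOpen_ne_fun ψ.continuous continuous_const)
  have hpos := hU.measure_pos (volume : Measure (Rd d))
    ⟨x, by rw [mem_ball_zero_iff]; linarith, hx⟩
  refine hpos.ne' (measure_mono_null (fun y hy => ?_) (ae_iff.1 h))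
  simp only [Set.mem_ofPred_eq, Classical.not_imp]
  refine ⟨hy.1, fun h0 => hy.2 ?_⟩
  rwa [ENNReal.rpow_eq_zero_iff_of_pos zero_lt_two, enorm_eq_zero] at h0

theorem lintegral_sq_fourier {d : ℕ} (f : 𝓢(Rd d, ℂ)) :
    ∫⁻ ξ, ‖𝓕 f ξ‖ₑ ^ (2 : ℝ) = ∫⁻ x, ‖f x‖ₑ ^ (2 : ℝ) := by
  have h1 : ∀ g : 𝓢(Rd d, ℂ), ∫⁻ x, ‖g x‖ₑ ^ (2 : ℝ) = ENNReal.ofReal (∫ x, ‖g x‖ ^ 2) := by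
    intro g
    rw [ofReal_integral_eq_lintegral_ofReal
      ((memLp_two_iff_integrable_sq_norm (g.memLp 2 volume).1).1 (g.memLp 2 volume))
      (.of_forall fun x => by positivity)]
    refine lintegral_congr fun x => ?_
    rw [ENNReal.rpow_two, ENNReal.ofReal_pow (norm_nonneg _), ofReal_norm]
  rw [h1 f, ← SchwartzMap.integral_norm_sq_fourier]
  exact h1 (𝓕 f)

/-! ### Necessity: a single test pair -/

theorem enorm_ofLp_le {d : ℕ} {q : ℝ≥0} [Fact ((1 : ℝ≥0∞) ≤ q)] {p : ℝ}
    (hpq : p.HolderConjugate q) (u : Lp ℝ q (volume : Measure (Rd d))) (φ : 𝓢(Rd d, ℝ)) :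
    ‖ofLp u φ‖ₑ ≤ (∫⁻ x, ‖φ x‖ₑ ^ p) ^ (1 / p) * ‖u‖ₑ := by
  have hq0 : (q : ℝ≥0∞) ≠ 0 := (zero_lt_one.trans_le (Fact.out : (1 : ℝ≥0∞) ≤ q)).ne'
  rw [ofLp_apply, Lp.enorm_def, eLpNorm_eq_lintegral_rpow_enorm_toReal hq0 ENNReal.coe_ne_top,
    ENNReal.coe_toReal]
  refine (enorm_integral_le_lintegral_enorm _).trans ?_
  simp_rw [enorm_mul]
  exact ENNReal.lintegral_mul_le_Lp_mul_Lq volume hpq φ.continuous.measurable.enorm.aemeasurable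
    (Lp.stronglyMeasurable u).measurable.enorm.aemeasurable

section Necessity

variable {Ω : Type*} [MeasurableSpace Ω] {Pr : Measure Ω}
  [IsProbabilityMeasure Pr] {γ : ℕ → Ω → ℝ} {d : ℕ}
  {e : HilbertBasis ℕ ℝ (Lp ℝ 2 (volume : Measure (Rd d)))} {s : ℝ} {η q : ℝ≥0}
  {hη : (2 : ℝ≥0∞) ≤ η} [Fact ((1 : ℝ≥0∞) ≤ q)] {C : ℝ≥0}

/-- The testing inequality for a Dirac mass, with Hölder's inequality supplying `B = ‖φ‖_{q'}`. -/
theorem MulGammaBound.setLIntegral_le (hC : MulGammaBound Pr γ e s hη q C)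
    (hγ : IsGaussianSeq Pr γ) {p : ℝ} (hpq : p.HolderConjugate q) {φ ψ : 𝓢(Rd d, ℝ)}
    (hp : IsTestPair s φ ψ) {E : Set (Rd d)} (hE : MeasurableSet E) (hEfin : volume E ≠ ∞) :
    ∫⁻ y in E, ‖ψ y‖ₑ ^ (2 : ℝ) ≤
      ((∫⁻ x, ‖φ x‖ₑ ^ p) ^ (1 / p) * (C * volume E ^ (1 / (η : ℝ)))) ^ (2 : ℝ) := by
  have hfin : (∫⁻ x, ‖φ x‖ₑ ^ p) ^ (1 / p) ≠ ∞ :=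
    ENNReal.rpow_ne_top_of_nonneg (one_div_nonneg.2 hpq.nonneg)
      (lintegral_rpow_enorm_ne_top φ hpq.pos)
  have h := hC.testing hγ (A := Unit) (ν := Measure.dirac ()) (Φ := fun _ => φ) (Ψ := fun _ => ψ)
    (fun _ => hp) (ψ.continuous.measurable.comp measurable_snd)
    (B := ((∫⁻ x, ‖φ x‖ₑ ^ p) ^ (1 / p)).toNNReal) (fun u => by
      rw [lintegral_dirac, ENNReal.coe_toNNReal hfin]
      exact ENNReal.rpow_le_rpow (enorm_ofLp_le hpq u φ) zero_le_two) hE hEfin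
  rwa [lintegral_dirac, ENNReal.coe_toNNReal hfin] at h

theorem lintegral_affine {φ : 𝓢(Rd d, ℝ)} {c : ℝ} (hc : 0 < c) (a p : ℝ) (hp : 0 < p) :
    ∫⁻ x, ‖(c ^ a • affine 0 hc.ne' φ) x‖ₑ ^ p =
      ENNReal.ofReal (c ^ (a * p - d)) * ∫⁻ x, ‖φ x‖ₑ ^ p := by
  have h1 : ∀ x, ‖(c ^ a • affine 0 hc.ne' φ) x‖ₑ ^ p =
      ENNReal.ofReal (c ^ (a * p)) * (fun x => ‖φ x‖ₑ ^ p) (c • x) := by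
    intro x
    rw [smul_apply, affine_apply, sub_zero, smul_eq_mul, enorm_mul,
      Real.enorm_of_nonneg (by positivity), ENNReal.mul_rpow_of_nonneg _ _ hp.le,
      ENNReal.ofReal_rpow_of_nonneg (by positivity) hp.le, ← Real.rpow_mul hc.le]
  rw [lintegral_congr h1, lintegral_const_mul' _ _ ENNReal.ofReal_ne_top, lintegral_comp_const_smul (fun x => ‖φ x‖ₑ ^ p) hc.ne',
    ← mul_assoc, ← ENNReal.ofReal_mul (by positivity), abs_of_pos hc, Real.rpow_sub hc,
    Real.rpow_natCast]
  rfl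

theorem setLIntegral_ball_affine {ψ : 𝓢(Rd d, ℝ)} {c : ℝ} (hc : 0 < c) (a r : ℝ) :
    ∫⁻ x in Metric.ball 0 (r / c), ‖(c ^ a • affine 0 hc.ne' ψ) x‖ₑ ^ (2 : ℝ) =
      ENNReal.ofReal (c ^ (a * 2 - d)) * ∫⁻ x in Metric.ball 0 r, ‖ψ x‖ₑ ^ (2 : ℝ) := by
  have h1 : ∀ x, ‖(c ^ a • affine 0 hc.ne' ψ) x‖ₑ ^ (2 : ℝ) =
      ENNReal.ofReal (c ^ (a * 2)) * (fun x => ‖ψ x‖ₑ ^ (2 : ℝ)) (c • x) := by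
    intro x
    rw [smul_apply, affine_apply, sub_zero, smul_eq_mul, enorm_mul,
      Real.enorm_of_nonneg (by positivity), ENNReal.mul_rpow_of_nonneg _ _ zero_le_two,
      ENNReal.ofReal_rpow_of_nonneg (by positivity) zero_le_two, ← Real.rpow_mul hc.le]
  rw [lintegral_congr h1, lintegral_const_mul' _ _ ENNReal.ofReal_ne_top, setLIntegral_ball_comp_smul (fun x => ‖ψ x‖ₑ ^ (2 : ℝ)) hc,
    ← mul_assoc, ← ENNReal.ofReal_mul (by positivity), Real.rpow_sub hc, Real.rpow_natCast]
  rfl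

theorem MulGammaBound.scaling (hC : MulGammaBound Pr γ e s hη q C)
    (hγ : IsGaussianSeq Pr γ) (hd : 1 ≤ d) {p : ℝ} (hpq : p.HolderConjugate q) :
    s / d + 1 / q = 1 / η + 1 / 2 := by
  obtain ⟨φ, ψ, hφψ, x₀, hx₀⟩ := exists_isTestPair_ne_zero hd s
  have hJ := setLIntegral_ball_ne_zero hx₀
  set r := ‖x₀‖ + 1 with hr
  set I := ∫⁻ x, ‖φ x‖ₑ ^ p with hI
  set v := volume (Metric.ball (0 : Rd d) r) with hv
  have hd0 : (0 : ℝ) < d := by exact_mod_cast hd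
  have hp0 := hpq.pos
  have hη0 : (0 : ℝ) < η := by
    have : (2 : ℝ) ≤ η := by exact_mod_cast hη
    linarith
  have hI' : I ≠ ∞ := lintegral_rpow_enorm_ne_top φ hp0
  have hv' : v ≠ ∞ := measure_ball_lt_top.ne
  -- Under dilation of the pair by `c` and of the ball by `1 / c`, the left side of the single-pair
  -- bound scales as `c ^ (-2 s - d)` and the right side as `c ^ (-2 (d / p + d / η))`.
  have he : -s * 2 - d + 2 * (d / p + d / η) = 0 := by
    refine eq_zero_of_rpow_mul_le (J := ∫⁻ y in Metric.ball 0 r, ‖ψ y‖ₑ ^ (2 : ℝ))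
      (K := (I ^ (1 / p) * (C * v ^ (1 / (η : ℝ)))) ^ (2 : ℝ)) hJ ?_ fun c hc => ?_
    · refine ENNReal.rpow_ne_top_of_nonneg zero_le_two (ENNReal.mul_ne_top
        (ENNReal.rpow_ne_top_of_nonneg (by positivity) hI') (ENNReal.mul_ne_top ENNReal.coe_ne_top
          (ENNReal.rpow_ne_top_of_nonneg (by positivity) hv')))
    · have h1 := hφψ.affine 0 hc.ne'
      rw [abs_of_pos hc] at h1
      have h2 := hC.setLIntegral_le hγ hpq h1 (E := Metric.ball 0 (r / c)) measurableSet_ball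
        measure_ball_lt_top.ne
      have h3 := lintegral_affine (φ := φ) hc 0 p hp0
      rw [Real.rpow_zero, one_smul, zero_mul, zero_sub, Real.rpow_neg hc.le, Real.rpow_natCast] at h3
      rw [setLIntegral_ball_affine hc, volume_ball_div hc, h3, ← hv, ← hI] at h2
      have hce : ∀ a : ℝ, 0 ≤ a → ENNReal.ofReal ((c ^ d)⁻¹) ^ a = ENNReal.ofReal (c ^ (-(d * a))) := by
        intro a ha
        rw [ENNReal.ofReal_rpow_of_nonneg (by positivity) ha, ← Real.rpow_natCast,
          ← Real.rpow_neg hc.le, ← Real.rpow_mul hc.le, neg_mul]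
      rw [ENNReal.mul_rpow_of_nonneg _ I (by positivity), hce _ (by positivity),
        ENNReal.mul_rpow_of_nonneg _ v (by positivity), hce _ (by positivity)] at h2
      have h4 : ENNReal.ofReal (c ^ (-(d * (1 / p)))) * I ^ (1 / p) *
          (C * (ENNReal.ofReal (c ^ (-(d * (1 / (η : ℝ))))) * v ^ (1 / (η : ℝ)))) =
          ENNReal.ofReal (c ^ (-(d / p + d / η))) * (I ^ (1 / p) * (C * v ^ (1 / (η : ℝ)))) := by
        rw [show -(d / p + d / (η : ℝ)) = -(d * (1 / p)) + -(d * (1 / (η : ℝ))) by ring,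
          Real.rpow_add hc, ENNReal.ofReal_mul (by positivity)]
        ring
      rw [h4, ENNReal.mul_rpow_of_nonneg _ _ zero_le_two,
        ENNReal.ofReal_rpow_of_nonneg (by positivity) zero_le_two, ← Real.rpow_mul hc.le] at h2
      calc ENNReal.ofReal (c ^ (-s * 2 - d + 2 * (d / p + d / η))) *
            ∫⁻ y in Metric.ball 0 r, ‖ψ y‖ₑ ^ (2 : ℝ)
          = ENNReal.ofReal (c ^ (2 * (d / p + d / (η : ℝ)))) * (ENNReal.ofReal (c ^ (-s * 2 - d)) *
              ∫⁻ y in Metric.ball 0 r, ‖ψ y‖ₑ ^ (2 : ℝ)) := by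
            rw [Real.rpow_add hc, ENNReal.ofReal_mul (by positivity)]
            ring
        _ ≤ ENNReal.ofReal (c ^ (2 * (d / p + d / (η : ℝ)))) *
              (ENNReal.ofReal (c ^ (-(d / p + d / (η : ℝ)) * 2)) *
                (I ^ (1 / p) * (C * v ^ (1 / (η : ℝ)))) ^ (2 : ℝ)) := mul_le_mul_right h2 _
        _ = _ := by
            rw [← mul_assoc, ← ENNReal.ofReal_mul (by positivity), ← Real.rpow_add hc,
              show 2 * (d / p + d / (η : ℝ)) + -(d / p + d / (η : ℝ)) * 2 = 0 by ring,
              Real.rpow_zero, ENNReal.ofReal_one, one_mul]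
  have h5 := hpq.inv_add_inv_eq_one
  have h6 : s / d = 1 / p + 1 / η - 1 / 2 := by
    rw [div_eq_iff hd0.ne']
    have : d / p + d / (η : ℝ) = (1 / p + 1 / η) * d := by ring
    rw [this] at he
    linarith
  rw [h6]
  rw [← one_div, ← one_div] at h5
  linarith

end Necessity

/-! ### Necessity: translates of a test pair -/

theorem setLIntegral_translate_sq_le {d : ℕ} {q : ℝ≥0} (hq : (2 : ℝ≥0∞) ≤ q)
    (u : Lp ℝ q (volume : Measure (Rd d))) (z : Rd d) (A : Set (Rd d)) :
    ∫⁻ x in A, ‖u (x - z)‖ₑ ^ (2 : ℝ) ≤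
      (‖u‖ₑ * volume A ^ (1 / (2 : ℝ) - 1 / (q : ℝ))) ^ (2 : ℝ) := by
  have hmp : MeasurePreserving (fun x : Rd d => x - z) volume volume :=
    measurePreserving_sub_right volume z
  have hm : AEStronglyMeasurable (fun x => u (x - z)) volume :=
    (Lp.aestronglyMeasurable u).comp_measurePreserving hmp
  have h1 := eLpNorm_le_eLpNorm_mul_rpow_measure_univ hq (hm.restrict (s := A))
  have h2 : eLpNorm (fun x => u (x - z)) q volume = ‖u‖ₑ := by
    rw [Lp.enorm_def]
    exact eLpNorm_comp_measurePreserving (Lp.aestronglyMeasurable u) hmp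
  have h3 : eLpNorm (fun x => u (x - z)) 2 (volume.restrict A) ≤
      ‖u‖ₑ * volume A ^ (1 / (2 : ℝ) - 1 / (q : ℝ)) := by
    refine h1.trans ?_
    rw [Measure.restrict_apply_univ, ENNReal.toReal_ofNat, ENNReal.coe_toReal, ← h2]
    exact mul_le_mul_left (eLpNorm_mono_measure _ Measure.restrict_le_self) _
  refine le_trans (le_of_eq ?_) (ENNReal.rpow_le_rpow h3 zero_le_two)
  rw [eLpNorm_eq_lintegral_rpow_enorm_toReal two_ne_zero ENNReal.ofNat_ne_top,
    ENNReal.toReal_ofNat, ← ENNReal.rpow_mul, one_div_mul_cancel two_ne_zero, ENNReal.rpow_one]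

/-- Cauchy–Schwarz for the measure `|φ(x - y)| dy`. -/
theorem enorm_integral_conv_sq_le {d : ℕ} {φ u : Rd d → ℝ} (hφ : Measurable φ)
    (hu : Measurable u) (x : Rd d) :
    ‖∫ y, φ (x - y) * u y‖ₑ ^ (2 : ℝ) ≤
      (∫⁻ z, ‖φ z‖ₑ) * ∫⁻ z, ‖φ z‖ₑ * ‖u (x - z)‖ₑ ^ (2 : ℝ) := by
  have hφx : Measurable fun y => φ (x - y) := hφ.comp (measurable_const.sub measurable_id)
  have h1 : ‖∫ y, φ (x - y) * u y‖ₑ ≤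
      ∫⁻ y, ((fun y => ‖φ (x - y)‖ₑ ^ (1 / (2 : ℝ))) *
        fun y => ‖φ (x - y)‖ₑ ^ (1 / (2 : ℝ)) * ‖u y‖ₑ) y := by
    refine (enorm_integral_le_lintegral_enorm _).trans (le_of_eq (lintegral_congr fun y => ?_))
    rw [Pi.mul_apply, ← mul_assoc, ← ENNReal.rpow_add_of_nonneg _ _ (by norm_num) (by norm_num),
      enorm_mul]
    norm_num
  have h2 := h1.trans (ENNReal.lintegral_mul_le_Lp_mul_Lq volume Real.HolderConjugate.two_two
    (hφx.enorm.pow_const _).aemeasurable ((hφx.enorm.pow_const _).mul hu.enorm).aemeasurable)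
  refine (ENNReal.rpow_le_rpow h2 zero_le_two).trans (le_of_eq ?_)
  have h3 : ∀ t : ℝ≥0∞, (t ^ (1 / (2 : ℝ))) ^ (2 : ℝ) = t := fun t => by
    rw [← ENNReal.rpow_mul, one_div_mul_cancel two_ne_zero, ENNReal.rpow_one]
  rw [ENNReal.mul_rpow_of_nonneg _ _ zero_le_two, h3, h3]
  simp_rw [ENNReal.mul_rpow_of_nonneg _ _ zero_le_two, h3]
  congr 1
  · exact lintegral_sub_left (fun z => ‖φ z‖ₑ) x
  · have := lintegral_sub_left (fun z => ‖φ z‖ₑ * ‖u (x - z)‖ₑ ^ (2 : ℝ)) x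
    simp only [sub_sub_cancel] at this
    exact this

/-- Convolution with `φ` costs `‖φ‖_1`, and passing from `L^q` to `L²` on `A` costs a power of the
volume of `A`. -/
theorem setLIntegral_conv_sq_le {d : ℕ} {q : ℝ≥0} (hq : (2 : ℝ≥0∞) ≤ q) {φ : Rd d → ℝ}
    (hφ : Measurable φ) (u : Lp ℝ q (volume : Measure (Rd d))) (A : Set (Rd d)) :
    ∫⁻ x in A, ‖∫ y, φ (x - y) * u y‖ₑ ^ (2 : ℝ) ≤
      ((∫⁻ z, ‖φ z‖ₑ) * volume A ^ (1 / (2 : ℝ) - 1 / (q : ℝ)) * ‖u‖ₑ) ^ (2 : ℝ) := by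
  have hu : Measurable u := (Lp.stronglyMeasurable u).measurable
  set N := ∫⁻ z, ‖φ z‖ₑ with hN
  have hm : Measurable fun p : Rd d × Rd d => ‖φ p.2‖ₑ * ‖u (p.1 - p.2)‖ₑ ^ (2 : ℝ) :=
    (hφ.comp measurable_snd).enorm.mul
      ((hu.comp (measurable_fst.sub measurable_snd)).enorm.pow_const _)
  calc ∫⁻ x in A, ‖∫ y, φ (x - y) * u y‖ₑ ^ (2 : ℝ)
      ≤ ∫⁻ x in A, N * ∫⁻ z, ‖φ z‖ₑ * ‖u (x - z)‖ₑ ^ (2 : ℝ) :=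
        lintegral_mono fun x => enorm_integral_conv_sq_le hφ hu x
    _ = N * ∫⁻ z, ∫⁻ x in A, ‖φ z‖ₑ * ‖u (x - z)‖ₑ ^ (2 : ℝ) := by
        rw [lintegral_const_mul _ hm.lintegral_prod_right', lintegral_lintegral_swap hm.aemeasurable]
    _ ≤ N * ∫⁻ z, ‖φ z‖ₑ * (‖u‖ₑ * volume A ^ (1 / (2 : ℝ) - 1 / (q : ℝ))) ^ (2 : ℝ) := by
        refine mul_le_mul_right (lintegral_mono fun z => ?_) _
        rw [lintegral_const_mul' _ _ enorm_ne_top]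
        exact mul_le_mul_right (setLIntegral_translate_sq_le hq u z A) _
    _ = _ := by
        have hsq : N * N = N ^ (2 : ℝ) := by rw [ENNReal.rpow_two, sq]
        rw [lintegral_mul_const _ hφ.enorm, ← hN, ← mul_assoc, hsq,
          ← ENNReal.mul_rpow_of_nonneg _ _ zero_le_two]
        congr 1
        ring

section Necessity

variable {Ω : Type*} [MeasurableSpace Ω] {Pr : Measure Ω}
  [IsProbabilityMeasure Pr] {γ : ℕ → Ω → ℝ} {d : ℕ}
  {e : HilbertBasis ℕ ℝ (Lp ℝ 2 (volume : Measure (Rd d)))} {s : ℝ} {η q : ℝ≥0}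
  {hη : (2 : ℝ≥0∞) ≤ η} [Fact ((1 : ℝ≥0∞) ≤ q)] {C : ℝ≥0}

/-- For `x` in the ball of radius `R`, the set `x - B_{2R}` contains `B_R`. -/
theorem mul_setLIntegral_ball_le (f : Rd d → ℝ≥0∞) (R : ℝ) :
    volume (Metric.ball (0 : Rd d) R) * ∫⁻ z in Metric.ball 0 R, f z ≤
      ∫⁻ x in Metric.ball 0 R, ∫⁻ y in Metric.ball 0 (2 * R), f (x - y) := by
  rw [mul_comm, ← setLIntegral_const]
  refine setLIntegral_mono' measurableSet_ball fun x hx => ?_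
  rw [← lintegral_indicator measurableSet_ball, ← lintegral_indicator measurableSet_ball,
    ← lintegral_sub_left _ x]
  refine lintegral_mono fun y => ?_
  by_cases hy : x - y ∈ Metric.ball (0 : Rd d) R
  · have : y ∈ Metric.ball (0 : Rd d) (2 * R) := by
      rw [mem_ball_zero_iff] at hx hy ⊢
      have h := norm_sub_le x (x - y)
      rw [sub_sub_cancel] at h
      linarith
    rw [Set.indicator_of_mem hy, Set.indicator_of_mem this]
  · rw [Set.indicator_of_notMem hy]
    exact zero_le

/-- Testing with all pairs `y ↦ φ(x - y)`, `x ∈ B_R`, and `E = B_{2R}`. Compared with a single pair,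
averaging replaces `‖φ‖_{q'}` by `‖φ‖_1` and changes the power of the volume, with `K` independent
of the pair. -/
theorem MulGammaBound.setLIntegral_ball_le (hC : MulGammaBound Pr γ e s hη q C)
    (hγ : IsGaussianSeq Pr γ) (hq : (2 : ℝ≥0∞) ≤ q) : ∃ K : ℝ≥0, ∀ {φ ψ : 𝓢(Rd d, ℝ)},
    IsTestPair s φ ψ → ∀ R : ℝ, 0 < R → ∫⁻ z in Metric.ball 0 R, ‖ψ z‖ₑ ^ (2 : ℝ) ≤
      K * (∫⁻ x, ‖φ x‖ₑ) ^ (2 : ℝ) *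
        volume (Metric.ball (0 : Rd d) R) ^ (2 / (η : ℝ) - 2 / (q : ℝ)) := by
  have hη2 : (2 : ℝ) ≤ η := by exact_mod_cast hη
  have hq2 : (2 : ℝ) ≤ q := by exact_mod_cast hq
  -- The factor `((1 / 2) ^ d)⁻¹ = 2 ^ d` is the ratio of the volumes of `B_{2R}` and `B_R`.
  set k : ℝ≥0∞ := (C * ENNReal.ofReal (((1 / 2 : ℝ) ^ d)⁻¹) ^ (1 / (η : ℝ))) ^ (2 : ℝ) with hk
  have hkfin : k ≠ ∞ := ENNReal.rpow_ne_top_of_nonneg zero_le_two (ENNReal.mul_ne_top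
    ENNReal.coe_ne_top (ENNReal.rpow_ne_top_of_nonneg (by positivity) ENNReal.ofReal_ne_top))
  refine ⟨k.toNNReal, fun {φ ψ} hφψ R hR => ?_⟩
  rw [ENNReal.coe_toNNReal hkfin]
  set v := volume (Metric.ball (0 : Rd d) R) with hv
  set N := ∫⁻ x, ‖φ x‖ₑ with hN
  have hv0 : v ≠ 0 := (Metric.measure_ball_pos _ _ hR).ne'
  have hvt : v ≠ ∞ := measure_ball_lt_top.ne
  have hNt : N ≠ ∞ := by simpa using lintegral_rpow_enorm_ne_top φ zero_lt_one
  have hexp : 0 ≤ 1 / (2 : ℝ) - 1 / (q : ℝ) :=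
    sub_nonneg.2 (one_div_le_one_div_of_le zero_lt_two hq2)
  have hBt : N * v ^ (1 / (2 : ℝ) - 1 / (q : ℝ)) ≠ ∞ :=
    ENNReal.mul_ne_top hNt (ENNReal.rpow_ne_top_of_nonneg hexp hvt)
  have hpair : ∀ x : Rd d, IsTestPair s (affine x (neg_ne_zero.2 one_ne_zero) φ)
      (affine x (neg_ne_zero.2 one_ne_zero) ψ) := by
    intro x
    have := hφψ.affine x (neg_ne_zero.2 (one_ne_zero (α := ℝ)))
    rwa [abs_neg, abs_one, Real.one_rpow, one_smul] at this
  have happ : ∀ (f : 𝓢(Rd d, ℝ)) (x y : Rd d),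
      affine x (neg_ne_zero.2 one_ne_zero) f y = f (x - y) := by
    intro f x y
    rw [affine_apply, neg_one_smul, neg_sub]
  have h := hC.testing hγ (ν := volume.restrict (Metric.ball 0 R)) hpair (by
      simp_rw [happ]
      exact ψ.continuous.measurable.comp (measurable_fst.sub measurable_snd))
    (B := (N * v ^ (1 / (2 : ℝ) - 1 / (q : ℝ))).toNNReal) (fun u => by
      rw [ENNReal.coe_toNNReal hBt]
      simp_rw [ofLp_apply, happ]
      exact setLIntegral_conv_sq_le hq φ.continuous.measurable u _)
    (measurableSet_ball (x := (0 : Rd d)) (ε := 2 * R)) measure_ball_lt_top.ne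
  rw [ENNReal.coe_toNNReal hBt] at h
  simp_rw [happ] at h
  have h2R : volume (Metric.ball (0 : Rd d) (2 * R)) =
      ENNReal.ofReal (((1 / 2 : ℝ) ^ d)⁻¹) * v := by
    rw [hv, ← volume_ball_div (by norm_num)]
    congr 2
    ring
  rw [h2R] at h
  have h' := (mul_setLIntegral_ball_le (fun z => ‖ψ z‖ₑ ^ (2 : ℝ)) R).trans h
  rw [← hv] at h'
  refine (ENNReal.mul_le_mul_iff_right hv0 hvt).1 (h'.trans_eq ?_)
  have hpow : v * v ^ (2 / (η : ℝ) - 2 / (q : ℝ)) =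
      (v ^ (1 / (2 : ℝ) - 1 / (q : ℝ)) * v ^ (1 / (η : ℝ))) ^ (2 : ℝ) := by
    rw [← ENNReal.rpow_add _ _ hv0 hvt, ← ENNReal.rpow_mul]
    nth_rewrite 1 [← ENNReal.rpow_one v]
    rw [← ENNReal.rpow_add _ _ hv0 hvt]
    congr 1
    ring
  rw [ENNReal.mul_rpow_of_nonneg _ v (by positivity : 0 ≤ 1 / (η : ℝ))]
  calc (N * v ^ (1 / (2 : ℝ) - 1 / (q : ℝ)) *
        (C * (ENNReal.ofReal (((1 / 2 : ℝ) ^ d)⁻¹) ^ (1 / (η : ℝ)) * v ^ (1 / (η : ℝ))))) ^ (2 : ℝ)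
      = (C * ENNReal.ofReal (((1 / 2 : ℝ) ^ d)⁻¹) ^ (1 / (η : ℝ)) * N *
          (v ^ (1 / (2 : ℝ) - 1 / (q : ℝ)) * v ^ (1 / (η : ℝ)))) ^ (2 : ℝ) := by
        congr 1
        ring
    _ = k * N ^ (2 : ℝ) * (v * v ^ (2 / (η : ℝ) - 2 / (q : ℝ))) := by
        rw [ENNReal.mul_rpow_of_nonneg _ _ zero_le_two, ENNReal.mul_rpow_of_nonneg _ _ zero_le_two,
          ← hpow]
    _ = _ := by ring

theorem iUnion_ball_nat : ⋃ n : ℕ, Metric.ball (0 : Rd d) (n + 1) = Set.univ := by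
  refine Set.eq_univ_of_forall fun x => Set.mem_iUnion.2 ?_
  obtain ⟨n, hn⟩ := exists_nat_gt ‖x‖
  exact ⟨n, by rw [mem_ball_zero_iff]; linarith⟩

/-- For `q < η` the power of the volume is negative, so `R → ∞` would force `ψ = 0`. -/
theorem MulGammaBound.le_of_scaling (hC : MulGammaBound Pr γ e s hη q C)
    (hγ : IsGaussianSeq Pr γ) (hd : 1 ≤ d) (hq : (2 : ℝ≥0∞) ≤ q) : η ≤ q := by
  by_contra! hlt
  obtain ⟨K, hK⟩ := hC.setLIntegral_ball_le hγ hq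
  obtain ⟨φ, ψ, hφψ, x₀, hx₀⟩ := exists_isTestPair_ne_zero hd s
  have hlt' : (q : ℝ) < η := by exact_mod_cast hlt
  have hq2 : (2 : ℝ) ≤ q := by exact_mod_cast hq
  have hexp : 2 / (η : ℝ) - 2 / (q : ℝ) < 0 :=
    sub_neg.2 (div_lt_div_of_pos_left two_pos (by linarith) hlt')
  have : Nonempty (Fin d) := ⟨⟨0, hd⟩⟩
  have hmono : Monotone fun n : ℕ => Metric.ball (0 : Rd d) ((n : ℝ) + 1) := fun m n hmn =>
    Metric.ball_subset_ball (by
      have : (m : ℝ) ≤ n := by exact_mod_cast hmn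
      linarith)
  have hvol : Tendsto (fun n : ℕ => volume (Metric.ball (0 : Rd d) (n + 1))) atTop (𝓝 ∞) := by
    have h := tendsto_measure_iUnion_atTop (μ := (volume : Measure (Rd d))) hmono
    rwa [iUnion_ball_nat, measure_univ_of_isAddLeftInvariant] at h
  have hNt : ∫⁻ x, ‖φ x‖ₑ ≠ ∞ := by simpa using lintegral_rpow_enorm_ne_top φ zero_lt_one
  have hlim : Tendsto (fun n : ℕ => K * (∫⁻ x, ‖φ x‖ₑ) ^ (2 : ℝ) *
      volume (Metric.ball (0 : Rd d) (n + 1)) ^ (2 / (η : ℝ) - 2 / (q : ℝ))) atTop (𝓝 0) := by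
    have h1 := (ENNReal.continuous_rpow_const (y := 2 / (η : ℝ) - 2 / (q : ℝ))).tendsto ∞
    rw [ENNReal.top_rpow_of_neg hexp] at h1
    have h2 := ENNReal.Tendsto.const_mul (h1.comp hvol)
      (Or.inr (ENNReal.mul_ne_top (ENNReal.coe_ne_top (r := K))
        (ENNReal.rpow_ne_top_of_nonneg zero_le_two hNt)))
    rwa [mul_zero] at h2
  refine setLIntegral_ball_ne_zero hx₀ (le_antisymm (ge_of_tendsto hlim ?_) zero_le)
  obtain ⟨n₀, hn₀⟩ := exists_nat_ge ‖x₀‖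
  filter_upwards [eventually_ge_atTop n₀] with n hn
  refine le_trans (lintegral_mono_set (Metric.ball_subset_ball ?_)) (hK hφψ (n + 1) (by positivity))
  have : (n₀ : ℝ) ≤ n := by exact_mod_cast hn
  linarith

end Necessity

/-! ### Necessity: superposition of dyadic annuli -/

/-- Here `φ` is the difference of two `L¹`-normalised dilates of one Schwartz function, so its `L¹`
norm is bounded uniformly in the number `N` of scales. -/
theorem exists_isTestPair_annulus (d : ℕ) (s : ℝ) : ∃ M : ℝ≥0∞, M ≠ ∞ ∧ ∀ N : ℕ,
    ∃ φ ψ : 𝓢(Rd d, ℝ), IsTestPair s φ ψ ∧ (∀ ξ, 𝓕 (toComplex φ) ξ = annulus d N ξ) ∧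
      ∫⁻ x, ‖φ x‖ₑ ≤ M := by
  obtain ⟨Θ, hΘ⟩ := exists_fourier_eq (cutoff d).contDiff (cutoff d).hasCompactSupport
    fun ξ => (cutoff d).neg ξ
  have hΘt : ∫⁻ x, ‖Θ x‖ₑ ≠ ∞ := by simpa using lintegral_rpow_enorm_ne_top Θ zero_lt_one
  refine ⟨(∫⁻ x, ‖Θ x‖ₑ) + ∫⁻ x, ‖Θ x‖ₑ, ENNReal.add_ne_top.2 ⟨hΘt, hΘt⟩, fun N => ?_⟩
  have hc : (0 : ℝ) < 2 ^ N := by positivity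
  set φ : 𝓢(Rd d, ℝ) := ((2 : ℝ) ^ N) ^ (d : ℝ) • affine 0 hc.ne' Θ - Θ with hφ
  have hφF : ∀ ξ, 𝓕 (toComplex φ) ξ = annulus d N ξ := by
    intro ξ
    have h1 : toComplex φ = ((((2 : ℝ) ^ N) ^ (d : ℝ) : ℝ) : ℂ) • toComplex (affine 0 hc.ne' Θ) +
        (-1 : ℂ) • toComplex Θ := by
      ext x
      rw [hφ]
      simp [sub_eq_add_neg]
    rw [h1, FourierTransform.fourier_add, FourierTransform.fourier_smul,
      FourierTransform.fourier_smul, add_apply, smul_apply, smul_apply, smul_eq_mul,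
      smul_eq_mul, fourier_affine, hΘ, hΘ, annulus, inner_zero_left, mul_zero, Complex.ofReal_zero,
      zero_mul, Complex.exp_zero, one_mul, ← mul_assoc, abs_of_pos hc, Real.rpow_natCast,
      ← Complex.ofReal_mul, mul_inv_cancel₀
      (by positivity), Complex.ofReal_one, one_mul, Complex.ofReal_sub, neg_one_mul, sub_eq_add_neg]
  obtain ⟨ψ, hψ⟩ := exists_isTestPair s hφF (contDiff_annulus d N) (hasCompactSupport_annulus d N)
    annulus_neg (annulus_eventually_eq_zero d N)
  refine ⟨φ, ψ, hψ, hφF, ?_⟩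
  have h3 := lintegral_affine (φ := Θ) hc d 1 one_pos
  simp only [ENNReal.rpow_one, mul_one, sub_self, Real.rpow_zero, ENNReal.ofReal_one, one_mul] at h3
  conv_rhs => enter [1]; rw [← h3]
  rw [← lintegral_add_left (by exact (SchwartzMap.continuous _).measurable.enorm)]
  refine lintegral_mono fun x => ?_
  rw [hφ, sub_apply]
  exact enorm_sub_le

theorem lintegral_symbol_annulus_ne_zero {d : ℕ} (hd : 1 ≤ d) (s : ℝ) :
    ∫⁻ ξ : Rd d, ‖(2 * Real.pi * ‖ξ‖) ^ (-s) * annulus d 1 ξ‖ₑ ^ (2 : ℝ) ≠ 0 := by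
  have hcont : Continuous fun ξ : Rd d => (2 * Real.pi * ‖ξ‖) ^ (-s) * annulus d 1 ξ :=
    (contDiff_symbol s (contDiff_annulus d 1) (annulus_eventually_eq_zero d 1)).continuous
  intro h
  rw [lintegral_eq_zero_iff (hcont.measurable.enorm.pow_const _)] at h
  have h1 : (fun ξ : Rd d => (2 * Real.pi * ‖ξ‖) ^ (-s) * annulus d 1 ξ) =ᵐ[volume] fun _ => 0 := by
    filter_upwards [h] with ξ hξ
    rwa [Pi.zero_apply, ENNReal.rpow_eq_zero_iff_of_pos zero_lt_two, enorm_eq_zero] at hξ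
  have h2 := (hcont.ae_eq_iff_eq volume continuous_const).1 h1
  obtain ⟨ξ, hξ⟩ := exists_norm_eq_two hd
  have h3 := congrFun h2 ξ
  simp only [annulus_one_eq_one hξ, mul_one, hξ] at h3
  have h4 : (2 * Real.pi * 2) ^ (-s) ≠ 0 := by positivity
  exact h4 h3

/-- For `2 s = d` the squared symbol is a multiple of `‖ξ‖ ^ (-d)`, and `‖ξ‖ ^ (-d) dξ` is invariant
under dilations. -/
theorem lintegral_symbol_annulus_dilate {d : ℕ} {s : ℝ} (hs : 2 * s = d) (j : ℕ) :
    ∫⁻ ξ : Rd d, ‖(2 * Real.pi * ‖ξ‖) ^ (-s) * annulus d 1 (((2 : ℝ) ^ j)⁻¹ • ξ)‖ₑ ^ (2 : ℝ) =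
      ∫⁻ ξ : Rd d, ‖(2 * Real.pi * ‖ξ‖) ^ (-s) * annulus d 1 ξ‖ₑ ^ (2 : ℝ) := by
  set c : ℝ := 2 ^ j with hcdef
  have hc : 0 < c := by positivity
  have h1 : ∀ ξ : Rd d, ‖(2 * Real.pi * ‖ξ‖) ^ (-s) * annulus d 1 (c⁻¹ • ξ)‖ₑ ^ (2 : ℝ) =
      ENNReal.ofReal (c ^ (-(2 * s))) *
        (fun ξ => ‖(2 * Real.pi * ‖ξ‖) ^ (-s) * annulus d 1 ξ‖ₑ ^ (2 : ℝ)) (c⁻¹ • ξ) := by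
    intro ξ
    have h2 : (2 * Real.pi * ‖ξ‖) ^ (-s) = c ^ (-s) * (2 * Real.pi * ‖c⁻¹ • ξ‖) ^ (-s) := by
      rw [← Real.mul_rpow hc.le (by positivity), norm_smul, Real.norm_of_nonneg (by positivity)]
      congr 1
      field_simp
    rw [h2, mul_assoc, enorm_mul, ENNReal.mul_rpow_of_nonneg _ _ zero_le_two,
      Real.enorm_of_nonneg (by positivity : 0 ≤ c ^ (-s)),
      ENNReal.ofReal_rpow_of_nonneg (by positivity) zero_le_two, ← Real.rpow_mul hc.le]
    congr 3
    ring
  rw [lintegral_congr h1, lintegral_const_mul' _ _ ENNReal.ofReal_ne_top,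
    lintegral_comp_const_smul (fun ξ : Rd d =>
      ‖(2 * Real.pi * ‖ξ‖) ^ (-s) * annulus d 1 ξ‖ₑ ^ (2 : ℝ)) (inv_ne_zero hc.ne'),
    ← mul_assoc, ← ENNReal.ofReal_mul (by positivity), hs, Real.rpow_neg hc.le, Real.rpow_natCast,
    abs_of_pos (inv_pos.2 hc), inv_pow, inv_inv, inv_mul_cancel₀ (by positivity),
    ENNReal.ofReal_one, one_mul]

/-- By Plancherel's theorem each of the `N` dyadic pieces contributes the same amount to the `L²`
norm of `ψ`. The pieces may overlap; being nonnegative, they satisfy `∑ a_j² ≤ (∑ a_j)²`. -/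
theorem mul_lintegral_symbol_annulus_le {d : ℕ} {s : ℝ} (hs : 2 * s = d) {N : ℕ}
    {φ ψ : 𝓢(Rd d, ℝ)} (h : IsTestPair s φ ψ)
    (hφ : ∀ ξ, 𝓕 (toComplex φ) ξ = annulus d N ξ) :
    N * ∫⁻ ξ : Rd d, ‖(2 * Real.pi * ‖ξ‖) ^ (-s) * annulus d 1 ξ‖ₑ ^ (2 : ℝ) ≤
      ∫⁻ x, ‖ψ x‖ₑ ^ (2 : ℝ) := by
  have h1 : ∫⁻ x, ‖ψ x‖ₑ ^ (2 : ℝ) = ∫⁻ ξ, ‖𝓕 (toComplex ψ) ξ‖ₑ ^ (2 : ℝ) := by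
    rw [lintegral_sq_fourier]
    refine lintegral_congr fun x => ?_
    rw [toComplex_apply, ← ofReal_norm, ← ofReal_norm, Complex.norm_real]
  have h2 : N * ∫⁻ ξ : Rd d, ‖(2 * Real.pi * ‖ξ‖) ^ (-s) * annulus d 1 ξ‖ₑ ^ (2 : ℝ) =
      ∑ j ∈ Finset.range N, ∫⁻ ξ : Rd d,
        ‖(2 * Real.pi * ‖ξ‖) ^ (-s) * annulus d 1 (((2 : ℝ) ^ j)⁻¹ • ξ)‖ₑ ^ (2 : ℝ) := by
    rw [Finset.sum_congr rfl fun j _ => lintegral_symbol_annulus_dilate hs j, Finset.sum_const,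
      Finset.card_range, nsmul_eq_mul]
  have hm : ∀ j : ℕ, Measurable fun ξ : Rd d =>
      ‖(2 * Real.pi * ‖ξ‖) ^ (-s) * annulus d 1 (((2 : ℝ) ^ j)⁻¹ • ξ)‖ₑ ^ (2 : ℝ) := by
    intro j
    have ha : Measurable (annulus d 1) := (contDiff_annulus d 1).continuous.measurable
    exact ((((measurable_norm.const_mul _).pow_const _).mul
      (ha.comp (measurable_const_smul _))).enorm).pow_const _
  rw [h1, h2, ← lintegral_finsetSum _ fun j _ => hm j]
  refine lintegral_mono fun ξ => ?_
  rw [h.fourier, hφ, ← Complex.ofReal_mul, ← ofReal_norm, Complex.norm_real, ofReal_norm,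
    annulus_eq_sum, Finset.mul_sum]
  have h3 : ∀ j, 0 ≤ (2 * Real.pi * ‖ξ‖) ^ (-s) * annulus d 1 (((2 : ℝ) ^ j)⁻¹ • ξ) := fun j =>
    mul_nonneg (by positivity) (annulus_one_nonneg _)
  have h4 : ∀ t : ℝ, 0 ≤ t → ‖t‖ₑ ^ (2 : ℝ) = ENNReal.ofReal (t ^ 2) := by
    intro t ht
    rw [Real.enorm_of_nonneg ht, ENNReal.rpow_two, ENNReal.ofReal_pow ht]
  rw [h4 _ (Finset.sum_nonneg fun j _ => h3 j), Finset.sum_congr rfl fun j _ => h4 _ (h3 j),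
    ← ENNReal.ofReal_sum_of_nonneg fun j _ => by positivity]
  exact ENNReal.ofReal_le_ofReal (Finset.sum_sq_le_sq_sum_of_nonneg fun j _ => h3 j)

section Necessity

variable {Ω : Type*} [MeasurableSpace Ω] {Pr : Measure Ω}
  [IsProbabilityMeasure Pr] {γ : ℕ → Ω → ℝ} {d : ℕ}
  {e : HilbertBasis ℕ ℝ (Lp ℝ 2 (volume : Measure (Rd d)))} {s : ℝ} {η q : ℝ≥0}
  {hη : (2 : ℝ≥0∞) ≤ η} [Fact ((1 : ℝ≥0∞) ≤ q)] {C : ℝ≥0}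

/-- If `η = q`, then `s = d / 2` and the volume disappears from the averaged bound, giving `‖ψ‖_2 ≤
C' ‖φ‖_1` for all test pairs. The annular pairs have bounded right side but `‖ψ‖_2²` at least
proportional to `N`. -/
theorem MulGammaBound.ne_of_scaling (hC : MulGammaBound Pr γ e s hη q C)
    (hγ : IsGaussianSeq Pr γ) (hd : 1 ≤ d) (hq : (2 : ℝ≥0∞) ≤ q)
    (hsc : s / d + 1 / q = 1 / η + 1 / 2) : η ≠ q := by
  rintro rfl
  have hd0 : (0 : ℝ) < d := by exact_mod_cast hd
  have hs : 2 * s = d := by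
    have : s / d = 1 / 2 := by linarith
    rw [div_eq_iff hd0.ne'] at this
    linarith
  obtain ⟨K, hK⟩ := hC.setLIntegral_ball_le hγ hq
  obtain ⟨M, hM, hpair⟩ := exists_isTestPair_annulus d s
  have hmono : Monotone fun n : ℕ => Metric.ball (0 : Rd d) ((n : ℝ) + 1) := fun m n hmn =>
    Metric.ball_subset_ball (by
      have : (m : ℝ) ≤ n := by exact_mod_cast hmn
      linarith)
  have hbound : ∀ N : ℕ, N * ∫⁻ ξ : Rd d,
      ‖(2 * Real.pi * ‖ξ‖) ^ (-s) * annulus d 1 ξ‖ₑ ^ (2 : ℝ) ≤ K * M ^ (2 : ℝ) := by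
    intro N
    obtain ⟨φ, ψ, hφψ, hφ, hφM⟩ := hpair N
    refine (mul_lintegral_symbol_annulus_le hs hφψ hφ).trans ?_
    rw [← setLIntegral_univ, ← iUnion_ball_nat,
      setLIntegral_iUnion_of_directed _ hmono.directed_le]
    refine iSup_le fun n => (hK hφψ (n + 1) (by positivity)).trans ?_
    rw [sub_self, ENNReal.rpow_zero, mul_one]
    exact mul_le_mul_right (ENNReal.rpow_le_rpow hφM zero_le_two) _
  have hlim := ENNReal.Tendsto.mul_const (b := ∫⁻ ξ : Rd d,
      ‖(2 * Real.pi * ‖ξ‖) ^ (-s) * annulus d 1 ξ‖ₑ ^ (2 : ℝ)) ENNReal.tendsto_nat_nhds_top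
      (Or.inl ENNReal.top_ne_zero)
  rw [ENNReal.top_mul (lintegral_symbol_annulus_ne_zero hd s)] at hlim
  have hfin : K * M ^ (2 : ℝ) ≠ ∞ := ENNReal.mul_ne_top ENNReal.coe_ne_top
    (ENNReal.rpow_ne_top_of_nonneg zero_le_two hM)
  exact hfin (top_le_iff.1 (le_of_tendsto' hlim hbound))

end Necessity

/-! ### Necessity: superposition of two widely separated scales -/

/-- Expand the square and use subadditivity of `t ↦ t ^ (p / 2)`. The coefficient `1` of the
diagonal terms matters: it makes the `p`-th powers of two nearly separated functions add. -/
theorem add_rpow_le_add_rpow_add {p : ℝ} (hp0 : 0 ≤ p) (hp : p ≤ 2) (a b : ℝ≥0∞) :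
    (a + b) ^ p ≤ a ^ p + b ^ p + 2 ^ (p / 2) * (a ^ (p / 2) * b ^ (p / 2)) := by
  have h2 : ∀ t : ℝ≥0∞, t ^ p = (t ^ 2) ^ (p / 2) := fun t => by
    rw [← ENNReal.rpow_two, ← ENNReal.rpow_mul, mul_div_cancel₀ _ two_ne_zero]
  have h0 : 0 ≤ p / 2 := by linarith
  have h1 : p / 2 ≤ 1 := by linarith
  rw [h2 (a + b), h2 a, h2 b, ← ENNReal.mul_rpow_of_nonneg _ _ h0, ← ENNReal.mul_rpow_of_nonneg _ _ h0,
    show (a + b) ^ 2 = a ^ 2 + b ^ 2 + 2 * (a * b) by ring]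
  exact (ENNReal.rpow_add_le_add_rpow _ _ h0 h1).trans
    (add_le_add_left (ENNReal.rpow_add_le_add_rpow _ _ h0 h1) _)

section

variable {d : ℕ} {s p : ℝ}

/-- The dilate has the same `L^p` norm as `φ`. In the cross term `φ` is bounded by its supremum, and
the integral of the `p / 2`-th power of the dilate decays as `c ^ (-d / 2)`. -/
theorem exists_lintegral_add_affine_le (hp0 : 0 < p) (hp : p ≤ 2) (φ : 𝓢(Rd d, ℝ)) :
    ∃ Z : ℝ≥0∞, Z ≠ ∞ ∧ ∀ (c : ℝ) (hc : 0 < c),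
      ∫⁻ x, ‖(φ + c ^ (d / p) • affine 0 hc.ne' φ) x‖ₑ ^ p ≤
        2 * (∫⁻ x, ‖φ x‖ₑ ^ p) + Z * ENNReal.ofReal (c ^ (-((d : ℝ) / 2))) := by
  obtain ⟨m, hm⟩ := φ.toBoundedContinuousFunction.bddAbove_range_norm_comp
  set m' : ℝ≥0∞ := ENNReal.ofReal m with hm'
  have hφm : ∀ x, ‖φ x‖ₑ ≤ m' := by
    intro x
    rw [← ofReal_norm]
    exact ENNReal.ofReal_le_ofReal (hm ⟨x, rfl⟩)
  have hp2 : 0 < p / 2 := by positivity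
  refine ⟨2 ^ (p / 2) * (m' ^ (p / 2) * ∫⁻ x, ‖φ x‖ₑ ^ (p / 2)), ?_, fun c hc => ?_⟩
  · exact ENNReal.mul_ne_top (ENNReal.rpow_ne_top_of_nonneg hp2.le ENNReal.ofNat_ne_top)
      (ENNReal.mul_ne_top (ENNReal.rpow_ne_top_of_nonneg hp2.le ENNReal.ofReal_ne_top)
        (lintegral_rpow_enorm_ne_top φ hp2))
  set φ' := c ^ (d / p) • affine 0 hc.ne' φ with hφ'
  have hmeas : ∀ (f : 𝓢(Rd d, ℝ)) (r : ℝ), Measurable fun x => ‖f x‖ₑ ^ r := fun f r =>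
    f.continuous.measurable.enorm.pow_const _
  have h1 : ∫⁻ x, ‖φ' x‖ₑ ^ p = ∫⁻ x, ‖φ x‖ₑ ^ p := by
    rw [hφ', lintegral_affine hc _ p hp0, div_mul_cancel₀ _ hp0.ne', sub_self, Real.rpow_zero,
      ENNReal.ofReal_one, one_mul]
  have h2 : ∫⁻ x, ‖φ' x‖ₑ ^ (p / 2) =
      ENNReal.ofReal (c ^ (-((d : ℝ) / 2))) * ∫⁻ x, ‖φ x‖ₑ ^ (p / 2) := by
    rw [hφ', lintegral_affine hc _ (p / 2) hp2]
    congr 3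
    field_simp
    ring
  calc ∫⁻ x, ‖(φ + φ') x‖ₑ ^ p
      ≤ ∫⁻ x, (‖φ x‖ₑ ^ p + ‖φ' x‖ₑ ^ p + 2 ^ (p / 2) * (m' ^ (p / 2) * ‖φ' x‖ₑ ^ (p / 2))) := by
        refine lintegral_mono fun x => ?_
        rw [add_apply]
        refine (ENNReal.rpow_le_rpow (enorm_add_le _ _) hp0.le).trans
          ((add_rpow_le_add_rpow_add hp0.le hp _ _).trans ?_)
        refine add_le_add_right (mul_le_mul_right (mul_le_mul_left ?_ _) _) _
        exact ENNReal.rpow_le_rpow (hφm x) hp2.le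
    _ = _ := by
        rw [lintegral_add_left (f := fun x => ‖φ x‖ₑ ^ p + ‖φ' x‖ₑ ^ p)
            ((hmeas φ p).add (hmeas φ' p)), lintegral_add_left (hmeas φ p),
          lintegral_const_mul _ ((hmeas φ' _).const_mul _), lintegral_const_mul _ (hmeas φ' _),
          h1, h2]
        ring

/-- If point evaluation is bounded on test pairs, then the constant can be improved. -/
theorem enorm_apply_zero_le_improve (hd : 1 ≤ d) (hp0 : 0 < p) (hp : p ≤ 2) (hs : s = d / p)
    {D : ℝ≥0∞} (hD : D ≠ ∞)
    (h : ∀ φ ψ : 𝓢(Rd d, ℝ), IsTestPair s φ ψ → ‖ψ 0‖ₑ ≤ D * (∫⁻ x, ‖φ x‖ₑ ^ p) ^ (1 / p))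
    {φ ψ : 𝓢(Rd d, ℝ)} (hφψ : IsTestPair s φ ψ) :
    ‖ψ 0‖ₑ ≤ D * (2 ^ (1 / p) * 2⁻¹) * (∫⁻ x, ‖φ x‖ₑ ^ p) ^ (1 / p) := by
  subst hs
  obtain ⟨Z, hZ, hle⟩ := exists_lintegral_add_affine_le hp0 hp φ
  have hd0 : (0 : ℝ) < d := by exact_mod_cast hd
  set I := ∫⁻ x, ‖φ x‖ₑ ^ p with hI
  have hc : ∀ c : ℝ, 0 < c → 2 * ‖ψ 0‖ₑ ≤
      D * (2 * I + Z * ENNReal.ofReal (c ^ (-((d : ℝ) / 2)))) ^ (1 / p) := by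
    intro c hc
    -- Since `s = d / p`, the normalisation `c ^ (d / p)` cancels the factor `c ^ (-s)` of the
    -- dilated `ψ`, so the values at the origin add up to `2 * ψ 0`.
    have h1 := hφψ.add ((hφψ.affine 0 hc.ne').smul (c ^ (d / p)))
    rw [abs_of_pos hc, smul_smul, ← Real.rpow_add hc, add_neg_cancel, Real.rpow_zero,
      one_smul] at h1
    have h2 := h _ _ h1
    have h3 : (ψ + affine 0 hc.ne' ψ) 0 = 2 * ψ 0 := by
      rw [add_apply, affine_apply, sub_zero, smul_zero, two_mul]
    rw [h3, enorm_mul, Real.enorm_of_nonneg zero_le_two, ENNReal.ofReal_ofNat] at h2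
    exact h2.trans (mul_le_mul_right (ENNReal.rpow_le_rpow (hle c hc) (by positivity)) _)
  have hlim : Tendsto (fun c : ℝ => D * (2 * I + Z * ENNReal.ofReal (c ^ (-((d : ℝ) / 2)))) ^ (1 / p))
      atTop (𝓝 (D * (2 * I) ^ (1 / p))) := by
    have h1 : Tendsto (fun c : ℝ => ENNReal.ofReal (c ^ (-((d : ℝ) / 2)))) atTop (𝓝 0) := by
      have := (ENNReal.continuous_ofReal.tendsto 0).comp
        (tendsto_rpow_neg_atTop (y := (d : ℝ) / 2) (by positivity))
      rwa [ENNReal.ofReal_zero] at this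
    have h2 := (tendsto_const_nhds (x := 2 * I)).add (ENNReal.Tendsto.const_mul h1 (Or.inr hZ))
    rw [mul_zero, add_zero] at h2
    exact ENNReal.Tendsto.const_mul ((ENNReal.continuous_rpow_const.tendsto _).comp h2) (Or.inr hD)
  have h2 : 2 * ‖ψ 0‖ₑ ≤ D * (2 * I) ^ (1 / p) := by
    refine ge_of_tendsto hlim ?_
    filter_upwards [eventually_gt_atTop 0] with c hc' using hc c hc'
  have h3 : 2⁻¹ * (2 * ‖ψ 0‖ₑ) ≤ 2⁻¹ * (D * (2 * I) ^ (1 / p)) := mul_le_mul_right h2 _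
  rw [← mul_assoc, ENNReal.inv_mul_cancel two_ne_zero ENNReal.ofNat_ne_top, one_mul,
    ENNReal.mul_rpow_of_nonneg _ _ (by positivity)] at h3
  refine h3.trans_eq ?_
  ring

/-- Each improvement multiplies the constant by `2 ^ (1 / p - 1)`, less than `1` as `p > 1`.
Iteration gives `ψ 0 = 0` for all test pairs, which a translate of a nonzero pair contradicts. -/
theorem not_forall_enorm_apply_zero_le (hd : 1 ≤ d) (hp1 : 1 < p) (hp : p ≤ 2) (hs : s = d / p)
    {D : ℝ≥0∞} (hD : D ≠ ∞)
    (h : ∀ φ ψ : 𝓢(Rd d, ℝ), IsTestPair s φ ψ → ‖ψ 0‖ₑ ≤ D * (∫⁻ x, ‖φ x‖ₑ ^ p) ^ (1 / p)) :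
    False := by
  have hp0 : 0 < p := by linarith
  set κ : ℝ≥0∞ := 2 ^ (1 / p) * 2⁻¹ with hκ
  have hκ1 : κ < 1 := by
    have h1 : (2 : ℝ≥0∞) ^ (1 / p) < 2 ^ (1 : ℝ) :=
      ENNReal.rpow_lt_rpow_of_exponent_lt ENNReal.one_lt_two ENNReal.ofNat_ne_top
        ((div_lt_one hp0).2 hp1)
    rw [ENNReal.rpow_one] at h1
    rw [hκ, ← div_eq_mul_inv]
    exact ENNReal.div_lt_of_lt_mul (by rwa [one_mul])
  have hn : ∀ n : ℕ, ∀ φ ψ : 𝓢(Rd d, ℝ), IsTestPair s φ ψ →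
      ‖ψ 0‖ₑ ≤ D * κ ^ n * (∫⁻ x, ‖φ x‖ₑ ^ p) ^ (1 / p) := by
    intro n
    induction n with
    | zero => simpa using h
    | succ n ih =>
      intro φ ψ hφψ
      refine (enorm_apply_zero_le_improve hd hp0 hp hs (ENNReal.mul_ne_top hD
        (ENNReal.pow_ne_top (hκ1.trans ENNReal.one_lt_top).ne)) ih hφψ).trans_eq ?_
      rw [pow_succ, ← hκ, mul_assoc D]
  have hzero : ∀ φ ψ : 𝓢(Rd d, ℝ), IsTestPair s φ ψ → ψ 0 = 0 := by
    intro φ ψ hφψ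
    have hI : (∫⁻ x, ‖φ x‖ₑ ^ p) ^ (1 / p) ≠ ∞ :=
      ENNReal.rpow_ne_top_of_nonneg (by positivity) (lintegral_rpow_enorm_ne_top φ hp0)
    have hlim := ENNReal.Tendsto.mul_const (b := (∫⁻ x, ‖φ x‖ₑ ^ p) ^ (1 / p))
      (ENNReal.Tendsto.const_mul (a := D) (ENNReal.tendsto_pow_atTop_nhds_zero_of_lt_one hκ1)
        (Or.inr hD)) (Or.inr hI)
    rw [mul_zero, zero_mul] at hlim
    exact enorm_eq_zero.1 (le_antisymm (ge_of_tendsto' hlim fun n => hn n φ ψ hφψ) zero_le)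
  obtain ⟨φ, ψ, hφψ, x, hx⟩ := exists_isTestPair_ne_zero hd s
  have h1 := hφψ.affine (-x) one_ne_zero
  rw [abs_one, Real.one_rpow, one_smul] at h1
  have h2 := hzero _ _ h1
  rw [affine_apply, one_smul, zero_sub, neg_neg] at h2
  exact hx h2

end

section Necessity

variable {Ω : Type*} [MeasurableSpace Ω] {Pr : Measure Ω}
  [IsProbabilityMeasure Pr] {γ : ℕ → Ω → ℝ} {d : ℕ}
  {e : HilbertBasis ℕ ℝ (Lp ℝ 2 (volume : Measure (Rd d)))} {s : ℝ} {η q : ℝ≥0}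
  {hη : (2 : ℝ≥0∞) ≤ η} [Fact ((1 : ℝ≥0∞) ≤ q)] {C : ℝ≥0}

/-- By continuity, averages over small balls detect the value at the centre. -/
theorem enorm_apply_zero_le_of_setLIntegral_ball {ψ : 𝓢(Rd d, ℝ)} {D : ℝ≥0∞}
    (h : ∀ r : ℝ, 0 < r → ∫⁻ y in Metric.ball 0 r, ‖ψ y‖ₑ ^ (2 : ℝ) ≤
      D ^ (2 : ℝ) * volume (Metric.ball (0 : Rd d) r)) : ‖ψ 0‖ₑ ≤ D := by
  by_contra! hlt
  obtain ⟨D', hD, hD'⟩ := exists_between hlt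
  have hcont : Continuous fun y => ‖ψ y‖ₑ := ψ.continuous.enorm
  obtain ⟨r, hr, hball⟩ := Metric.eventually_nhds_iff_ball.1
    (hcont.continuousAt.eventually (lt_mem_nhds hD'))
  have hv0 := (Metric.measure_ball_pos (volume : Measure (Rd d)) 0 hr).ne'
  have hvt : volume (Metric.ball (0 : Rd d) r) ≠ ∞ := measure_ball_lt_top.ne
  have h1 : D' ^ (2 : ℝ) * volume (Metric.ball (0 : Rd d) r) ≤
      ∫⁻ y in Metric.ball 0 r, ‖ψ y‖ₑ ^ (2 : ℝ) := by
    rw [← setLIntegral_const]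
    exact setLIntegral_mono' measurableSet_ball fun y hy =>
      ENNReal.rpow_le_rpow (hball y hy).le zero_le_two
  have h2 := (ENNReal.mul_le_mul_iff_left hv0 hvt).1 (h1.trans (h r hr))
  exact absurd ((ENNReal.rpow_le_rpow_iff zero_lt_two).1 h2) (not_le.2 hD)

/-- If `η = 2`, the scaling identity reads `s = d / p` with `p = q'`, and the single-pair bound
becomes proportional to the volume of `E`. Balls shrinking to the origin then bound `ψ 0` by
`‖φ‖_p`, which is impossible. -/
theorem MulGammaBound.two_lt_of_scaling (hC : MulGammaBound Pr γ e s hη q C)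
    (hγ : IsGaussianSeq Pr γ) (hd : 1 ≤ d) (hηq : η < q)
    (hsc : s / d + 1 / q = 1 / η + 1 / 2) : 2 < η := by
  have hη2 : 2 ≤ η := by exact_mod_cast hη
  refine lt_of_le_of_ne hη2 ?_
  rintro rfl
  have hq2 : (2 : ℝ) < q := by exact_mod_cast hηq
  have hd0 : (0 : ℝ) < d := by exact_mod_cast hd
  have hqp := Real.HolderConjugate.conjExponent (p := (q : ℝ)) (by linarith)
  set p := (q : ℝ).conjExponent with hp
  have hpq := hqp.symm
  have hinv := hpq.inv_add_inv_eq_one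
  have hq' : (q : ℝ)⁻¹ < 2⁻¹ := inv_strictAnti₀ two_pos hq2
  have hp2 : p ≤ 2 := by
    refine (inv_le_inv₀ two_pos hpq.pos).1 ?_
    linarith
  have hs : s = d / p := by
    have : s / d = p⁻¹ := by
      simp only [one_div, NNReal.coe_ofNat] at hsc
      linarith
    rw [div_eq_iff hd0.ne'] at this
    rw [this, mul_comm, div_eq_mul_inv]
  refine not_forall_enorm_apply_zero_le hd hpq.lt hp2 hs (D := C) ENNReal.coe_ne_top
    fun φ ψ hφψ => ?_
  refine enorm_apply_zero_le_of_setLIntegral_ball fun r hr => ?_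
  refine (hC.setLIntegral_le hγ hpq hφψ measurableSet_ball measure_ball_lt_top.ne).trans_eq ?_
  rw [NNReal.coe_ofNat, ← mul_assoc, ENNReal.mul_rpow_of_nonneg _ _ zero_le_two, ← ENNReal.rpow_mul,
    one_div_mul_cancel two_ne_zero, ENNReal.rpow_one, mul_comm (C : ℝ≥0∞)]

theorem MulGammaBound.sharpExponents (hC : MulGammaBound Pr γ e s hη q C)
    (hγ : IsGaussianSeq Pr γ) (hd : 1 ≤ d) (hq : (2 : ℝ≥0∞) ≤ q) : SharpExponents d s η q := by
  have hq2 : (2 : ℝ) ≤ q := by exact_mod_cast hq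
  have hd0 : (0 : ℝ) < d := by exact_mod_cast hd
  have hpq := (Real.HolderConjugate.conjExponent (p := (q : ℝ)) (by linarith)).symm
  have hsc := hC.scaling hγ hd hpq
  have hηq : η < q := lt_of_le_of_ne (hC.le_of_scaling hγ hd hq) (hC.ne_of_scaling hγ hd hq hsc)
  have hη2 := hC.two_lt_of_scaling hγ hd hηq hsc
  have hη2' : (2 : ℝ) < η := by exact_mod_cast hη2
  have hηq' : (η : ℝ) < q := by exact_mod_cast hηq
  have h1 : 1 / (q : ℝ) < 1 / η := one_div_lt_one_div_of_lt (by linarith) hηq'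
  have h2 : 1 / (η : ℝ) < 1 / 2 := one_div_lt_one_div_of_lt two_pos hη2'
  have h3 : 0 < 1 / (q : ℝ) := by positivity
  have h4 : 1 / 2 < s / d := by linarith
  have h5 : s / d < 1 := by linarith
  rw [lt_div_iff₀ hd0] at h4
  rw [div_lt_one hd0] at h5
  exact ⟨hsc, ⟨by linarith, h5⟩, hη2, hηq⟩

end Necessity

end HomSob

end

theorem mainTheorem5 (d : ℕ) (hd : 1 ≤ d) (s : ℝ) (hs : 0 ≤ s) (η q : ℝ≥0)
    (hη : (2 : ℝ≥0∞) ≤ η) (hq : (2 : ℝ≥0∞) ≤ q) [Fact ((1 : ℝ≥0∞) ≤ q)] :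
    (∀ (Ω : Type*) [MeasurableSpace Ω] (Pr : Measure Ω) [IsProbabilityMeasure Pr]
        (γ : ℕ → Ω → ℝ) (_ : HomSob.IsGaussianSeq Pr γ)
        (e : HilbertBasis ℕ ℝ (Lp ℝ 2 (volume : Measure (HomSob.Rd d)))),
        (∃ C : ℝ≥0, HomSob.MulGammaBound Pr γ e s hη q C) ↔ HomSob.SharpExponents d s η q) ∧
    (HomSob.SharpExponents d s η q → ∃ C : ℝ≥0,
      ∀ (Ω : Type*) [MeasurableSpace Ω] (Pr : Measure Ω) [IsProbabilityMeasure Pr]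
        (γ : ℕ → Ω → ℝ) (_ : HomSob.IsGaussianSeq Pr γ)
        (e : HilbertBasis ℕ ℝ (Lp ℝ 2 (volume : Measure (HomSob.Rd d)))),
        HomSob.MulGammaBound Pr γ e s hη q C) := by
  refine ⟨fun Ω _ Pr _ γ hγ e => ⟨fun ⟨C, hC⟩ => hC.sharpExponents hγ hd hq, fun h => ?_⟩,
    fun h => HomSob.mulGammaBound_of_sharp hd hη hq h⟩
  obtain ⟨C, hC⟩ := HomSob.mulGammaBound_of_sharp hd hη hq h
  exact ⟨C, hC Ω Pr γ hγ e⟩
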